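/- **Theorem 2.1 (Positive definite Hessian).** Let $d\ge 1$ and let $\Omega\subset\mathbb R^d$ be a polyhedral domain: a nonempty connected open set that is the interior of its closure and whose closure is a finite union of closed $d$-simplices. Let $\hat K$ be a reference $d$-simplex with $|\hat K|=1$. Let $\mathcal L v=-\nabla\cdot(A\nabla v)+b\cdot\nabla v+cv$ with $A,b,c\in L^\infty(\Omega)$ be elliptic: $A$ is uniformly positive definite, and the bilinear form $a(v,w)=\int_\Omega (A\nabla v\cdot\nabla w+(b\cdot\nabla v)\,w+c\,v\,w)\,dx$ is coercive on $H^1_0(\Omega)$. Then there is a constant $C>0$, depending only on $d$, $\hat K$, $\Omega$ and $\mathcal L$, such that the following holds. Let $f\in L^2(\Omega)$, let $g$ be a function on $\partial\Omega$, and let $u\in H^2(\Omega)$ be a solution of $$\mathcal L u=f \text{ in } \Omega,\qquad u=g \text{ on } \partial\Omega,$$ that is, $a(u,\varphi)=\int_\Omega f\varphi\,dx$ for all $\varphi\in C_c^\infty(\Omega)$ and $u(x)\to g(z)$ as $\Omega\ni x\to z$ for every $z\in\partial\Omega$. Let $H$ be the (weak) Hessian of $u$, and assume that it is uniformly positive definite: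 $H(x)\ge\gamma I$ for a.e. $x\in\Omega$, with some $\gamma>0$ (for symmetric matrices, $\ge$ means that the difference is positive semidefinite). Let $\mathcal T_h$ be a conforming simplicial mesh of $\Omega$ with $N$ elements, let $F_K$ be an affine map of $\hat K$ onto $K$ with Jacobian matrix $F_K'$, for every $K\in\mathcal T_h$, and let $u_h$ be a linear finite element solution on $\mathcal T_h$: $u_h$ is continuous and piecewise affine, $u_h=g$ at the mesh vertices on $\partial\Omega$, and $a(u_h,v_h)=\int_\Omega f v_h\,dx$ for all continuous piecewise affine $v_h$ that vanish on $\partial\Omega$. Let $R$ be an integrable symmetric-matrix-valued function (the recovered Hessian), uniformly positive definite in $\Omega$, and let $R_K=\frac1{|K|}\int_K R\,dx$ be its average over $K$. Assume that, with element-wise constants $C_{R-,K}$, $C_{R+,K}$ and constants $C_{R-},C_{R+}>0$, $$C_{R-,K}\,I\le R_K^{-1}H(x)\le C_{R+,K}\,I\qquad\text{for a.e. } x\in K \text{ and all } K\in\mathcal T_h$$ (that is, the eigenvalues of $R_K^{-1}H(x)$ lie in $[C_{R-,K},C_{R+,K}]$), and $$C_{R-}\le\min_{K}C_{R-,K},\qquad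 \sqrt{\frac1N\sum_{K}C_{R+,K}^2}\le C_{R+}.$$ Assume finally that the mesh is quasi-$M$-uniform for the metric tensor $$M_K=\det(R_K)^{-\frac1{d+2}}\,\|R_K\|_2^{\frac2{d+2}}\,R_K,$$ that is, for some constants $C_{eq},C_{ali}\ge1$ and all $K\in\mathcal T_h$, $$|K|\det(M_K)^{\frac12}\le \frac{C_{eq}}{N}\sum_{\tilde K\in\mathcal T_h}|\tilde K|\det(M_{\tilde K})^{\frac12},\qquad \frac1d\operatorname{tr}\bigl((F_K')^TM_KF_K'\bigr)\le C_{ali}\,|K|^{\frac2d}\det(M_K)^{\frac1d}.$$ Then $$|u-u_h|_{H^1(\Omega)}\le C\; C_{ali}^{\frac{d+1}2}\,C_{eq}^{\frac{d+2}{2d}}\,\frac{C_{R+}}{C_{R-}}\,N^{-\frac1d}\,\bigl\|\det(H)^{\frac1d}H\bigr\|_{L^{\frac d{d+2}}(\Omega)}^{\frac12},$$ where $|\cdot|_{H^1(\Omega)}$ is the $L^2(\Omega)$ norm of the gradient, and the last norm is $\bigl(\int_\Omega\|\det(H)^{1/d}H\|_2^{d/(d+2)}dx\bigr)^{(d+2)/d}$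 with the spectral norm $\|\cdot\|_2$. -/

import Mathlib

open MeasureTheory Set Filter Topology
open scoped Matrix ContDiff ENNReal Matrix.Norms.L2Operator

noncomputable section

/-- `ℝᵈ` with the Euclidean norm. -/
abbrev Euc (d : ℕ) : Type := EuclideanSpace ℝ (Fin d)

/-! ### Simplices, polyhedral domains, simplicial meshes -/

/-- `s` is the vertex set of a nondegenerate `d`-simplex in `ℝᵈ`. -/
def IsSimplex {d : ℕ} (s : Finset (Euc d)) : Prop :=
  s.card = d + 1 ∧ AffineIndependent ℝ ((↑) : s → Euc d)

/-- The closed simplex with vertex set `s`. -/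
def cell {d : ℕ} (s : Finset (Euc d)) : Set (Euc d) := convexHull ℝ (s : Set (Euc d))

/-- A (bounded) polyhedral domain: a connected nonempty open set whose closure is a finite union of
closed simplices and which is the interior of its closure (no slits or punctures). -/
structure IsPolyhedralDomain {d : ℕ} (Ω : Set (Euc d)) : Prop where
  isOpen : IsOpen Ω
  isConnected : IsConnected Ω
  interior_closure : interior (closure Ω) = Ω
  polyhedral : ∃ S : Finset (Finset (Euc d)), (∀ s ∈ S, IsSimplex s) ∧
    closure Ω = ⋃ s ∈ S, cell s

/-- A conforming simplicial mesh of `Ω`; elements are given by their vertex sets. -/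
structure SimplicialMesh {d : ℕ} (Ω : Set (Euc d)) where
  elems : Finset (Finset (Euc d))
  isSimplex : ∀ s ∈ elems, IsSimplex s
  /-- Two elements meet in the (possibly empty) common face spanned by their common vertices. -/
  conforming : ∀ s ∈ elems, ∀ t ∈ elems,
    cell s ∩ cell t = convexHull ℝ ((s : Set (Euc d)) ∩ (t : Set (Euc d)))
  cover : closure Ω = ⋃ s ∈ elems, cell s

namespace SimplicialMesh

variable {d : ℕ} {Ω : Set (Euc d)}

/-- The number `N` of elements. -/
def numElems (T : SimplicialMesh Ω) : ℕ := T.elems.card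

/-- The mesh vertices. -/
def vertices (T : SimplicialMesh Ω) : Set (Euc d) := {z | ∃ s ∈ T.elems, z ∈ s}

/-- The linear finite element space: functions that are affine on every closed element (and hence
continuous on the closure of `Ω`). -/
def feSpace (T : SimplicialMesh Ω) : Set (Euc d → ℝ) :=
  {v | ∀ s ∈ T.elems, ∃ p : Euc d →ᵃ[ℝ] ℝ, EqOn v p (cell s)}

/-- The finite element functions that vanish on the boundary. -/
def feSpaceZero (T : SimplicialMesh Ω) : Set (Euc d → ℝ) :=
  {v | v ∈ T.feSpace ∧ ∀ x ∈ frontier Ω, v x = 0}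

/-- `F` assigns to every element an affine map of the reference simplex `Khat` onto that element. -/
def IsReferenceMap (T : SimplicialMesh Ω) (Khat : Finset (Euc d))
    (F : Finset (Euc d) → Euc d →ᵃ[ℝ] Euc d) : Prop :=
  ∀ s ∈ T.elems, F s '' cell Khat = cell s

end SimplicialMesh

/-- The (constant) Jacobian matrix of an affine map of `ℝᵈ`. -/
def jacobian {d : ℕ} (F : Euc d →ᵃ[ℝ] Euc d) : Matrix (Fin d) (Fin d) ℝ :=
  LinearMap.toMatrix (EuclideanSpace.basisFun (Fin d) ℝ).toBasis
    (EuclideanSpace.basisFun (Fin d) ℝ).toBasis F.linear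

/-! ### Weak derivatives -/

/-- Smooth functions with compact support in `Ω`. -/
def testFunctions {d : ℕ} (Ω : Set (Euc d)) : Set (Euc d → ℝ) :=
  {φ | ContDiff ℝ ∞ φ ∧ HasCompactSupport φ ∧ tsupport φ ⊆ Ω}

/-- `g` is the weak partial derivative `∂ᵢ f` in `Ω`. -/
def HasWeakPartial {d : ℕ} (Ω : Set (Euc d)) (i : Fin d) (f g : Euc d → ℝ) : Prop :=
  ∀ φ ∈ testFunctions Ω,
    ∫ x in Ω, f x * gradient φ x i = -∫ x in Ω, g x * φ x

/-- `u ∈ H²(Ω)` with weak gradient `Du` and weak Hessian `H`. -/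
structure IsH2 {d : ℕ} (Ω : Set (Euc d)) (u : Euc d → ℝ) (Du : Euc d → Euc d)
    (H : Euc d → Matrix (Fin d) (Fin d) ℝ) : Prop where
  memLp : MemLp u 2 (volume.restrict Ω)
  memLp_grad : ∀ i, MemLp (fun x => Du x i) 2 (volume.restrict Ω)
  memLp_hess : ∀ i j, MemLp (fun x => H x i j) 2 (volume.restrict Ω)
  weak_grad : ∀ i, HasWeakPartial Ω i u (fun x => Du x i)
  weak_hess : ∀ i j, HasWeakPartial Ω j (fun x => Du x i) (fun x => H x i j)

/-! ### The boundary value problem and its finite element discretization -/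

/-- The coefficients of the operator `ℒ u = -div (A ∇u) + b · ∇u + c u`. -/
structure SecondOrderOperator (d : ℕ) where
  A : Euc d → (Euc d →L[ℝ] Euc d)
  b : Euc d → Euc d
  c : Euc d → ℝ

/-- The bilinear form `∫_Ω (A ∇v · ∇w + (b · ∇v) w + c v w)` of the operator, where `Dv` is the
gradient of `v`, and `w` is differentiable almost everywhere. -/
def SecondOrderOperator.form {d : ℕ} (L : SecondOrderOperator d) (Ω : Set (Euc d))
    (v : Euc d → ℝ) (Dv : Euc d → Euc d) (w : Euc d → ℝ) : ℝ :=
  ∫ x in Ω, (inner ℝ (L.A x (Dv x)) (gradient w x) + inner ℝ (L.b x) (Dv x) * w x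
    + L.c x * v x * w x)

/-- `ℒ` is elliptic on `Ω`: its coefficients are bounded and measurable, its principal part is
uniformly elliptic and its bilinear form is `H¹₀(Ω)`-elliptic (coercivity is stated on the dense
subspace of test functions). -/
structure SecondOrderOperator.IsElliptic {d : ℕ} (L : SecondOrderOperator d)
    (Ω : Set (Euc d)) : Prop where
  memLp_A : MemLp L.A ∞ (volume.restrict Ω)
  memLp_b : MemLp L.b ∞ (volume.restrict Ω)
  memLp_c : MemLp L.c ∞ (volume.restrict Ω)
  uniformly_elliptic : ∃ θ > (0 : ℝ), ∀ᵐ x ∂(volume.restrict Ω), ∀ ξ : Euc d,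
    θ * ‖ξ‖ ^ 2 ≤ inner ℝ (L.A x ξ) ξ
  coercive : ∃ α > (0 : ℝ), ∀ φ ∈ testFunctions Ω,
    α * ∫ x in Ω, (φ x ^ 2 + ‖gradient φ x‖ ^ 2) ≤ L.form Ω φ (gradient φ) φ

/-- `u` (with weak gradient `Du`) solves `ℒ u = f` in `Ω` weakly, and `u = g` on `∂Ω`, the boundary
values being attained as limits from inside. -/
structure IsBVPSolution {d : ℕ} (L : SecondOrderOperator d) (Ω : Set (Euc d))
    (f g u : Euc d → ℝ) (Du : Euc d → Euc d) : Prop where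
  weak_form : ∀ φ ∈ testFunctions Ω, L.form Ω u Du φ = ∫ x in Ω, f x * φ x
  boundary : ∀ z ∈ frontier Ω, Tendsto u (𝓝[Ω] z) (𝓝 (g z))

/-- `uh` is a linear finite element solution of `ℒ u = f` in `Ω`, `u = g` on `∂Ω`: it interpolates
`g` at the boundary vertices and satisfies the Galerkin equations. Finite element functions are
differentiable off the element boundaries, hence almost everywhere. -/
structure IsFESolution {d : ℕ} (L : SecondOrderOperator d) {Ω : Set (Euc d)}
    (T : SimplicialMesh Ω) (f g uh : Euc d → ℝ) : Prop where
  mem : uh ∈ T.feSpace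
  boundary : ∀ z ∈ T.vertices, z ∈ frontier Ω → uh z = g z
  galerkin : ∀ v ∈ T.feSpaceZero, L.form Ω uh (gradient uh) v = ∫ x in Ω, f x * v x

/-! ### Metric tensor and quasi-`M`-uniform meshes -/

/-- The average of a matrix-valued function over an element. -/
def cellAverage {d : ℕ} (R : Euc d → Matrix (Fin d) (Fin d) ℝ) (s : Finset (Euc d)) :
    Matrix (Fin d) (Fin d) ℝ :=
  Matrix.of fun i j => ⨍ x in cell s, R x i j

/-- The metric tensor `det(S)^{-1/(d+2)} ‖S‖₂^{2/(d+2)} S`, with the spectral norm. -/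
def metricTensor {d : ℕ} (S : Matrix (Fin d) (Fin d) ℝ) : Matrix (Fin d) (Fin d) ℝ :=
  (S.det ^ (-(1 : ℝ) / (d + 2)) * ‖S‖ ^ ((2 : ℝ) / (d + 2))) • S

/-- The mesh is quasi-`M`-uniform for the elementwise metric tensor `M`, with equidistribution
constant `Ceq` and alignment constant `Cali`. -/
structure IsQuasiMUniform {d : ℕ} {Ω : Set (Euc d)} (T : SimplicialMesh Ω)
    (F : Finset (Euc d) → Euc d →ᵃ[ℝ] Euc d) (M : Finset (Euc d) → Matrix (Fin d) (Fin d) ℝ)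
    (Ceq Cali : ℝ) : Prop where
  one_le_Ceq : 1 ≤ Ceq
  one_le_Cali : 1 ≤ Cali
  equidistribution : ∀ s ∈ T.elems,
    volume.real (cell s) * (M s).det ^ ((1 : ℝ) / 2) ≤
      Ceq * (1 / (T.numElems : ℝ) *
        ∑ t ∈ T.elems, volume.real (cell t) * (M t).det ^ ((1 : ℝ) / 2))
  alignment : ∀ s ∈ T.elems,
    1 / (d : ℝ) * ((jacobian (F s))ᵀ * M s * jacobian (F s)).trace ≤
      Cali * volume.real (cell s) ^ ((2 : ℝ) / d) * (M s).det ^ ((1 : ℝ) / d)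

/-- The closeness condition `Cm I ≤ S⁻¹ H(x) ≤ Cp I` for almost every `x` in the element `s`.
For positive definite `S` and symmetric `H(x)` the matrix `S⁻¹ H(x)` is similar to the symmetric
matrix `S^{-1/2} H(x) S^{-1/2}`, and the inequalities are bounds on its eigenvalues. -/
def IsClose {d : ℕ} (S : Matrix (Fin d) (Fin d) ℝ) (H : Euc d → Matrix (Fin d) (Fin d) ℝ)
    (s : Finset (Euc d)) (Cm Cp : ℝ) : Prop :=
  ∀ᵐ x ∂(volume.restrict (cell s)), spectrum ℝ (S⁻¹ * H x) ⊆ Icc Cm Cp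

end

/-!
By Céa's lemma it suffices to bound the error of the piecewise linear interpolant of `u`. On an
element, the difference of the interpolant and the first order Taylor polynomial of `u` at a point
is an affine function whose vertex values are second order remainders. Since `0 ≤ H ≤ C_{R+,K} R_K`,
these lie between `0` and `C_{R+,K}` times the values of the quadratic form of `R_K` on the edges,
which the alignment condition controls through `tr (F_K'ᵀ R_K F_K')`. The resulting elementwise
bounds are powers of `|K| det(M_K)^{1/2}`; equidistribution allows their summation, and the lower
bound `C_{R-} R_K ≤ H` compares `∑ |K| det(M_K)^{1/2}` with the norm of `det(H)^{1/d} H`. The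
remainders of `u`, which is only weakly differentiable, are estimated by mollification.
-/

/-! ### Quadratic forms of real matrices -/

/-- The quadratic form `vᵀ S v` of a real square matrix on the Euclidean space. -/
noncomputable def quadForm {n : Type*} [Fintype n] [DecidableEq n] (S : Matrix n n ℝ)
    (v : EuclideanSpace ℝ n) : ℝ :=
  inner ℝ v (Matrix.toEuclideanCLM (𝕜 := ℝ) S v)

lemma posSemidef_of_sub_smul_one {n : Type*} [DecidableEq n] {S : Matrix n n ℝ} {c : ℝ}
    (hc : 0 ≤ c) (h : (S - c • 1).PosSemidef) : S.PosSemidef := by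
  simpa using h.add (Matrix.PosSemidef.one.smul hc)

lemma exists_eq_transpose_mul_self {n : Type*} [Fintype n] {S : Matrix n n ℝ}
    (hS : S.PosSemidef) : ∃ Q : Matrix n n ℝ, S = Qᵀ * Q := by
  classical
  open scoped MatrixOrder in
  obtain ⟨Q, hQ⟩ := CStarAlgebra.nonneg_iff_eq_star_mul_self.mp hS.nonneg
  exact ⟨Q, by simpa [Matrix.star_eq_conjTranspose] using hQ⟩

section QuadForm

variable {n : Type*} [Fintype n] [DecidableEq n] {S H G Q : Matrix n n ℝ} {a b c : ℝ}

lemma quadForm_eq_dotProduct (S : Matrix n n ℝ) (v : EuclideanSpace ℝ n) :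
    quadForm S v = v.ofLp ⬝ᵥ S *ᵥ v.ofLp :=
  Matrix.inner_toEuclideanCLM S v v

lemma quadForm_eq_sum (S : Matrix n n ℝ) (v : EuclideanSpace ℝ n) :
    quadForm S v = ∑ i, ∑ j, S i j * v i * v j := by
  simp only [quadForm_eq_dotProduct, dotProduct, Matrix.mulVec, Finset.mul_sum]
  exact Finset.sum_congr rfl fun i _ => Finset.sum_congr rfl fun j _ => by ring

lemma quadForm_sub (S H : Matrix n n ℝ) (v : EuclideanSpace ℝ n) :
    quadForm (S - H) v = quadForm S v - quadForm H v := by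
  simp [quadForm, inner_sub_right]

lemma quadForm_smul_one (c : ℝ) (v : EuclideanSpace ℝ n) :
    quadForm (c • 1 : Matrix n n ℝ) v = c * ‖v‖ ^ 2 := by
  simp [quadForm, inner_smul_right]

lemma quadForm_smul (c : ℝ) (S : Matrix n n ℝ) (v : EuclideanSpace ℝ n) :
    quadForm (c • S) v = c * quadForm S v := by
  simp [quadForm, inner_smul_right]

lemma continuous_quadForm (S : Matrix n n ℝ) : Continuous (quadForm S) := by
  unfold quadForm
  fun_prop

lemma quadForm_nonneg (hS : S.PosSemidef) (v : EuclideanSpace ℝ n) : 0 ≤ quadForm S v := by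
  simpa [quadForm_eq_dotProduct] using hS.dotProduct_mulVec_nonneg v.ofLp

lemma quadForm_transpose_mul_mul (S Q : Matrix n n ℝ) (v : EuclideanSpace ℝ n) :
    quadForm (Qᵀ * S * Q) v = quadForm S (Matrix.toEuclideanCLM (𝕜 := ℝ) Q v) := by
  simp only [quadForm_eq_dotProduct, ← Matrix.mulVec_mulVec, Matrix.ofLp_toEuclideanCLM]
  rw [Matrix.dotProduct_mulVec, Matrix.vecMul_transpose]

lemma quadForm_transpose_mul_self (Q : Matrix n n ℝ) (v : EuclideanSpace ℝ n) :
    quadForm (Qᵀ * Q) v = ‖Matrix.toEuclideanCLM (𝕜 := ℝ) Q v‖ ^ 2 := by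
  simpa using (quadForm_transpose_mul_mul 1 Q v).trans
    (by simpa using quadForm_smul_one 1 (Matrix.toEuclideanCLM (𝕜 := ℝ) Q v))

lemma norm_toEuclideanCLM_apply_le (S : Matrix n n ℝ) (v : EuclideanSpace ℝ n) :
    ‖Matrix.toEuclideanCLM (𝕜 := ℝ) S v‖ ≤ ‖S‖ * ‖v‖ :=
  ContinuousLinearMap.le_opNorm _ _

lemma abs_quadForm_le (S : Matrix n n ℝ) (v : EuclideanSpace ℝ n) :
    |quadForm S v| ≤ ‖S‖ * ‖v‖ ^ 2 :=
  calc |quadForm S v| ≤ ‖v‖ * ‖Matrix.toEuclideanCLM (𝕜 := ℝ) S v‖ := abs_real_inner_le_norm _ _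
    _ ≤ ‖v‖ * (‖S‖ * ‖v‖) := by
      gcongr
      exact norm_toEuclideanCLM_apply_le S v
    _ = ‖S‖ * ‖v‖ ^ 2 := by ring

lemma quadForm_le_opNorm (S : Matrix n n ℝ) (v : EuclideanSpace ℝ n) :
    quadForm S v ≤ ‖S‖ * ‖v‖ ^ 2 :=
  (le_abs_self _).trans (abs_quadForm_le S v)

lemma opNorm_le_of_quadForm_le (hS : S.PosSemidef) (hc : 0 ≤ c)
    (h : ∀ v, quadForm S v ≤ c * ‖v‖ ^ 2) : ‖S‖ ≤ c := by
  obtain ⟨Q, rfl⟩ := exists_eq_transpose_mul_self hS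
  have hQ : ‖Q‖ ≤ √c := by
    rw [Matrix.cstar_norm_def]
    refine ContinuousLinearMap.opNorm_le_bound _ (Real.sqrt_nonneg _) fun v => ?_
    refine abs_le_of_sq_le_sq' ?_ (by positivity) |>.2
    rw [mul_pow, Real.sq_sqrt hc, ← quadForm_transpose_mul_self]
    exact h v
  calc ‖Qᵀ * Q‖ = ‖Q‖ * ‖Q‖ := by simpa using Matrix.l2_opNorm_conjTranspose_mul_self Q
    _ ≤ √c * √c := by gcongr
    _ = c := Real.mul_self_sqrt hc

lemma mul_norm_sq_le_quadForm (h : (S - c • 1).PosSemidef) (v : EuclideanSpace ℝ n) :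
    c * ‖v‖ ^ 2 ≤ quadForm S v := by
  simpa [quadForm_sub, quadForm_smul_one] using quadForm_nonneg h v

lemma posDef_of_mul_norm_sq_le (hS : S.IsHermitian) (hc : 0 < c)
    (h : ∀ v, c * ‖v‖ ^ 2 ≤ quadForm S v) : S.PosDef := by
  refine .of_dotProduct_mulVec_pos hS fun x hx => ?_
  have hx' : WithLp.toLp 2 x ≠ 0 := by simpa using hx
  have := (show 0 < c * ‖WithLp.toLp 2 x‖ ^ 2 by positivity).trans_le (h (WithLp.toLp 2 x))
  simpa [quadForm_eq_dotProduct] using this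

lemma mul_norm_sq_le_quadForm_of_spectrum (hG : G.IsHermitian)
    (h : ∀ t ∈ spectrum ℝ G, a ≤ t) (v : EuclideanSpace ℝ n) : a * ‖v‖ ^ 2 ≤ quadForm G v := by
  open scoped MatrixOrder in
  have := (algebraMap_le_iff_le_spectrum (ha := hG.isSelfAdjoint)).2 h
  exact mul_norm_sq_le_quadForm (by rwa [Matrix.le_iff, Algebra.algebraMap_eq_smul_one] at this) v

lemma quadForm_le_of_spectrum (hG : G.IsHermitian)
    (h : ∀ t ∈ spectrum ℝ G, t ≤ b) (v : EuclideanSpace ℝ n) : quadForm G v ≤ b * ‖v‖ ^ 2 := by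
  open scoped MatrixOrder in
  have := (le_algebraMap_iff_spectrum_le (ha := hG.isSelfAdjoint)).2 h
  rw [Matrix.le_iff, Algebra.algebraMap_eq_smul_one] at this
  simpa [quadForm_sub, quadForm_smul_one] using quadForm_nonneg this v

/-- With `S = Qᵀ Q`, the matrix `S⁻¹ H` is similar to the symmetric matrix `G = Q⁻ᵀ H Q⁻¹`. -/
lemma exists_congr_spectrum (hS : S.PosDef) (hH : H.IsHermitian) :
    ∃ Q G : Matrix n n ℝ, S = Qᵀ * Q ∧ G.IsHermitian ∧ H = Qᵀ * G * Q ∧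
      spectrum ℝ G = spectrum ℝ (S⁻¹ * H) := by
  obtain ⟨Q, rfl⟩ := exists_eq_transpose_mul_self hS.posSemidef
  have hdet : IsUnit Q.det := by
    refine isUnit_iff_ne_zero.2 fun h => hS.det_pos.ne' ?_
    rw [Matrix.det_mul, h, mul_zero]
  have hdetT : IsUnit Qᵀ.det := by rwa [Matrix.det_transpose]
  refine ⟨Q, (Qᵀ)⁻¹ * H * Q⁻¹, rfl, ?_, ?_, ?_⟩
  · simpa [Matrix.transpose_nonsing_inv] using
      Matrix.isHermitian_conjTranspose_mul_mul (Q⁻¹) hH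
  · simp only [Matrix.mul_assoc, Matrix.nonsing_inv_mul _ hdet, Matrix.mul_one,
      Matrix.mul_nonsing_inv_cancel_left _ _ hdetT]
  · obtain ⟨U, rfl⟩ := (Matrix.isUnit_iff_isUnit_det Q).2 hdet
    rw [← spectrum.units_conjugate (R := ℝ) (a := ((U : Matrix n n ℝ)ᵀ * U)⁻¹ * H) (u := U),
      Matrix.mul_inv_rev, Matrix.coe_units_inv]
    simp only [Matrix.mul_assoc, Matrix.mul_nonsing_inv_cancel_left _ _ hdet]

lemma quadForm_bounds_of_spectrum (hS : S.PosDef) (hH : H.IsHermitian)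
    (h : spectrum ℝ (S⁻¹ * H) ⊆ Icc a b) (v : EuclideanSpace ℝ n) :
    a * quadForm S v ≤ quadForm H v ∧ quadForm H v ≤ b * quadForm S v := by
  obtain ⟨Q, G, rfl, hG, rfl, hsp⟩ := exists_congr_spectrum hS hH
  rw [← hsp] at h
  rw [quadForm_transpose_mul_self, quadForm_transpose_mul_mul]
  exact ⟨mul_norm_sq_le_quadForm_of_spectrum hG (fun t ht => (h ht).1) _,
    quadForm_le_of_spectrum hG (fun t ht => (h ht).2) _⟩

lemma le_of_spectrum_subset_Icc [Nonempty n] (hS : S.PosDef) (hH : H.IsHermitian)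
    (h : spectrum ℝ (S⁻¹ * H) ⊆ Icc a b) : a ≤ b := by
  obtain ⟨_, G, -, hG, -, hsp⟩ := exists_congr_spectrum hS hH
  have := h (hsp ▸ hG.eigenvalues_mem_spectrum_real (Classical.arbitrary n))
  exact this.1.trans this.2

lemma opNorm_le_of_spectrum (hS : S.PosDef) (hH : H.PosSemidef) (hb : 0 ≤ b)
    (h : spectrum ℝ (S⁻¹ * H) ⊆ Icc a b) : ‖H‖ ≤ b * ‖S‖ := by
  refine opNorm_le_of_quadForm_le hH (by positivity) fun v => ?_
  calc quadForm H v ≤ b * quadForm S v := (quadForm_bounds_of_spectrum hS hH.1 h v).2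
    _ ≤ b * (‖S‖ * ‖v‖ ^ 2) := by
      gcongr
      exact quadForm_le_opNorm S v
    _ = b * ‖S‖ * ‖v‖ ^ 2 := by ring

lemma pow_mul_det_le_of_spectrum (hS : S.PosDef) (hH : H.IsHermitian) (ha : 0 ≤ a)
    (h : ∀ t ∈ spectrum ℝ (S⁻¹ * H), a ≤ t) : a ^ Fintype.card n * S.det ≤ H.det := by
  obtain ⟨Q, G, rfl, hG, rfl, hsp⟩ := exists_congr_spectrum hS hH
  rw [← hsp] at h
  have hdet : a ^ Fintype.card n ≤ G.det := by
    rw [hG.det_eq_prod_eigenvalues, ← Finset.card_univ, ← Finset.prod_const]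
    exact Finset.prod_le_prod (fun _ _ => ha) fun i _ =>
      h _ (hG.eigenvalues_mem_spectrum_real i)
  simp only [Matrix.det_mul, Matrix.det_transpose]
  calc a ^ Fintype.card n * (Q.det * Q.det) ≤ G.det * (Q.det * Q.det) := by
        gcongr
        exact mul_self_nonneg _
    _ = Q.det * G.det * Q.det := by ring

lemma eigenvalues_le_trace (hS : S.PosSemidef) (i : n) : hS.1.eigenvalues i ≤ S.trace := by
  rw [hS.1.trace_eq_sum_eigenvalues]
  exact Finset.single_le_sum (f := hS.1.eigenvalues)
    (fun j _ => hS.eigenvalues_nonneg j) (Finset.mem_univ i)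

lemma quadForm_le_trace_mul (hS : S.PosSemidef) (v : EuclideanSpace ℝ n) :
    quadForm S v ≤ S.trace * ‖v‖ ^ 2 := by
  refine quadForm_le_of_spectrum hS.1 ?_ v
  rw [hS.1.spectrum_real_eq_range_eigenvalues]
  rintro _ ⟨i, rfl⟩
  exact eigenvalues_le_trace hS i

lemma det_le_trace_pow_mul_eigenvalues (hS : S.PosSemidef) (i : n) :
    S.det ≤ S.trace ^ (Fintype.card n - 1) * hS.1.eigenvalues i := by
  rw [hS.1.det_eq_prod_eigenvalues, ← Finset.prod_erase_mul _ _ (Finset.mem_univ i)]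
  refine mul_le_mul_of_nonneg_right ?_ (hS.eigenvalues_nonneg i)
  calc _ ≤ ∏ _j ∈ Finset.univ.erase i, S.trace :=
        Finset.prod_le_prod (fun j _ => hS.eigenvalues_nonneg j)
          fun j _ => eigenvalues_le_trace hS j
    _ = _ := by simp

lemma det_mul_norm_sq_le [Nonempty n] (hS : S.PosDef) (v : EuclideanSpace ℝ n) :
    S.det * ‖v‖ ^ 2 ≤ S.trace ^ (Fintype.card n - 1) * quadForm S v := by
  have htr : 0 < S.trace ^ (Fintype.card n - 1) := pow_pos hS.trace_pos _
  have h := mul_norm_sq_le_quadForm_of_spectrum (a := S.det / S.trace ^ (Fintype.card n - 1))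
    hS.1 (by
      rw [hS.1.spectrum_real_eq_range_eigenvalues]
      rintro _ ⟨i, rfl⟩
      rw [div_le_iff₀' htr]
      exact det_le_trace_pow_mul_eigenvalues hS.posSemidef i) v
  rwa [div_mul_eq_mul_div, div_le_iff₀' htr] at h

lemma posDef_transpose_mul_mul (hS : S.PosDef) (hQ : Q.det ≠ 0) : (Qᵀ * S * Q).PosDef := by
  simpa using hS.conjTranspose_mul_mul_same
    (Matrix.mulVec_injective_of_isUnit ((Q.isUnit_iff_isUnit_det).2 hQ.isUnit))

lemma opNorm_pos [Nonempty n] (hS : S.PosDef) : 0 < ‖S‖ := by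
  rw [norm_pos_iff]
  rintro rfl
  simpa using hS.det_pos

end QuadForm

/-! ### Algebra of the metric tensor -/

/-- An upper bound for `‖J⁻¹‖²` that involves the Jacobian `J` only through its determinant and the
trace of `Jᵀ S J`, the quantity controlled by the alignment condition. -/
noncomputable def invJacobianBound {d : ℕ} (S J : Matrix (Fin d) (Fin d) ℝ) : ℝ :=
  ‖S‖ * (Jᵀ * S * J).trace ^ (d - 1) / (J.det ^ 2 * S.det)

section MetricTensor

variable {d : ℕ} {S J H : Matrix (Fin d) (Fin d) ℝ} {V Cali : ℝ}

lemma invJacobianBound_nonneg (hS : S.PosDef) (hJ : J.det ≠ 0) : 0 ≤ invJacobianBound S J := by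
  have htr := (posDef_transpose_mul_mul hS hJ).posSemidef.trace_nonneg
  have hdet := hS.det_pos
  unfold invJacobianBound
  positivity

lemma metricTensor_posSemidef (hS : S.PosSemidef) : (metricTensor S).PosSemidef :=
  hS.smul (mul_nonneg (Real.rpow_nonneg hS.det_nonneg _) (by positivity))

variable [NeZero d]

/-- The smallest eigenvalue of `B = Jᵀ S J` is at least `det B / (tr B) ^ (d - 1)`. -/
lemma norm_sq_le_invJacobianBound_mul (hS : S.PosDef) (hJ : J.det ≠ 0) (v : Euc d) :
    ‖v‖ ^ 2 ≤ invJacobianBound S J * ‖Matrix.toEuclideanCLM (𝕜 := ℝ) J v‖ ^ 2 := by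
  have hB := posDef_transpose_mul_mul hS hJ
  have htr : 0 ≤ (Jᵀ * S * J).trace := hB.posSemidef.trace_nonneg
  have hdet : (Jᵀ * S * J).det = J.det ^ 2 * S.det := by
    rw [Matrix.det_mul, Matrix.det_mul, Matrix.det_transpose]
    ring
  have hpos : 0 < J.det ^ 2 * S.det := hdet ▸ hB.det_pos
  rw [invJacobianBound, div_mul_eq_mul_div, le_div_iff₀' hpos]
  calc J.det ^ 2 * S.det * ‖v‖ ^ 2
      ≤ (Jᵀ * S * J).trace ^ (d - 1) * quadForm (Jᵀ * S * J) v := by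
        simpa [hdet] using det_mul_norm_sq_le hB v
    _ ≤ (Jᵀ * S * J).trace ^ (d - 1) *
        (‖S‖ * ‖Matrix.toEuclideanCLM (𝕜 := ℝ) J v‖ ^ 2) := by
        rw [quadForm_transpose_mul_mul]
        gcongr
        exact quadForm_le_opNorm S _
    _ = _ := by ring

lemma det_metricTensor_rpow_half (hS : S.PosDef) :
    (metricTensor S).det ^ ((1 : ℝ) / 2) =
      (S.det ^ ((1 : ℝ) / d) * ‖S‖) ^ ((d : ℝ) / (d + 2)) := by
  have hdet := hS.det_pos
  have hnorm := opNorm_pos hS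
  have hd : (d : ℝ) ≠ 0 := NeZero.ne _
  rw [metricTensor, Matrix.det_smul, Fintype.card_fin, Real.mul_rpow (by positivity) hdet.le,
    ← Real.rpow_natCast, Real.mul_rpow (by positivity) (by positivity),
    Real.mul_rpow (by positivity) (by positivity), Real.mul_rpow (by positivity) (by positivity)]
  simp only [← Real.rpow_mul hdet.le, ← Real.rpow_mul hnorm.le]
  rw [mul_right_comm, ← Real.rpow_add hdet]
  congr 2 <;> field_simp
  ring

lemma mul_det_metricTensor_rpow (hS : S.PosDef) (hV : 0 < V) :
    (V * (metricTensor S).det ^ ((1 : ℝ) / 2)) ^ (((d : ℝ) + 2) / d) =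
      V * ‖S‖ * (V ^ ((2 : ℝ) / d) * S.det ^ ((1 : ℝ) / d)) := by
  have hdet := hS.det_pos
  have hd : (d : ℝ) ≠ 0 := NeZero.ne _
  have hexp : (d : ℝ) / (d + 2) * ((d + 2) / d) = 1 := by field_simp
  have hexp' : ((d : ℝ) + 2) / d = 1 + 2 / d := by field_simp
  rw [det_metricTensor_rpow_half hS, Real.mul_rpow hV.le (by positivity),
    ← Real.rpow_mul (by positivity), hexp, hexp', Real.rpow_add hV, Real.rpow_one, Real.rpow_one]
  ring

/-- The alignment condition is homogeneous in the metric tensor, so its scalar factor cancels. -/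
lemma trace_le_of_alignment (hS : S.PosDef)
    (h : 1 / (d : ℝ) * (Jᵀ * metricTensor S * J).trace ≤
      Cali * V ^ ((2 : ℝ) / d) * (metricTensor S).det ^ ((1 : ℝ) / d)) :
    (Jᵀ * S * J).trace ≤ d * Cali * (V ^ ((2 : ℝ) / d) * S.det ^ ((1 : ℝ) / d)) := by
  have hdet := hS.det_pos
  have hnorm := opNorm_pos hS
  have hd : (0 : ℝ) < d := by exact_mod_cast NeZero.pos d
  rw [metricTensor] at h
  set μ : ℝ := S.det ^ (-(1 : ℝ) / (d + 2)) * ‖S‖ ^ ((2 : ℝ) / (d + 2))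
  have hμ : 0 < μ := by positivity
  rw [Matrix.mul_smul, Matrix.smul_mul, Matrix.trace_smul, smul_eq_mul, Matrix.det_smul,
    Fintype.card_fin, Real.mul_rpow (by positivity) hdet.le, one_div (d : ℝ),
    Real.pow_rpow_inv_natCast hμ.le (NeZero.ne d), inv_mul_le_iff₀ hd] at h
  refine le_of_mul_le_mul_left (h.trans_eq ?_) hμ
  rw [one_div]
  ring

lemma mul_trace_sq_mul_invJacobianBound_le (hS : S.PosDef) (hV : V = |J.det|) (hV0 : 0 < V)
    (h : 1 / (d : ℝ) * (Jᵀ * metricTensor S * J).trace ≤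
      Cali * V ^ ((2 : ℝ) / d) * (metricTensor S).det ^ ((1 : ℝ) / d)) :
    V * (Jᵀ * S * J).trace ^ 2 * invJacobianBound S J ≤
      (d * Cali) ^ (d + 1) *
        (V * (metricTensor S).det ^ ((1 : ℝ) / 2)) ^ (((d : ℝ) + 2) / d) := by
  have hdet := hS.det_pos
  have hJ : J.det ≠ 0 := abs_pos.1 (hV ▸ hV0)
  have hτ := trace_le_of_alignment hS h
  rw [mul_det_metricTensor_rpow hS hV0]
  set τ := (Jᵀ * S * J).trace with hτdef
  have hτ0 : 0 ≤ τ := (posDef_transpose_mul_mul hS hJ).posSemidef.trace_nonneg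
  set X : ℝ := V ^ ((2 : ℝ) / d) * S.det ^ ((1 : ℝ) / d) with hX
  have hXd : X ^ d = J.det ^ 2 * S.det := by
    rw [hX, mul_pow, one_div, Real.rpow_inv_natCast_pow hdet.le (NeZero.ne d), div_eq_mul_inv,
      Real.rpow_mul hV0.le, Real.rpow_inv_natCast_pow (by positivity) (NeZero.ne d), Real.rpow_two,
      hV, sq_abs]
  have hpow : τ ^ (d + 1) = τ ^ (d - 1) * τ ^ 2 := by
    rw [← pow_add]
    congr 1
    have := NeZero.pos d
    omega
  calc V * τ ^ 2 * invJacobianBound S J = V * ‖S‖ * τ ^ (d + 1) / X ^ d := by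
        rw [invJacobianBound, hXd, hpow, ← hτdef]
        ring
    _ ≤ V * ‖S‖ * (d * Cali * X) ^ (d + 1) / X ^ d := by gcongr
    _ = (d * Cali) ^ (d + 1) * (V * ‖S‖ * X) := by
        have : X ≠ 0 := by positivity
        rw [mul_pow _ X, pow_succ X]
        field_simp

lemma sq_mul_det_rpow_mul_opNorm_le {a b : ℝ} (hS : S.PosDef) (hH : H.IsHermitian) (ha : 0 < a)
    (h : spectrum ℝ (S⁻¹ * H) ⊆ Icc a b) :
    a ^ 2 * (S.det ^ ((1 : ℝ) / d) * ‖S‖) ≤ ‖H.det ^ ((1 : ℝ) / d) • H‖ := by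
  have hSdet := hS.det_pos
  have hdet : a ^ d * S.det ≤ H.det := by
    simpa using pow_mul_det_le_of_spectrum hS hH ha.le fun t ht => (h ht).1
  have hHdet : 0 < H.det := lt_of_lt_of_le (by positivity) hdet
  have hroot : a * S.det ^ ((1 : ℝ) / d) ≤ H.det ^ ((1 : ℝ) / d) :=
    calc a * S.det ^ ((1 : ℝ) / d) = (a ^ d * S.det) ^ ((1 : ℝ) / d) := by
          rw [Real.mul_rpow (by positivity) hSdet.le, one_div,
            Real.pow_rpow_inv_natCast ha.le (NeZero.ne d)]
      _ ≤ _ := by gcongr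
  have hnorm : a * ‖S‖ ≤ ‖H‖ := by
    rw [← le_div_iff₀' ha]
    refine opNorm_le_of_quadForm_le hS.posSemidef (by positivity) fun v => ?_
    rw [div_mul_eq_mul_div, le_div_iff₀' ha]
    exact (quadForm_bounds_of_spectrum hS hH h v).1.trans (quadForm_le_opNorm H v)
  rw [norm_smul, Real.norm_of_nonneg (by positivity)]
  calc _ = (a * S.det ^ ((1 : ℝ) / d)) * (a * ‖S‖) := by ring
    _ ≤ _ := by gcongr

end MetricTensor

/-! ### Affine maps and simplices -/

section AffineBasis

variable {ι k V P W : Type*} [Ring k] [AddCommGroup V] [Module k V] [AddTorsor V P]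
  [AddCommGroup W] [Module k W]

lemma affineMap_eq_sum_coord [Fintype ι] (b : AffineBasis ι k P) (p : P →ᵃ[k] W) (x : P) :
    p x = ∑ i, b.coord i x • p (b i) := by
  conv_lhs => rw [← b.affineCombination_coord_eq_self x]
  rw [Finset.map_affineCombination _ _ _ (b.sum_coord_apply_eq_one x),
    Finset.affineCombination_eq_linear_combination _ _ _ (b.sum_coord_apply_eq_one x)]
  rfl

lemma exists_affineMap_apply_eq [Finite ι] (b : AffineBasis ι k P) (c : ι → W) :
    ∃ p : P →ᵃ[k] W, ∀ i, p (b i) = c i := by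
  classical
  cases nonempty_fintype ι
  refine ⟨(Fintype.linearCombination k c).toAffineMap.comp b.coords, fun i => ?_⟩
  simp [Fintype.linearCombination_apply, AffineBasis.coord_apply]

end AffineBasis

section AddHaar

variable {E F : Type*} [NormedAddCommGroup E] [NormedSpace ℝ E] [MeasurableSpace E] [BorelSpace E]
  [FiniteDimensional ℝ E] [AddCommGroup F] [Module ℝ F] (μ : Measure E) [μ.IsAddHaarMeasure]

lemma addHaar_zeros_affineMap {p : E →ᵃ[ℝ] F} (hp : p ≠ 0) : μ {x | p x = 0} = 0 := by
  let A : AffineSubspace ℝ E := (affineSpan ℝ {(0 : F)}).comap p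
  have hA : (A : Set E) = {x | p x = 0} := by
    ext x
    simp [A]
  rw [← hA]
  refine Measure.addHaar_affineSubspace μ A fun htop => hp ?_
  ext x
  exact hA.subset (htop ▸ AffineSubspace.mem_top ℝ E x)

lemma addHaar_image_affineMap (f : E →ᵃ[ℝ] E) (A : Set E) :
    μ (f '' A) = ENNReal.ofReal |LinearMap.det f.linear| * μ A := by
  have h : f '' A = (fun x => f 0 + x) '' (f.linear '' A) := by
    rw [image_image]
    refine image_congr fun x _ => ?_
    rw [congrFun f.decomp x, Pi.add_apply, add_comm]
  rw [h, image_add_left, measure_preimage_add, Measure.addHaar_image_linearMap]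

end AddHaar

section Simplex

variable {d : ℕ} {s : Finset (Euc d)}

/-- The vertices of a simplex as an affine basis of the space, indexed by the vertex set itself. -/
noncomputable def IsSimplex.basis (hs : IsSimplex s) : AffineBasis s ℝ (Euc d) where
  toFun := (↑)
  ind' := hs.2
  tot' := by
    rw [hs.2.affineSpan_eq_top_iff_card_eq_finrank_add_one]
    simp [hs.1]

lemma IsSimplex.basis_apply (hs : IsSimplex s) (i : s) : hs.basis i = i := rfl

lemma IsSimplex.coord_self (hs : IsSimplex s) (i : s) : hs.basis.coord i i = 1 :=
  hs.basis.coord_apply_eq i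

lemma IsSimplex.coord_of_ne (hs : IsSimplex s) {i : s} {v : Euc d} (hv : v ∈ s)
    (h : (i : Euc d) ≠ v) : hs.basis.coord i v = 0 :=
  hs.basis.coord_apply_ne (i := i) (j := ⟨v, hv⟩) fun hi => h (congrArg Subtype.val hi)

lemma IsSimplex.range_basis (hs : IsSimplex s) : range hs.basis = (s : Set (Euc d)) := by
  ext x
  simp [IsSimplex.basis_apply]

lemma IsSimplex.mem_cell_iff (hs : IsSimplex s) {x : Euc d} :
    x ∈ cell s ↔ ∀ i, 0 ≤ hs.basis.coord i x := by
  rw [cell, ← hs.range_basis, hs.basis.convexHull_eq_nonneg_coord, mem_ofPred_eq]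

lemma IsSimplex.mem_cell_of_lineMap_mem (hs : IsSimplex s) {v : s} {x : Euc d} {r : ℝ}
    (hr : 0 < r) (h : AffineMap.lineMap (v : Euc d) x r ∈ cell s)
    (hx : 0 ≤ hs.basis.coord v x) : x ∈ cell s := by
  refine hs.mem_cell_iff.2 fun i => ?_
  rcases eq_or_ne i v with rfl | hiv
  · exact hx
  · have hi := hs.mem_cell_iff.1 h i
    rw [AffineMap.apply_lineMap, AffineMap.lineMap_apply_ring,
      hs.coord_of_ne v.2 (Subtype.coe_ne_coe.2 hiv), mul_zero, zero_add] at hi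
    exact nonneg_of_mul_nonneg_right hi hr

lemma isCompact_cell (s : Finset (Euc d)) : IsCompact (cell s) :=
  s.finite_toSet.isCompact_convexHull ℝ

lemma convex_cell (s : Finset (Euc d)) : Convex ℝ (cell s) := convex_convexHull ℝ _

lemma subset_cell (s : Finset (Euc d)) : (s : Set (Euc d)) ⊆ cell s := subset_convexHull ℝ _

lemma measurableSet_cell (s : Finset (Euc d)) : MeasurableSet (cell s) :=
  (isCompact_cell s).measurableSet

lemma volume_cell_lt_top (s : Finset (Euc d)) : volume (cell s) < ⊤ :=
  (isCompact_cell s).measure_lt_top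

lemma volume_frontier_cell (s : Finset (Euc d)) : volume (frontier (cell s)) = 0 :=
  (convex_cell s).addHaar_frontier _

lemma IsSimplex.interior_cell_nonempty (hs : IsSimplex s) : (interior (cell s)).Nonempty := by
  rw [cell, interior_convexHull_nonempty_iff_affineSpan_eq_top]
  simpa [hs.range_basis] using hs.basis.tot

lemma IsSimplex.closure_interior_cell (hs : IsSimplex s) :
    closure (interior (cell s)) = cell s := by
  rw [(convex_cell s).closure_interior_eq_closure_of_nonempty_interior hs.interior_cell_nonempty,
    (isCompact_cell s).isClosed.closure_eq]

lemma IsSimplex.volume_real_pos (hs : IsSimplex s) : 0 < volume.real (cell s) :=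
  ENNReal.toReal_pos
    ((isOpen_interior.measure_pos _ hs.interior_cell_nonempty).trans_le
      (measure_mono interior_subset)).ne' (volume_cell_lt_top s).ne

end Simplex

section ReferenceMap

variable {d : ℕ} {Khat s : Finset (Euc d)} {F : Euc d →ᵃ[ℝ] Euc d}

lemma toEuclideanCLM_jacobian (F : Euc d →ᵃ[ℝ] Euc d) (v : Euc d) :
    Matrix.toEuclideanCLM (𝕜 := ℝ) (jacobian F) v = F.linear v := by
  change Matrix.toLin (EuclideanSpace.basisFun (Fin d) ℝ).toBasis
    (EuclideanSpace.basisFun (Fin d) ℝ).toBasis (jacobian F) v = F.linear v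
  rw [jacobian, Matrix.toLin_toMatrix]

lemma volume_real_cell_eq (hvol : volume (cell Khat) = 1) (hF : F '' cell Khat = cell s) :
    volume.real (cell s) = |(jacobian F).det| := by
  rw [Measure.real, ← hF, addHaar_image_affineMap, hvol, mul_one,
    ENNReal.toReal_ofReal (abs_nonneg _), jacobian, LinearMap.det_toMatrix]

end ReferenceMap

/-! ### Meshes -/

namespace SimplicialMesh

variable {d : ℕ} {Ω : Set (Euc d)} {s t : Finset (Euc d)} (T : SimplicialMesh Ω)

lemma isCompact_closure (T : SimplicialMesh Ω) : IsCompact (closure Ω) := by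
  rw [T.cover]
  exact T.elems.isCompact_biUnion fun s _ => isCompact_cell s

lemma cell_subset_closure (hs : s ∈ T.elems) : cell s ⊆ closure Ω := by
  rw [T.cover]
  exact subset_biUnion_of_mem (u := fun s => cell s) hs

lemma interior_cell_subset (hΩ : interior (closure Ω) = Ω) (hs : s ∈ T.elems) :
    interior (cell s) ⊆ Ω := by
  rw [← hΩ]
  exact interior_mono (T.cell_subset_closure hs)

lemma exists_mem_cell {x : Euc d} (hx : x ∈ closure Ω) : ∃ s ∈ T.elems, x ∈ cell s := by
  rw [T.cover] at hx
  simpa using hx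

lemma ae_mem_interior_cell : ∀ᵐ x ∂(volume.restrict (closure Ω)),
    ∃ s ∈ T.elems, x ∈ interior (cell s) := by
  rw [ae_restrict_iff' isClosed_closure.measurableSet]
  have h : ∀ᵐ x, ∀ s ∈ T.elems, x ∉ frontier (cell s) :=
    (ae_ball_iff T.elems.countable_toSet).2 fun s _ =>
      measure_eq_zero_iff_ae_notMem.1 (volume_frontier_cell s)
  filter_upwards [h] with x hx hxΩ
  obtain ⟨s, hs, hxs⟩ := T.exists_mem_cell hxΩ
  refine ⟨s, hs, ?_⟩
  by_contra hcon
  exact hx s hs ⟨subset_closure hxs, hcon⟩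

lemma restrict_closure (T : SimplicialMesh Ω) (hΩ : interior (closure Ω) = Ω) :
    volume.restrict (closure Ω) = volume.restrict Ω := by
  refine Measure.restrict_congr_set ?_
  have h := T.ae_mem_interior_cell
  rw [ae_restrict_iff' isClosed_closure.measurableSet] at h
  refine EventuallyLE.antisymm ?_ subset_closure.eventuallyLE
  filter_upwards [h] with x hx hxc
  obtain ⟨s, hs, hxs⟩ := hx hxc
  exact T.interior_cell_subset hΩ hs hxs

lemma coord_eq_zero_of_mem_inter (hs : s ∈ T.elems) (ht : t ∈ T.elems) {v : s} (hv : ↑v ∉ t)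
    {x : Euc d} (hx : x ∈ cell s ∩ cell t) : (T.isSimplex s hs).basis.coord v x = 0 := by
  rw [T.conforming s hs t ht] at hx
  have hvert : EqOn ((T.isSimplex s hs).basis.coord v) (0 : Euc d →ᵃ[ℝ] ℝ)
      ((s : Set (Euc d)) ∩ t) := fun w hw =>
    (T.isSimplex s hs).coord_of_ne hw.1 fun h => hv (h ▸ hw.2)
  exact AffineMap.eqOn_affineSpan hvert (convexHull_subset_affineSpan _ hx)

lemma aedisjoint_cells : (T.elems : Set (Finset (Euc d))).Pairwise
    (Function.onFun (AEDisjoint volume) fun s => cell s) := by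
  intro s hs t ht hst
  have hss := T.isSimplex s hs
  have hnot : ¬ s ⊆ t := fun h => hst <|
    Finset.eq_of_subset_of_card_le h (by rw [hss.1, (T.isSimplex t ht).1])
  obtain ⟨v, hvs, hvt⟩ := Finset.not_subset.1 hnot
  have hp : hss.basis.coord ⟨v, hvs⟩ ≠ 0 := fun h => by
    simpa [h] using hss.coord_self ⟨v, hvs⟩
  exact measure_mono_null (fun x hx => T.coord_eq_zero_of_mem_inter hs ht (v := ⟨v, hvs⟩) hvt hx)
    (addHaar_zeros_affineMap volume hp)

lemma lintegral_eq_sum (hΩ : interior (closure Ω) = Ω) (f : Euc d → ℝ≥0∞) :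
    ∫⁻ x in Ω, f x = ∑ s ∈ T.elems, ∫⁻ x in cell s, f x := by
  rw [← T.restrict_closure hΩ, T.cover]
  exact lintegral_biUnion_finset₀ T.aedisjoint_cells
    (fun s _ => (measurableSet_cell s).nullMeasurableSet) _

lemma ae_restrict_cell_of_ae (hΩ : interior (closure Ω) = Ω) {P : Euc d → Prop}
    (h : ∀ᵐ x ∂(volume.restrict Ω), P x) (hs : s ∈ T.elems) :
    ∀ᵐ x ∂(volume.restrict (cell s)), P x := by
  rw [← T.restrict_closure hΩ] at h
  exact ae_mono (Measure.restrict_mono (T.cell_subset_closure hs) le_rfl) h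

end SimplicialMesh

/-! ### Finite element functions with vanishing boundary values -/

namespace SimplicialMesh

variable {d : ℕ} {Ω : Set (Euc d)} {s t : Finset (Euc d)} (T : SimplicialMesh Ω)

lemma mem_of_mem_cell (hs : s ∈ T.elems) (ht : t ∈ T.elems) {v : s} (hv : ↑v ∈ cell t) :
    ↑v ∈ t := by
  by_contra hvt
  have hzero := T.coord_eq_zero_of_mem_inter hs ht hvt ⟨subset_cell s v.2, hv⟩
  exact one_ne_zero (((T.isSimplex s hs).coord_self v).symm.trans hzero)

lemma eqOn_inter_of_eqOn_vertices {p q : Euc d →ᵃ[ℝ] ℝ} (hs : s ∈ T.elems) (ht : t ∈ T.elems)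
    (h : EqOn p q ((s : Set (Euc d)) ∩ t)) : EqOn p q (cell s ∩ cell t) := by
  rw [T.conforming s hs t ht]
  exact (AffineMap.eqOn_affineSpan h).mono (convexHull_subset_affineSpan _)

lemma coord_eq_coord_of_mem_inter (hs : s ∈ T.elems) (ht : t ∈ T.elems) {v : Euc d} (hvs : v ∈ s)
    (hvt : v ∈ t) {x : Euc d} (hx : x ∈ cell s ∩ cell t) :
    (T.isSimplex s hs).basis.coord ⟨v, hvs⟩ x = (T.isSimplex t ht).basis.coord ⟨v, hvt⟩ x := by
  refine T.eqOn_inter_of_eqOn_vertices hs ht (fun w hw => ?_) hx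
  rcases eq_or_ne v w with rfl | hvw
  · exact ((T.isSimplex s hs).coord_self ⟨v, hvs⟩).trans
      ((T.isSimplex t ht).coord_self ⟨v, hvt⟩).symm
  · rw [(T.isSimplex s hs).coord_of_ne hw.1 hvw, (T.isSimplex t ht).coord_of_ne hw.2 hvw]

lemma coord_eq_coord_of_lineMap_mem_inter (hs : s ∈ T.elems) (ht : t ∈ T.elems) {v : Euc d}
    (hvs : v ∈ s) (hvt : v ∈ t) {x : Euc d} {r : ℝ} (hr : r ≠ 0)
    (h : AffineMap.lineMap v x r ∈ cell s ∩ cell t) :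
    (T.isSimplex s hs).basis.coord ⟨v, hvs⟩ x = (T.isSimplex t ht).basis.coord ⟨v, hvt⟩ x := by
  have hcoord := T.coord_eq_coord_of_mem_inter hs ht hvs hvt h
  rw [AffineMap.apply_lineMap, AffineMap.apply_lineMap, AffineMap.lineMap_apply_ring,
    AffineMap.lineMap_apply_ring, (T.isSimplex s hs).coord_self ⟨v, hvs⟩,
    (T.isSimplex t ht).coord_self ⟨v, hvt⟩] at hcoord
  exact mul_left_cancel₀ hr (add_left_cancel hcoord)

lemma eventually_mem_cell_of_mem_cell (w : Euc d) :
    ∀ᶠ y in 𝓝 w, ∀ t ∈ T.elems, y ∈ cell t → w ∈ cell t := by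
  rw [Filter.eventually_all_finset]
  intro t _
  by_cases hw : w ∈ cell t
  · simp [hw]
  · filter_upwards [(isCompact_cell t).isClosed.isOpen_compl.mem_nhds hw] with y hy hyt
    exact absurd hyt hy

/-- The elements that contain points near `lineMap v x r` with small `r > 0` have `v` as a vertex,
so that the homothety with centre `v` carries them to a neighbourhood of `x`. -/
lemma mem_of_coord_pos (hΩ : interior (closure Ω) = Ω) (hs : s ∈ T.elems) {v : s} (hv : ↑v ∈ Ω)
    {x : Euc d} (hxs : x ∈ cell s) (hx : 0 < (T.isSimplex s hs).basis.coord v x) : x ∈ Ω := by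
  have hopen : IsOpen Ω := hΩ ▸ isOpen_interior
  have hline : Tendsto (fun r : ℝ => AffineMap.lineMap (v : Euc d) x r) (𝓝[>] 0) (𝓝 v) := by
    have h := (AffineMap.lineMap_continuous (p := (v : Euc d)) (q := x) (R := ℝ)).tendsto 0
    rw [AffineMap.lineMap_apply_zero] at h
    exact h.mono_left nhdsWithin_le_nhds
  obtain ⟨r, ⟨hwΩ, hstar⟩, hr0, hr1⟩ := ((hline.eventually ((hopen.eventually_mem hv).and
    (T.eventually_mem_cell_of_mem_cell v))).and (Ioo_mem_nhdsGT (zero_lt_one' ℝ))).exists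
  set w := AffineMap.lineMap (v : Euc d) x r
  have hws : w ∈ cell s := (convex_cell s).lineMap_mem (subset_cell s v.2) hxs ⟨hr0.le, hr1.le⟩
  have hhom : Tendsto (fun y => AffineMap.lineMap (v : Euc d) y r) (𝓝 x) (𝓝 w) :=
    (AffineMap.homothety_continuous (v : Euc d) r).tendsto x
  have hpos : ∀ᶠ y in 𝓝 x, ∀ t : T.elems, w ∈ cell t.1 → ∀ hvt : ↑v ∈ t.1,
      0 < (T.isSimplex t t.2).basis.coord ⟨v, hvt⟩ y := by
    simp only [eventually_all]
    intro t hwt hvt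
    rw [T.coord_eq_coord_of_lineMap_mem_inter hs t.2 v.2 hvt hr0.ne' ⟨hws, hwt⟩] at hx
    exact (AffineMap.continuous_of_finiteDimensional _).continuousAt.eventually (lt_mem_nhds hx)
  rw [← hΩ, mem_interior_iff_mem_nhds]
  filter_upwards [hhom.eventually (hopen.eventually_mem hwΩ),
    hhom.eventually (T.eventually_mem_cell_of_mem_cell w), hpos] with y hyΩ hyw hy
  obtain ⟨t, ht, hyt⟩ := T.exists_mem_cell (subset_closure hyΩ)
  have hwt := hyw t ht hyt
  have hvt := T.mem_of_mem_cell hs ht (hstar t ht hwt)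
  exact T.cell_subset_closure ht
    ((T.isSimplex t ht).mem_cell_of_lineMap_mem (v := ⟨v, hvt⟩) hr0 hyt (hy ⟨t, ht⟩ hwt hvt).le)

lemma vertex_mem_frontier (hΩ : interior (closure Ω) = Ω) (hs : s ∈ T.elems) {x : Euc d}
    (hx : x ∈ frontier Ω) (hxs : x ∈ cell s) {v : s}
    (hv : 0 < (T.isSimplex s hs).basis.coord v x) : (v : Euc d) ∈ frontier Ω := by
  have hopen : IsOpen Ω := hΩ ▸ isOpen_interior
  rw [hopen.frontier_eq] at hx ⊢
  exact ⟨T.cell_subset_closure hs (subset_cell s v.2),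
    fun hvΩ => hx.2 (T.mem_of_coord_pos hΩ hs hvΩ hxs hv)⟩

lemma mem_feSpaceZero (hΩ : interior (closure Ω) = Ω) {v : Euc d → ℝ} (hv : v ∈ T.feSpace)
    (h : ∀ z ∈ T.vertices, z ∈ frontier Ω → v z = 0) : v ∈ T.feSpaceZero := by
  refine ⟨hv, fun x hx => ?_⟩
  obtain ⟨s, hs, hxs⟩ := T.exists_mem_cell (frontier_subset_closure hx)
  obtain ⟨p, hp⟩ := hv s hs
  rw [hp hxs, affineMap_eq_sum_coord (T.isSimplex s hs).basis p x]
  refine Finset.sum_eq_zero fun i _ => ?_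
  rcases ((T.isSimplex s hs).mem_cell_iff.1 hxs i).eq_or_lt with hi | hi
  · rw [← hi, zero_smul]
  · rw [(T.isSimplex s hs).basis_apply, ← hp (subset_cell s i.2),
      h i ⟨s, hs, i.2⟩ (T.vertex_mem_frontier hΩ hs hx hxs hi), smul_zero]

lemma exists_interpolant (U : Euc d → ℝ) : ∃ I ∈ T.feSpace, EqOn I U T.vertices := by
  classical
  have hexists : ∀ s ∈ T.elems, ∃ p : Euc d →ᵃ[ℝ] ℝ, EqOn p U s := fun s hs =>
    let ⟨p, hp⟩ := exists_affineMap_apply_eq (T.isSimplex s hs).basis fun v => U v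
    ⟨p, fun v hv => hp ⟨v, hv⟩⟩
  choose! p hp using hexists
  let I : Euc d → ℝ := fun x => if h : ∃ s ∈ T.elems, x ∈ cell s then p h.choose x else 0
  have hI : ∀ s ∈ T.elems, EqOn I (p s) (cell s) := by
    intro s hs x hx
    have h : ∃ s ∈ T.elems, x ∈ cell s := ⟨s, hs, hx⟩
    obtain ⟨ht, hxt⟩ := h.choose_spec
    rw [show I x = p h.choose x from dif_pos h]
    exact T.eqOn_inter_of_eqOn_vertices ht hs
      (fun v hv => (hp _ ht hv.1).trans (hp s hs hv.2).symm) ⟨hxt, hx⟩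
  refine ⟨I, fun s hs => ⟨p s, hI s hs⟩, ?_⟩
  rintro z ⟨s, hs, hz⟩
  rw [hI s hs (subset_cell s hz), hp s hs hz]

end SimplicialMesh

/-! ### Mollification of weakly differentiable functions -/

/-- The mollification `x ↦ ∫_Ω φ(x - y) f(y) dy` of a function on `Ω`, which is extended by zero
outside `Ω`. -/
noncomputable def mollify {d : ℕ} {F : Type*} [NormedAddCommGroup F] [NormedSpace ℝ F]
    (φ : ContDiffBump (0 : Euc d)) (Ω : Set (Euc d)) (f : Euc d → F) (x : Euc d) : F :=
  ∫ y in Ω, φ.normed volume (x - y) • f y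

/-- `g` is the weak gradient of `f` in `Ω`. -/
def HasWeakGradient {d : ℕ} (Ω : Set (Euc d)) (f : Euc d → ℝ) (g : Euc d → Euc d) : Prop :=
  ∀ i, HasWeakPartial Ω i f (fun x => g x i)

section Mollify

variable {d : ℕ} {F G : Type*} [NormedAddCommGroup F] [NormedSpace ℝ F] [NormedAddCommGroup G]
  [NormedSpace ℝ G] {φ : ContDiffBump (0 : Euc d)} {Ω : Set (Euc d)} {x v : Euc d} {m M : ℝ}

lemma gradient_apply_eq_fderiv (f : Euc d → ℝ) (x : Euc d) (i : Fin d) :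
    gradient f x i = fderiv ℝ f x (EuclideanSpace.single i 1) := by
  rw [← inner_gradient_left, EuclideanSpace.inner_single_right]
  simp

lemma mollify_eq_convolution (hΩ : MeasurableSet Ω) (f : Euc d → F) :
    mollify φ Ω f =
      convolution (φ.normed volume) (Ω.indicator f) (ContinuousLinearMap.lsmul ℝ ℝ) volume := by
  ext x
  rw [mollify, convolution_lsmul_swap, ← integral_indicator hΩ]
  simp only [indicator_smul_apply]

lemma normed_sub_eq_zero {y : Euc d} (h : y ∉ Metric.ball x φ.rOut) :
    φ.normed volume (x - y) = 0 := by
  rw [← Function.notMem_support, φ.support_normed_eq]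
  simpa [dist_eq_norm, norm_sub_rev] using h

lemma integrable_normed_smul {μ : Measure (Euc d)} {f : Euc d → F} (hf : Integrable f μ)
    (x : Euc d) : Integrable (fun y => φ.normed volume (x - y) • f y) μ := by
  obtain ⟨C, hC⟩ := φ.hasCompactSupport_normed.exists_bound_of_continuous
    (φ.continuous_normed (μ := volume))
  exact hf.bdd_smul C (φ.continuous_normed.comp (by fun_prop)).aestronglyMeasurable
    (Eventually.of_forall fun y => hC _)

lemma clm_mollify [CompleteSpace F] [CompleteSpace G] (A : F →L[ℝ] G) {f : Euc d → F}
    (hf : IntegrableOn f Ω) (x : Euc d) :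
    A (mollify φ Ω f x) = mollify φ Ω (fun y => A (f y)) x := by
  rw [mollify, ← A.integral_comp_comm (integrable_normed_smul hf x)]
  simp only [mollify, map_smul]

lemma mollify_inner {g : Euc d → Euc d} (hg : IntegrableOn g Ω) (v x : Euc d) :
    mollify φ Ω (fun y => inner ℝ v (g y)) x = ∑ i, v i * mollify φ Ω (fun y => g y i) x := by
  have mollify_apply : ∀ i, mollify φ Ω (fun y => g y i) x = mollify φ Ω g x i := fun i =>
    (clm_mollify (EuclideanSpace.proj i) hg x).symm
  have inner_mollify : mollify φ Ω (fun y => inner ℝ v (g y)) x = inner ℝ v (mollify φ Ω g x) :=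
    (clm_mollify (innerSL ℝ v) hg x).symm
  rw [inner_mollify]
  simp [mollify_apply, PiLp.inner_apply, mul_comm]

lemma mollify_le {f : Euc d → ℝ} (hx : Metric.closedBall x φ.rOut ⊆ Ω) (hf : IntegrableOn f Ω)
    (h : ∀ᵐ y ∂(volume.restrict Ω), y ∈ Metric.ball x φ.rOut → f y ≤ M) :
    mollify φ Ω f x ≤ M := by
  have integral_normed : ∫ y in Ω, φ.normed volume (x - y) = 1 := by
    rw [setIntegral_eq_integral_of_forall_compl_eq_zero, integral_sub_left_eq_self,
      φ.integral_normed]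
    exact fun y hy =>
      normed_sub_eq_zero fun hyb => hy (hx (Metric.ball_subset_closedBall hyb))
  calc mollify φ Ω f x ≤ ∫ y in Ω, φ.normed volume (x - y) * M := by
        refine integral_mono_ae (integrable_normed_smul hf x)
          ((φ.integrable_normed.comp_sub_left x).mul_const M).integrableOn ?_
        filter_upwards [h] with y hy
        by_cases hyb : y ∈ Metric.ball x φ.rOut
        · exact mul_le_mul_of_nonneg_left (hy hyb) (φ.nonneg_normed _)
        · simp [normed_sub_eq_zero hyb]
    _ = M := by rw [integral_mul_const, integral_normed, one_mul]

lemma mollify_mem_Icc {f : Euc d → ℝ} (hx : Metric.closedBall x φ.rOut ⊆ Ω)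
    (hf : IntegrableOn f Ω)
    (h : ∀ᵐ y ∂(volume.restrict Ω), y ∈ Metric.ball x φ.rOut → f y ∈ Icc m M) :
    mollify φ Ω f x ∈ Icc m M := by
  have neg_le : mollify φ Ω (-f) x ≤ -m := by
    refine mollify_le hx hf.neg ?_
    filter_upwards [h] with y hy hyb using neg_le_neg (hy hyb).1
  have mollify_neg : mollify φ Ω (-f) x = -mollify φ Ω f x := by
    simp [mollify, integral_neg]
  exact ⟨by linarith, mollify_le hx hf (h.mono fun y hy hyb => (hy hyb).2)⟩

lemma normed_sub_mem_testFunctions (hx : Metric.closedBall x φ.rOut ⊆ Ω) :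
    (fun y => φ.normed volume (x - y)) ∈ testFunctions Ω := by
  have hsub : tsupport (fun y => φ.normed volume (x - y)) ⊆ Metric.closedBall x φ.rOut := by
    refine closure_minimal (fun y hy => ?_) Metric.isClosed_closedBall
    by_contra hcon
    exact hy (normed_sub_eq_zero fun hb => hcon (Metric.ball_subset_closedBall hb))
  exact ⟨φ.contDiff_normed.comp (contDiff_const.sub contDiff_id),
    (isCompact_closedBall x φ.rOut).of_isClosed_subset (isClosed_tsupport _) hsub, hsub.trans hx⟩

lemma gradient_normed_sub_apply (x y : Euc d) (i : Fin d) :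
    gradient (fun z => φ.normed volume (x - z)) y i =
      -fderiv ℝ (φ.normed volume) (x - y) (EuclideanSpace.single i 1) := by
  have hφ : DifferentiableAt ℝ (φ.normed volume) (x - y) :=
    (φ.contDiff_normed (n := 1)).differentiable one_ne_zero _
  have hder : HasFDerivAt (fun z => φ.normed volume (x - z))
      (fderiv ℝ (φ.normed volume) (x - y) ∘L (-ContinuousLinearMap.id ℝ (Euc d))) y :=
    hφ.hasFDerivAt.comp y ((hasFDerivAt_id y).const_sub x)
  simp [gradient_apply_eq_fderiv, hder.fderiv]

lemma hasFDerivAt_mollify {f : Euc d → ℝ} (hΩ : MeasurableSet Ω) (hf : IntegrableOn f Ω)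
    (x : Euc d) :
    HasFDerivAt (mollify φ Ω f) (∫ y in Ω, f y • fderiv ℝ (φ.normed volume) (x - y)) x := by
  rw [mollify_eq_convolution hΩ]
  have hder := (φ.hasCompactSupport_normed (μ := volume)).hasFDerivAt_convolution_left
    (ContinuousLinearMap.lsmul ℝ ℝ) φ.contDiff_normed
    (hf.integrable_indicator hΩ).locallyIntegrable x
  convert! hder using 1
  rw [convolution_eq_swap, ← integral_indicator hΩ]
  congr 1
  ext y v
  by_cases hy : y ∈ Ω <;> simp [hy, mul_comm]

lemma HasWeakGradient.hasGradientAt_mollify {f : Euc d → ℝ} {g : Euc d → Euc d}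
    (hw : HasWeakGradient Ω f g) (hΩ : MeasurableSet Ω) (hf : IntegrableOn f Ω)
    (hg : IntegrableOn g Ω) (hx : Metric.closedBall x φ.rOut ⊆ Ω) :
    HasGradientAt (mollify φ Ω f) (mollify φ Ω g x) x := by
  rw [hasGradientAt_iff_hasFDerivAt]
  convert! hasFDerivAt_mollify hΩ hf x using 1
  refine ContinuousLinearMap.coe_injective
    ((EuclideanSpace.basisFun (Fin d) ℝ).toBasis.ext fun i => ?_)
  have hφ : Continuous (fderiv ℝ (φ.normed (volume : Measure (Euc d)))) :=
    (φ.contDiff_normed (n := 1)).continuous_fderiv one_ne_zero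
  obtain ⟨C, hC⟩ := (φ.hasCompactSupport_normed.fderiv ℝ).exists_bound_of_continuous hφ
  have hint : IntegrableOn (fun y => f y • fderiv ℝ (φ.normed volume) (x - y)) Ω :=
    hf.smul_bdd C (hφ.comp (by fun_prop)).aestronglyMeasurable
      (Eventually.of_forall fun y => hC _)
  have hparts := hw i _ (normed_sub_mem_testFunctions hx)
  simp only [gradient_normed_sub_apply, mul_neg, integral_neg, neg_inj] at hparts
  have mollify_apply : mollify φ Ω g x i = ∫ y in Ω, φ.normed volume (x - y) * g y i :=
    clm_mollify (EuclideanSpace.proj i) hg x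
  simp [ContinuousLinearMap.integral_apply hint, EuclideanSpace.inner_single_right,
    mollify_apply, hparts, mul_comm]

lemma HasWeakGradient.hasDerivAt_mollify_line {f : Euc d → ℝ} {g : Euc d → Euc d}
    (hw : HasWeakGradient Ω f g) (hΩ : MeasurableSet Ω) (hf : IntegrableOn f Ω)
    (hg : IntegrableOn g Ω) {t : ℝ} (hx : Metric.closedBall (x + t • v) φ.rOut ⊆ Ω) :
    HasDerivAt (fun t : ℝ => mollify φ Ω f (x + t • v))
      (mollify φ Ω (fun y => inner ℝ v (g y)) (x + t • v)) t := by
  have hline : HasDerivAt (fun t : ℝ => x + t • v) v t := by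
    simpa using ((hasDerivAt_id t).smul_const v).const_add x
  convert! (hw.hasGradientAt_mollify hΩ hf hg hx).hasFDerivAt.comp_hasDerivAt t hline using 1
  rw [InnerProductSpace.toDual_apply_apply, real_inner_comm]
  exact (clm_mollify (innerSL ℝ v) hg _).symm

lemma HasWeakGradient.mollify_increment_mem_Icc {f : Euc d → ℝ} {g : Euc d → Euc d}
    (hw : HasWeakGradient Ω f g) (hΩ : MeasurableSet Ω) (hf : IntegrableOn f Ω)
    (hg : IntegrableOn g Ω)
    (hx : ∀ t ∈ Icc (0 : ℝ) 1, Metric.closedBall (x + t • v) φ.rOut ⊆ Ω)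
    (h : ∀ᵐ y ∂(volume.restrict Ω), (∃ t ∈ Icc (0 : ℝ) 1, y ∈ Metric.ball (x + t • v) φ.rOut) →
      inner ℝ v (g y) ∈ Icc m M) :
    mollify φ Ω f (x + v) - mollify φ Ω f x ∈ Icc m M := by
  have hder := fun t ht => hw.hasDerivAt_mollify_line hΩ hf hg (hx t ht)
  obtain ⟨ξ, hξ, hslope⟩ := exists_hasDerivAt_eq_slope _ _ zero_lt_one
    (fun t ht => (hder t ht).continuousAt.continuousWithinAt)
    (fun t ht => hder t (Ioo_subset_Icc_self ht))
  simp only [one_smul, zero_smul, add_zero, sub_zero, div_one] at hslope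
  rw [← hslope]
  have hξ' := Ioo_subset_Icc_self hξ
  refine mollify_mem_Icc (hx ξ hξ') (hg.const_inner (𝕜 := ℝ) v) ?_
  filter_upwards [h] with y hy hyb using hy ⟨ξ, hξ', hyb⟩

end Mollify

/-- `u` has a weak gradient `Du` and a weak Hessian `H` in `Ω`, all of them integrable:
`u ∈ W^{2,1}(Ω)`. -/
structure IsW21 {d : ℕ} (Ω : Set (Euc d)) (u : Euc d → ℝ) (Du : Euc d → Euc d)
    (H : Euc d → Matrix (Fin d) (Fin d) ℝ) : Prop where
  integrableOn : IntegrableOn u Ω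
  integrableOn_grad : IntegrableOn Du Ω
  integrableOn_hess_row : ∀ i, IntegrableOn (fun x => WithLp.toLp 2 (H x i)) Ω
  weak_grad : HasWeakGradient Ω u Du
  weak_hess : ∀ i, HasWeakGradient Ω (fun x => Du x i) (fun x => WithLp.toLp 2 (H x i))

lemma IsH2.isW21 {d : ℕ} {Ω : Set (Euc d)} {u : Euc d → ℝ} {Du : Euc d → Euc d}
    {H : Euc d → Matrix (Fin d) (Fin d) ℝ} [IsFiniteMeasure (volume.restrict Ω)]
    (h : IsH2 Ω u Du H) : IsW21 Ω u Du H :=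
  ⟨h.memLp.integrable one_le_two,
    Integrable.of_eval_piLp fun i => (h.memLp_grad i).integrable one_le_two,
    fun i => Integrable.of_eval_piLp fun j => (h.memLp_hess i j).integrable one_le_two,
    h.weak_grad, h.weak_hess⟩

/-- By the mean value theorem, applied to `F` and then to its derivative. -/
lemma second_order_remainder_mem_Icc {F F' F'' : ℝ → ℝ} {m M : ℝ} (hm : m ≤ 0) (hM : 0 ≤ M)
    (hF : ∀ t ∈ Icc (0 : ℝ) 1, HasDerivAt F (F' t) t)
    (hF' : ∀ t ∈ Icc (0 : ℝ) 1, HasDerivAt F' (F'' t) t)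
    (hF'' : ∀ t ∈ Icc (0 : ℝ) 1, F'' t ∈ Icc m M) : F 1 - F 0 - F' 0 ∈ Icc m M := by
  obtain ⟨ξ, hξ, hslope⟩ := exists_hasDerivAt_eq_slope F F' zero_lt_one
    (fun t ht => (hF t ht).continuousAt.continuousWithinAt)
    (fun t ht => hF t (Ioo_subset_Icc_self ht))
  obtain ⟨η, hη, hslope'⟩ := exists_hasDerivAt_eq_slope F' F'' hξ.1
    (fun t ht => (hF' t ⟨ht.1, ht.2.trans hξ.2.le⟩).continuousAt.continuousWithinAt)
    (fun t ht => hF' t ⟨ht.1.le, ht.2.le.trans hξ.2.le⟩)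
  rw [sub_zero, eq_div_iff hξ.1.ne'] at hslope'
  rw [sub_zero, div_one] at hslope
  have hη' := hF'' η ⟨hη.1.le, hη.2.le.trans hξ.2.le⟩
  have hξ0 := hξ.1
  have hξ1 := hξ.2
  rw [← hslope, ← hslope']
  exact ⟨by nlinarith [hη'.1], by nlinarith [hη'.2]⟩

section Hessian

variable {d : ℕ} {φ : ContDiffBump (0 : Euc d)} {Ω : Set (Euc d)} {u : Euc d → ℝ}
  {Du : Euc d → Euc d} {H : Euc d → Matrix (Fin d) (Fin d) ℝ} {x v : Euc d}

lemma IsW21.integrableOn_hess_apply (h : IsW21 Ω u Du H) (v : Euc d) :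
    IntegrableOn (fun x => Matrix.toEuclideanCLM (𝕜 := ℝ) (H x) v) Ω :=
  Integrable.of_eval_piLp fun i => by
    simpa [Matrix.mulVec, dotProduct, PiLp.inner_apply, mul_comm] using
      (h.integrableOn_hess_row i).const_inner (𝕜 := ℝ) v

lemma IsW21.hasDerivAt_mollify_grad_line (h : IsW21 Ω u Du H) (hΩ : MeasurableSet Ω) {t : ℝ}
    (hx : Metric.closedBall (x + t • v) φ.rOut ⊆ Ω) :
    HasDerivAt (fun t : ℝ => mollify φ Ω (fun y => inner ℝ v (Du y)) (x + t • v))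
      (mollify φ Ω (fun y => quadForm (H y) v) (x + t • v)) t := by
  have hess_apply : ∀ y i, Matrix.toEuclideanCLM (𝕜 := ℝ) (H y) v i =
      inner ℝ v (WithLp.toLp 2 (H y i)) := fun y i => by
    simp [Matrix.mulVec, dotProduct, PiLp.inner_apply]
  simp only [quadForm, mollify_inner h.integrableOn_grad,
    mollify_inner (h.integrableOn_hess_apply v), hess_apply]
  exact HasDerivAt.fun_sum fun i _ => ((h.weak_hess i).hasDerivAt_mollify_line hΩ
    (h.integrableOn_grad.eval_piLp i) (h.integrableOn_hess_row i) hx).const_mul (v i)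

lemma IsW21.mollify_remainder_mem_Icc (h : IsW21 Ω u Du H) (hΩ : MeasurableSet Ω) {m M : ℝ}
    (hm : m ≤ 0) (hM : 0 ≤ M)
    (hx : ∀ t ∈ Icc (0 : ℝ) 1, Metric.closedBall (x + t • v) φ.rOut ⊆ Ω)
    (hb : ∀ᵐ y ∂(volume.restrict Ω), (∃ t ∈ Icc (0 : ℝ) 1, y ∈ Metric.ball (x + t • v) φ.rOut) →
      quadForm (H y) v ∈ Icc m M) :
    mollify φ Ω u (x + v) - mollify φ Ω u x - inner ℝ v (mollify φ Ω Du x) ∈ Icc m M := by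
  have hmem : ∀ t ∈ Icc (0 : ℝ) 1,
      mollify φ Ω (fun y => quadForm (H y) v) (x + t • v) ∈ Icc m M := fun t ht => by
    refine mollify_mem_Icc (hx t ht) ((h.integrableOn_hess_apply v).const_inner (𝕜 := ℝ) v) ?_
    filter_upwards [hb] with y hy hyb using hy ⟨t, ht, hyb⟩
  have inner_mollify : inner ℝ v (mollify φ Ω Du x) =
      mollify φ Ω (fun y => inner ℝ v (Du y)) x := clm_mollify (innerSL ℝ v) h.integrableOn_grad x
  have hder := fun t ht =>
    h.weak_grad.hasDerivAt_mollify_line hΩ h.integrableOn h.integrableOn_grad (hx t ht)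
  simpa only [one_smul, zero_smul, add_zero, inner_mollify] using
    second_order_remainder_mem_Icc hm hM hder
    (fun t ht => h.hasDerivAt_mollify_grad_line hΩ (hx t ht)) hmem

end Hessian

/-! ### Pointwise Taylor estimates for functions with bounded weak Hessian -/

section Taylor

variable {d : ℕ}

/-- A sequence of mollifiers with shrinking supports. -/
noncomputable def shrinkingBump (d k : ℕ) : ContDiffBump (0 : Euc d) where
  rIn := 1 / (2 * ((k : ℝ) + 1))
  rOut := 1 / ((k : ℝ) + 1)
  rIn_pos := by positivity
  rIn_lt_rOut :=
    one_div_lt_one_div_of_lt (by positivity) (by linarith [k.cast_add_one_pos (α := ℝ)])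

lemma tendsto_shrinkingBump_rOut : Tendsto (fun k => (shrinkingBump d k).rOut) atTop (𝓝 0) :=
  tendsto_one_div_add_atTop_nhds_zero_nat

/-- The points of `Ω` where the mollifications of `u` and of its gradient converge. They have full
measure, and pointwise statements about `u` and `Du` hold there rather than merely a.e. -/
def approxPoints (Ω : Set (Euc d)) (u : Euc d → ℝ) (Du : Euc d → Euc d) : Set (Euc d) :=
  {x | x ∈ Ω ∧ Tendsto (fun k => mollify (shrinkingBump d k) Ω u x) atTop (𝓝 (u x)) ∧
    Tendsto (fun k => mollify (shrinkingBump d k) Ω Du x) atTop (𝓝 (Du x))}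

variable {Ω V : Set (Euc d)} {u : Euc d → ℝ} {Du : Euc d → Euc d}
  {H : Euc d → Matrix (Fin d) (Fin d) ℝ} {x y : Euc d} {m M Λ : ℝ}

lemma approxPoints_subset : approxPoints Ω u Du ⊆ Ω := fun _ hx => hx.1

lemma ae_tendsto_mollify {F : Type*} [NormedAddCommGroup F] [NormedSpace ℝ F] [CompleteSpace F]
    (hΩ : MeasurableSet Ω) {f : Euc d → F} (hf : IntegrableOn f Ω) :
    ∀ᵐ x ∂(volume.restrict Ω),
      Tendsto (fun k => mollify (shrinkingBump d k) Ω f x) atTop (𝓝 (f x)) := by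
  rw [ae_restrict_iff' hΩ]
  have rOut_le : ∀ k, (shrinkingBump d k).rOut ≤ 2 * (shrinkingBump d k).rIn := fun k => by
    simp only [shrinkingBump]
    field_simp
    rfl
  filter_upwards [ContDiffBump.ae_convolution_tendsto_right_of_locallyIntegrable
    tendsto_shrinkingBump_rOut (Eventually.of_forall rOut_le)
    (hf.integrable_indicator hΩ).locallyIntegrable] with x hx hxΩ
  simpa only [mollify_eq_convolution hΩ, indicator_of_mem hxΩ] using hx

lemma IsW21.ae_mem_approxPoints (h : IsW21 Ω u Du H) (hΩ : MeasurableSet Ω) :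
    ∀ᵐ x ∂(volume.restrict Ω), x ∈ approxPoints Ω u Du := by
  filter_upwards [ae_restrict_mem hΩ, ae_tendsto_mollify hΩ h.integrableOn,
    ae_tendsto_mollify hΩ h.integrableOn_grad] with x hx hu hDu
  exact ⟨hx, hu, hDu⟩

lemma eventually_tube_subset (hV : IsOpen V) (hVc : Convex ℝ V) (hx : x ∈ V) (hy : y ∈ V) :
    ∀ᶠ k in atTop, ∀ t ∈ Icc (0 : ℝ) 1,
      Metric.closedBall (x + t • (y - x)) (shrinkingBump d k).rOut ⊆ V := by
  have hcompact : IsCompact (segment ℝ x y) := by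
    rw [segment_eq_image_lineMap]
    exact isCompact_Icc.image AffineMap.lineMap_continuous
  obtain ⟨δ, hδ, hsub⟩ :=
    hcompact.exists_cthickening_subset_open hV (hVc.segment_subset hx hy)
  filter_upwards [tendsto_shrinkingBump_rOut (d := d) (Iio_mem_nhds hδ)] with k hk t ht
  have hmem : x + t • (y - x) ∈ segment ℝ x y := by
    rw [segment_eq_image']
    exact ⟨t, ht, rfl⟩
  exact (Metric.closedBall_subset_cthickening hmem _).trans
    ((Metric.cthickening_mono (le_of_lt hk) _).trans hsub)

lemma ae_of_mem_tube (hV : MeasurableSet V) {P : Euc d → Prop}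
    (hP : ∀ᵐ z ∂(volume.restrict V), P z) {v : Euc d} {r : ℝ}
    (htube : ∀ t ∈ Icc (0 : ℝ) 1, Metric.closedBall (x + t • v) r ⊆ V) :
    ∀ᵐ z ∂(volume.restrict Ω), (∃ t ∈ Icc (0 : ℝ) 1, z ∈ Metric.ball (x + t • v) r) → P z := by
  rw [ae_restrict_iff' hV] at hP
  refine ae_restrict_of_ae ?_
  filter_upwards [hP] with z hz
  rintro ⟨t, ht, hzt⟩
  exact hz (htube t ht (Metric.ball_subset_closedBall hzt))

lemma IsW21.remainder_mem_Icc (h : IsW21 Ω u Du H) (hΩ : MeasurableSet Ω) (hV : IsOpen V)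
    (hVc : Convex ℝ V) (hVΩ : V ⊆ Ω) (hx : x ∈ approxPoints Ω u Du ∩ V)
    (hy : y ∈ approxPoints Ω u Du ∩ V) (hm : m ≤ 0) (hM : 0 ≤ M)
    (hb : ∀ᵐ z ∂(volume.restrict V), quadForm (H z) (y - x) ∈ Icc m M) :
    u y - u x - inner ℝ (y - x) (Du x) ∈ Icc m M := by
  have hlim : Tendsto (fun k => mollify (shrinkingBump d k) Ω u (x + (y - x)) -
      mollify (shrinkingBump d k) Ω u x -
      inner ℝ (y - x) (mollify (shrinkingBump d k) Ω Du x)) atTop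
      (𝓝 (u y - u x - inner ℝ (y - x) (Du x))) := by
    rw [add_sub_cancel]
    exact (hy.1.2.1.sub hx.1.2.1).sub (tendsto_const_nhds.inner hx.1.2.2)
  refine isClosed_Icc.mem_of_tendsto hlim ?_
  filter_upwards [eventually_tube_subset hV hVc hx.2 hy.2] with k hk
  exact h.mollify_remainder_mem_Icc hΩ hm hM (fun t ht => (hk t ht).trans hVΩ)
    (ae_of_mem_tube hV.measurableSet hb hk)

lemma HasWeakGradient.increment_mem_Icc {f : Euc d → ℝ} {g : Euc d → Euc d}
    (hw : HasWeakGradient Ω f g) (hΩ : MeasurableSet Ω) (hf : IntegrableOn f Ω)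
    (hg : IntegrableOn g Ω) (hV : IsOpen V) (hVc : Convex ℝ V) (hVΩ : V ⊆ Ω)
    (hx : x ∈ V) (hy : y ∈ V)
    (hfx : Tendsto (fun k => mollify (shrinkingBump d k) Ω f x) atTop (𝓝 (f x)))
    (hfy : Tendsto (fun k => mollify (shrinkingBump d k) Ω f y) atTop (𝓝 (f y)))
    (hb : ∀ᵐ z ∂(volume.restrict V), inner ℝ (y - x) (g z) ∈ Icc m M) :
    f y - f x ∈ Icc m M := by
  refine isClosed_Icc.mem_of_tendsto (hfy.sub hfx) ?_
  filter_upwards [eventually_tube_subset hV hVc hx hy] with k hk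
  have hinc := hw.mollify_increment_mem_Icc (φ := shrinkingBump d k) hΩ hf hg
    (fun t ht => (hk t ht).trans hVΩ) (ae_of_mem_tube hV.measurableSet hb hk)
  rwa [add_sub_cancel] at hinc

lemma IsW21.tendsto_mollify_grad_apply (h : IsW21 Ω u Du H) (hx : x ∈ approxPoints Ω u Du)
    (i : Fin d) :
    Tendsto (fun k => mollify (shrinkingBump d k) Ω (fun z => Du z i) x) atTop (𝓝 (Du x i)) := by
  have hlim := ((EuclideanSpace.proj (𝕜 := ℝ) i).continuous.tendsto (Du x)).comp hx.2.2
  exact hlim.congr fun k => clm_mollify (EuclideanSpace.proj i) h.integrableOn_grad x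

lemma IsW21.abs_grad_sub_apply_le (h : IsW21 Ω u Du H) (hΩ : MeasurableSet Ω) (hV : IsOpen V)
    (hVc : Convex ℝ V) (hVΩ : V ⊆ Ω) (hΛ : ∀ᵐ z ∂(volume.restrict V), ‖H z‖ ≤ Λ)
    (hx : x ∈ approxPoints Ω u Du ∩ V) (hy : y ∈ approxPoints Ω u Du ∩ V) (i : Fin d) :
    |Du y i - Du x i| ≤ Λ * ‖y - x‖ := by
  refine abs_le.2 ((h.weak_hess i).increment_mem_Icc hΩ (h.integrableOn_grad.eval_piLp i)
    (h.integrableOn_hess_row i) hV hVc hVΩ hx.2 hy.2 (h.tendsto_mollify_grad_apply hx.1 i)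
    (h.tendsto_mollify_grad_apply hy.1 i) ?_)
  filter_upwards [hΛ] with z hz
  have inner_row : inner ℝ (y - x) (WithLp.toLp 2 (H z i)) =
      Matrix.toEuclideanCLM (𝕜 := ℝ) (H z) (y - x) i := by
    simp [Matrix.mulVec, dotProduct, PiLp.inner_apply, mul_sub]
  rw [inner_row]
  exact abs_le.1 ((PiLp.norm_apply_le _ i).trans ((norm_toEuclideanCLM_apply_le _ _).trans
    (mul_le_mul_of_nonneg_right hz (norm_nonneg _))))

lemma IsW21.exists_norm_grad_le (h : IsW21 Ω u Du H) (hΩ : MeasurableSet Ω) (hV : IsOpen V)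
    (hVc : Convex ℝ V) (hVb : Bornology.IsBounded V) (hVΩ : V ⊆ Ω) (hΛ0 : 0 ≤ Λ)
    (hΛ : ∀ᵐ z ∂(volume.restrict V), ‖H z‖ ≤ Λ) :
    ∃ K, 0 ≤ K ∧ ∀ x ∈ approxPoints Ω u Du ∩ V, ‖Du x‖ ≤ K := by
  obtain ⟨D, hD⟩ := Metric.isBounded_iff.1 hVb
  rcases (approxPoints Ω u Du ∩ V).eq_empty_or_nonempty with hempty | ⟨z, hz⟩
  · exact ⟨0, le_rfl, by simp [hempty]⟩
  have hD0 : 0 ≤ D := dist_nonneg.trans (hD hz.2 hz.2)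
  refine ⟨∑ i, (|Du z i| + Λ * D), by positivity, fun x hx => ?_⟩
  calc ‖Du x‖ ≤ ∑ i, |Du x i| := by
        conv_lhs => rw [← (EuclideanSpace.basisFun (Fin d) ℝ).sum_repr (Du x)]
        exact (norm_sum_le _ _).trans_eq (by simp [norm_smul])
    _ ≤ ∑ i, (|Du z i| + Λ * D) := Finset.sum_le_sum fun i _ => ?_
  have hsub : |Du x i - Du z i| ≤ Λ * D :=
    (h.abs_grad_sub_apply_le hΩ hV hVc hVΩ hΛ hz hx i).trans (by
      rw [← dist_eq_norm]
      exact mul_le_mul_of_nonneg_left (hD hx.2 hz.2) hΛ0)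
  linarith [abs_sub_abs_le_abs_sub (Du x i) (Du z i)]

lemma IsW21.exists_lipschitzOnWith (h : IsW21 Ω u Du H) (hΩ : MeasurableSet Ω) (hV : IsOpen V)
    (hVc : Convex ℝ V) (hVb : Bornology.IsBounded V) (hVΩ : V ⊆ Ω) (hΛ0 : 0 ≤ Λ)
    (hΛ : ∀ᵐ z ∂(volume.restrict V), ‖H z‖ ≤ Λ) :
    ∃ C, LipschitzOnWith C u (approxPoints Ω u Du ∩ V) := by
  obtain ⟨K, _, hK⟩ := h.exists_norm_grad_le hΩ hV hVc hVb hVΩ hΛ0 hΛ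
  obtain ⟨D, hD⟩ := Metric.isBounded_iff.1 hVb
  refine ⟨_, LipschitzOnWith.of_dist_le' (K := Λ * D + K) fun y hy x hx => ?_⟩
  have hyx : ‖y - x‖ ≤ D := by
    rw [← dist_eq_norm]
    exact hD hy.2 hx.2
  have hrem : |u y - u x - inner ℝ (y - x) (Du x)| ≤ Λ * ‖y - x‖ ^ 2 := by
    have hΛv : 0 ≤ Λ * ‖y - x‖ ^ 2 := by positivity
    refine abs_le.2 (h.remainder_mem_Icc hΩ hV hVc hVΩ hx hy (neg_nonpos.2 hΛv) hΛv ?_)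
    filter_upwards [hΛ] with z hz
    exact abs_le.1 ((abs_quadForm_le _ _).trans (mul_le_mul_of_nonneg_right hz (sq_nonneg _)))
  have hgrad : |inner ℝ (y - x) (Du x)| ≤ ‖y - x‖ * K :=
    (abs_real_inner_le_norm _ _).trans (mul_le_mul_of_nonneg_left (hK x hx) (norm_nonneg _))
  rw [Real.dist_eq, dist_eq_norm]
  calc |u y - u x| ≤ |u y - u x - inner ℝ (y - x) (Du x)| + |inner ℝ (y - x) (Du x)| := by
        linarith [abs_sub_abs_le_abs_sub (u y - u x) (inner ℝ (y - x) (Du x))]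
    _ ≤ Λ * (D * ‖y - x‖) + ‖y - x‖ * K := by
        refine add_le_add (hrem.trans ?_) hgrad
        rw [sq]
        gcongr
    _ = (Λ * D + K) * ‖y - x‖ := by ring

lemma nonempty_inter_of_ae_mem {A W : Set (Euc d)} (hA : ∀ᵐ x ∂(volume.restrict Ω), x ∈ A)
    (hW : IsOpen W) (hne : W.Nonempty) (hWΩ : W ⊆ Ω) : (W ∩ A).Nonempty := by
  have hAW : ∀ᵐ x ∂(volume.restrict W), x ∈ A := ae_mono (Measure.restrict_mono hWΩ le_rfl) hA
  have : (ae (volume.restrict W)).NeBot := by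
    rw [ae_neBot, Ne, Measure.restrict_eq_zero]
    exact (hW.measure_pos volume hne).ne'
  exact ((ae_restrict_mem hW.measurableSet).and hAW).exists

lemma closure_subset_closure_of_ae_mem {A : Set (Euc d)}
    (hA : ∀ᵐ x ∂(volume.restrict Ω), x ∈ A) (hV : IsOpen V) (hVΩ : V ⊆ Ω) :
    closure V ⊆ closure (A ∩ V) := by
  intro y hy
  rw [mem_closure_iff] at hy ⊢
  intro W hW hyW
  obtain ⟨z, ⟨hzW, hzV⟩, hzA⟩ := nonempty_inter_of_ae_mem hA (hW.inter hV) (hy W hW hyW)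
    (inter_subset_right.trans hVΩ)
  exact ⟨z, hzW, hzA, hzV⟩

lemma IsW21.exists_tendsto_approxPoints (h : IsW21 Ω u Du H) (hΩ : IsOpen Ω) (hΛ0 : 0 ≤ Λ)
    (hΛ : ∀ᵐ z ∂(volume.restrict Ω), ‖H z‖ ≤ Λ) (hx : x ∈ Ω) :
    ∃ c, Tendsto u (𝓝[approxPoints Ω u Du] x) (𝓝 c) ∧ (x ∈ approxPoints Ω u Du → c = u x) := by
  obtain ⟨r, hr, hball⟩ := Metric.isOpen_iff.1 hΩ x hx
  obtain ⟨C, hC⟩ := h.exists_lipschitzOnWith hΩ.measurableSet Metric.isOpen_ball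
    (convex_ball x r) Metric.isBounded_ball hball hΛ0
    (ae_mono (Measure.restrict_mono hball le_rfl) hΛ)
  obtain ⟨g, hg, hug⟩ := hC.extend_real
  have hnhds := Metric.ball_mem_nhds x hr
  refine ⟨g x, ?_, fun hxG => (hug ⟨hxG, mem_of_mem_nhds hnhds⟩).symm⟩
  refine (hg.continuous.continuousAt.tendsto.mono_left nhdsWithin_le_nhds).congr' ?_
  filter_upwards [self_mem_nhdsWithin, nhdsWithin_le_nhds hnhds] with y hy hyball
    using (hug ⟨hy, hyball⟩).symm

lemma IsW21.exists_continuousOn_closure (h : IsW21 Ω u Du H) (hΩ : IsOpen Ω) (hΛ0 : 0 ≤ Λ)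
    (hΛ : ∀ᵐ z ∂(volume.restrict Ω), ‖H z‖ ≤ Λ) {g : Euc d → ℝ}
    (hg : ∀ z ∈ frontier Ω, Tendsto u (𝓝[Ω] z) (𝓝 (g z))) :
    ∃ U : Euc d → ℝ, ContinuousOn U (closure Ω) ∧ EqOn U u (approxPoints Ω u Du) ∧
      EqOn U g (frontier Ω) := by
  set G := approxPoints Ω u Du
  have hdense : closure Ω ⊆ closure G :=
    (closure_subset_closure_of_ae_mem (h.ae_mem_approxPoints hΩ.measurableSet) hΩ
      subset_rfl).trans (closure_mono inter_subset_left)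
  have hlim : ∀ x ∈ frontier Ω, Tendsto u (𝓝[G] x) (𝓝 (g x)) := fun x hx =>
    (hg x hx).mono_left (nhdsWithin_mono _ approxPoints_subset)
  refine ⟨extendFrom G u, continuousOn_extendFrom hdense fun x hx => ?_, fun x hx => ?_,
    fun x hx => extendFrom_eq (hdense (frontier_subset_closure hx)) (hlim x hx)⟩
  · by_cases hxΩ : x ∈ Ω
    · exact (h.exists_tendsto_approxPoints hΩ hΛ0 hΛ hxΩ).imp fun c hc => hc.1
    · exact ⟨_, hlim x ⟨hx, by rwa [hΩ.interior_eq]⟩⟩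
  · have hxΩ := approxPoints_subset hx
    obtain ⟨c, hc, hcu⟩ := h.exists_tendsto_approxPoints hΩ hΛ0 hΛ hxΩ
    rw [extendFrom_eq (hdense (subset_closure hxΩ)) hc, hcu hx]

lemma IsW21.remainder_mem_Icc_of_mem_closure (h : IsW21 Ω u Du H) (hΩ : MeasurableSet Ω)
    {U : Euc d → ℝ} (hU : ContinuousOn U (closure Ω)) (hUu : EqOn U u (approxPoints Ω u Du))
    (hV : IsOpen V) (hVc : Convex ℝ V) (hVΩ : V ⊆ Ω) (hx : x ∈ approxPoints Ω u Du ∩ V)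
    (hy : y ∈ closure V) {S : Matrix (Fin d) (Fin d) ℝ} (hS : S.PosSemidef)
    (hb : ∀ᵐ z ∂(volume.restrict V), ∀ v, quadForm (H z) v ∈ Icc 0 (quadForm S v)) :
    U y - u x - inner ℝ (y - x) (Du x) ∈ Icc 0 (quadForm S (y - x)) := by
  set A := approxPoints Ω u Du ∩ V
  have : (𝓝[A] y).NeBot := mem_closure_iff_nhdsWithin_neBot.1
    (closure_subset_closure_of_ae_mem (h.ae_mem_approxPoints hΩ) hV hVΩ hy)
  have hid : Tendsto (fun z : Euc d => z) (𝓝[A] y) (𝓝 y) := nhdsWithin_le_nhds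
  have hUy : Tendsto U (𝓝[A] y) (𝓝 (U y)) := (hU y (closure_mono hVΩ hy)).tendsto.mono_left
    (nhdsWithin_mono _ fun z hz => subset_closure (hVΩ hz.2))
  have hrem : Tendsto (fun z => U z - u x - inner ℝ (z - x) (Du x)) (𝓝[A] y)
      (𝓝 (U y - u x - inner ℝ (y - x) (Du x))) :=
    (hUy.sub_const _).sub ((hid.sub_const x).inner tendsto_const_nhds)
  have hquad : Tendsto (fun z => quadForm S (z - x)) (𝓝[A] y) (𝓝 (quadForm S (y - x))) :=
    ((continuous_quadForm S).tendsto _).comp (hid.sub_const x)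
  have hbounds : ∀ᶠ z in 𝓝[A] y,
      U z - u x - inner ℝ (z - x) (Du x) ∈ Icc 0 (quadForm S (z - x)) := by
    filter_upwards [self_mem_nhdsWithin] with z hz
    rw [hUu hz.1]
    exact h.remainder_mem_Icc hΩ hV hVc hVΩ hx hz le_rfl (quadForm_nonneg hS _)
      (hb.mono fun w hw => hw _)
  exact ⟨ge_of_tendsto hrem (hbounds.mono fun z hz => hz.1),
    le_of_tendsto_of_tendsto hrem hquad (hbounds.mono fun z hz => hz.2)⟩

end Taylor
/-! ### Interpolation on an element -/

section Element

variable {d : ℕ}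

lemma abs_linear_le_of_mapsTo_Icc {E : Type*} [NormedAddCommGroup E] [NormedSpace ℝ E]
    {q : E →ᵃ[ℝ] ℝ} {c : E} {ρ M : ℝ} (hρ : 0 < ρ)
    (hq : MapsTo q (Metric.closedBall c ρ) (Icc 0 M)) (w : E) :
    |q.linear w| ≤ M / ρ * ‖w‖ := by
  rcases eq_or_ne w 0 with rfl | hw
  · simp
  have hw0 : 0 < ‖w‖ := norm_pos_iff.2 hw
  have hr : 0 < ρ / ‖w‖ := div_pos hρ hw0
  have hmem : c + (ρ / ‖w‖) • w ∈ Metric.closedBall c ρ := by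
    rw [mem_closedBall_iff_norm, add_sub_cancel_left, norm_smul, Real.norm_of_nonneg hr.le,
      div_mul_cancel₀ _ hw0.ne']
  have hincr : q (c + (ρ / ‖w‖) • w) - q c = ρ / ‖w‖ * q.linear w := by
    rw [add_comm, ← vadd_eq_add, AffineMap.map_vadd, map_smul, vadd_eq_add, add_sub_cancel_right,
      smul_eq_mul]
  obtain ⟨hlo, hhi⟩ := hq hmem
  obtain ⟨hclo, hchi⟩ := hq (Metric.mem_closedBall_self hρ.le)
  have hosc : ρ / ‖w‖ * |q.linear w| ≤ M := by
    rw [← abs_of_pos hr, ← abs_mul, ← hincr]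
    exact abs_le.2 ⟨by linarith, by linarith⟩
  calc |q.linear w| = ρ / ‖w‖ * |q.linear w| * (‖w‖ / ρ) := by field_simp
    _ ≤ M * (‖w‖ / ρ) := by gcongr
    _ = M / ρ * ‖w‖ := by ring

lemma mapsTo_cell {s : Finset (Euc d)} {q : Euc d →ᵃ[ℝ] ℝ} {I : Set ℝ} (hI : Convex ℝ I)
    (h : MapsTo q s I) : MapsTo q (cell s) I :=
  convexHull_min h (hI.affine_preimage q)

lemma exists_affineMap_sub_taylor (p : Euc d →ᵃ[ℝ] ℝ) (x : Euc d) (u₀ : ℝ) (w₀ : Euc d) :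
    ∃ q : Euc d →ᵃ[ℝ] ℝ, (∀ y, q y = p y - u₀ - inner ℝ (y - x) w₀) ∧
      ∀ w, q.linear w = p.linear w - inner ℝ w w₀ := by
  refine ⟨p - ((innerSL ℝ w₀).toLinearMap.toAffineMap +
    AffineMap.const ℝ (Euc d) (u₀ - inner ℝ w₀ x)), fun y => ?_, fun w => ?_⟩
  · simp only [AffineMap.coe_sub, AffineMap.coe_add, Pi.sub_apply, Pi.add_apply,
      AffineMap.const_apply, LinearMap.coe_toAffineMap, ContinuousLinearMap.coe_coe,
      innerSL_apply_apply, real_inner_comm w₀, inner_sub_right]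
    ring
  · simp [real_inner_comm w₀]

lemma norm_le_of_abs_inner_le {E : Type*} [NormedAddCommGroup E] [InnerProductSpace ℝ E] {v : E}
    {M : ℝ} (hM : 0 ≤ M) (h : ∀ w, |inner ℝ v w| ≤ M * ‖w‖) : ‖v‖ ≤ M := by
  rw [← innerSL_apply_norm (𝕜 := ℝ) v]
  exact ContinuousLinearMap.opNorm_le_bound _ hM h

/-- Bound for the error of linear interpolation on the image of the simplex `Khat` under an affine
map with Jacobian matrix `J`, for functions with a Hessian between `0` and `Cp • S`. -/
noncomputable def valueErrorBound (Khat : Finset (Euc d)) (Cp : ℝ)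
    (S J : Matrix (Fin d) (Fin d) ℝ) : ℝ :=
  Cp * ((Jᵀ * S * J).trace * Metric.diam (cell Khat) ^ 2)

/-- Bound for the gradient of the interpolation error that `valueErrorBound` bounds, where `ρ` is
the radius of a ball contained in `Khat`. -/
noncomputable def gradErrorBound (Khat : Finset (Euc d)) (ρ Cp : ℝ)
    (S J : Matrix (Fin d) (Fin d) ℝ) : ℝ :=
  valueErrorBound Khat Cp S J / ρ * √(invJacobianBound S J)

variable {Khat s : Finset (Euc d)} {F : Euc d →ᵃ[ℝ] Euc d} {c x y : Euc d} {ρ Cp : ℝ}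
  {S J : Matrix (Fin d) (Fin d) ℝ}

lemma valueErrorBound_nonneg (hS : S.PosSemidef) (hCp : 0 ≤ Cp) :
    0 ≤ valueErrorBound Khat Cp S J := by
  have htr := (hS.conjTranspose_mul_mul_same J).trace_nonneg
  rw [Matrix.conjTranspose_eq_transpose_of_trivial] at htr
  unfold valueErrorBound
  positivity

lemma gradErrorBound_nonneg (hρ : 0 < ρ) (hS : S.PosSemidef) (hCp : 0 ≤ Cp) :
    0 ≤ gradErrorBound Khat ρ Cp S J := by
  have := valueErrorBound_nonneg (Khat := Khat) (J := J) hS hCp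
  unfold gradErrorBound
  positivity

lemma quadForm_sub_le (hF : F '' cell Khat = cell s) (hS : S.PosSemidef) (hx : x ∈ cell s)
    (hy : y ∈ cell s) :
    quadForm S (y - x) ≤
      ((jacobian F)ᵀ * S * jacobian F).trace * Metric.diam (cell Khat) ^ 2 := by
  rw [← hF] at hx hy
  obtain ⟨a, ha, rfl⟩ := hx
  obtain ⟨b, hb, rfl⟩ := hy
  have hJSJ := hS.conjTranspose_mul_mul_same (jacobian F)
  rw [Matrix.conjTranspose_eq_transpose_of_trivial] at hJSJ
  have hdiam : ‖b - a‖ ≤ Metric.diam (cell Khat) := by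
    rw [← dist_eq_norm]
    exact Metric.dist_le_diam_of_mem (isCompact_cell Khat).isBounded hb ha
  have htr := hJSJ.trace_nonneg
  calc quadForm S (F b - F a)
      = quadForm ((jacobian F)ᵀ * S * jacobian F) (b - a) := by
        rw [quadForm_transpose_mul_mul, toEuclideanCLM_jacobian, ← vsub_eq_sub b a,
          F.linearMap_vsub, vsub_eq_sub]
    _ ≤ ((jacobian F)ᵀ * S * jacobian F).trace * ‖b - a‖ ^ 2 := quadForm_le_trace_mul hJSJ _
    _ ≤ _ := by gcongr

lemma mapsTo_Icc_valueErrorBound (hF : F '' cell Khat = cell s) (hS : S.PosSemidef)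
    (hCp : 0 ≤ Cp) (hx : x ∈ cell s) {q : Euc d →ᵃ[ℝ] ℝ}
    (hq : ∀ v ∈ s, q v ∈ Icc 0 (Cp * quadForm S (v - x))) :
    MapsTo q (cell s) (Icc 0 (valueErrorBound Khat Cp S (jacobian F))) :=
  mapsTo_cell (convex_Icc _ _) fun v hv => ⟨(hq v hv).1, (hq v hv).2.trans
    (mul_le_mul_of_nonneg_left (quadForm_sub_le hF hS hx (subset_cell s hv)) hCp)⟩

variable [NeZero d]

lemma norm_le_sqrt_invJacobianBound_mul (hS : S.PosDef) (hJ : (jacobian F).det ≠ 0) (w : Euc d) :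
    ‖w‖ ≤ √(invJacobianBound S (jacobian F)) * ‖F.linear w‖ := by
  rw [← toEuclideanCLM_jacobian, ← Real.sqrt_sq (norm_nonneg w),
    ← Real.sqrt_sq (norm_nonneg (Matrix.toEuclideanCLM (𝕜 := ℝ) _ w)),
    ← Real.sqrt_mul (invJacobianBound_nonneg hS hJ)]
  exact Real.sqrt_le_sqrt (norm_sq_le_invJacobianBound_mul hS hJ w)

lemma abs_linear_le_gradErrorBound_mul (hF : F '' cell Khat = cell s) (hρ : 0 < ρ)
    (hball : Metric.closedBall c ρ ⊆ cell Khat) (hS : S.PosDef) (hJ : (jacobian F).det ≠ 0)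
    (hCp : 0 ≤ Cp) {q : Euc d →ᵃ[ℝ] ℝ}
    (hq : MapsTo q (cell s) (Icc 0 (valueErrorBound Khat Cp S (jacobian F)))) (w : Euc d) :
    |q.linear w| ≤ gradErrorBound Khat ρ Cp S (jacobian F) * ‖w‖ := by
  have hdet : LinearMap.det F.linear ≠ 0 := by rwa [jacobian, LinearMap.det_toMatrix] at hJ
  obtain ⟨w, rfl⟩ := (LinearMap.equivOfDetNeZero F.linear hdet).surjective w
  have hqF : MapsTo (q.comp F) (Metric.closedBall c ρ)
      (Icc 0 (valueErrorBound Khat Cp S (jacobian F))) :=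
    fun a ha => hq (hF ▸ mem_image_of_mem F (hball ha))
  have hnonneg := valueErrorBound_nonneg (Khat := Khat) (J := jacobian F) hS.posSemidef hCp
  calc |q.linear (F.linear w)| ≤ valueErrorBound Khat Cp S (jacobian F) / ρ * ‖w‖ :=
        abs_linear_le_of_mapsTo_Icc hρ hqF w
    _ ≤ valueErrorBound Khat Cp S (jacobian F) / ρ *
          (√(invJacobianBound S (jacobian F)) * ‖F.linear w‖) := by
        gcongr
        exact norm_le_sqrt_invJacobianBound_mul hS hJ w
    _ = _ := by rw [gradErrorBound, ← mul_assoc]; rfl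

lemma le_sqrt_invJacobianBound_mul_diam (hF : F '' cell Khat = cell s) (hρ : 0 < ρ)
    (hball : Metric.closedBall c ρ ⊆ cell Khat) (hS : S.PosDef) (hJ : (jacobian F).det ≠ 0) :
    ρ ≤ √(invJacobianBound S (jacobian F)) * Metric.diam (cell s) := by
  obtain ⟨w, hw⟩ := exists_norm_eq (Euc d) hρ.le
  have hmem : ∀ a ∈ Metric.closedBall c ρ, F a ∈ cell s := fun a ha =>
    hF ▸ mem_image_of_mem F (hball ha)
  have hFw : F.linear w = F (w + c) - F c := by
    rw [← vadd_eq_add w c, AffineMap.map_vadd, vadd_eq_add, add_sub_cancel_right]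
  calc ρ = ‖w‖ := hw.symm
    _ ≤ √(invJacobianBound S (jacobian F)) * ‖F.linear w‖ :=
        norm_le_sqrt_invJacobianBound_mul hS hJ w
    _ ≤ _ := by
        rw [hFw, ← dist_eq_norm]
        gcongr
        exact Metric.dist_le_diam_of_mem (isCompact_cell s).isBounded
          (hmem _ (by simp [hw])) (hmem _ (Metric.mem_closedBall_self hρ.le))

lemma valueErrorBound_le_diam_mul_gradErrorBound (hF : F '' cell Khat = cell s) (hρ : 0 < ρ)
    (hball : Metric.closedBall c ρ ⊆ cell Khat) (hS : S.PosDef) (hJ : (jacobian F).det ≠ 0)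
    (hCp : 0 ≤ Cp) :
    valueErrorBound Khat Cp S (jacobian F) ≤
      Metric.diam (cell s) * gradErrorBound Khat ρ Cp S (jacobian F) := by
  have hnonneg := valueErrorBound_nonneg (Khat := Khat) (J := jacobian F) hS.posSemidef hCp
  calc valueErrorBound Khat Cp S (jacobian F)
      = valueErrorBound Khat Cp S (jacobian F) / ρ * ρ := (div_mul_cancel₀ _ hρ.ne').symm
    _ ≤ valueErrorBound Khat Cp S (jacobian F) / ρ *
          (√(invJacobianBound S (jacobian F)) * Metric.diam (cell s)) := by
        gcongr
        exact le_sqrt_invJacobianBound_mul_diam hF hρ hball hS hJ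
    _ = _ := by rw [gradErrorBound]; ring

lemma mul_gradErrorBound_sq_le {V Cali : ℝ} (hS : S.PosDef) (hV : V = |J.det|) (hV0 : 0 < V)
    (h : 1 / (d : ℝ) * (Jᵀ * metricTensor S * J).trace ≤
      Cali * V ^ ((2 : ℝ) / d) * (metricTensor S).det ^ ((1 : ℝ) / d)) :
    V * gradErrorBound Khat ρ Cp S J ^ 2 ≤
      (Metric.diam (cell Khat) ^ 2 / ρ) ^ 2 * Cp ^ 2 * ((d * Cali) ^ (d + 1) *
        (V * (metricTensor S).det ^ ((1 : ℝ) / 2)) ^ (((d : ℝ) + 2) / d)) := by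
  have hJ : J.det ≠ 0 := abs_pos.1 (hV ▸ hV0)
  calc V * gradErrorBound Khat ρ Cp S J ^ 2
      = (Metric.diam (cell Khat) ^ 2 / ρ) ^ 2 * Cp ^ 2 *
          (V * (Jᵀ * S * J).trace ^ 2 * invJacobianBound S J) := by
        rw [gradErrorBound, mul_pow, Real.sq_sqrt (invJacobianBound_nonneg hS hJ),
          valueErrorBound]
        ring
    _ ≤ _ := by
        exact mul_le_mul_of_nonneg_left
          (mul_trace_sq_mul_invJacobianBound_le hS hV hV0 h) (by positivity)

end Element
/-! ### Piecewise Lipschitz functions -/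

lemma dist_le_of_Icc_subset_biUnion {β ι : Type*} [PseudoMetricSpace β] {f : ℝ → β} {K : NNReal}
    {C : ι → Set ℝ} {b : ℝ} (t : Finset ι) (hC : ∀ i ∈ t, IsClosed (C i))
    (hf : ∀ i ∈ t, LipschitzOnWith K f (C i)) :
    ∀ a ≤ b, Icc a b ⊆ ⋃ i ∈ t, C i → dist (f a) (f b) ≤ K * (b - a) := by
  classical
  induction t using Finset.strongInduction with
  | H t ih =>
    intro a hab hcov
    obtain ⟨i, hit, hai⟩ : ∃ i ∈ t, a ∈ C i := by simpa using hcov (left_mem_Icc.2 hab)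
    obtain ⟨c, ⟨hci, hcab⟩, hmax⟩ : ∃ c, IsGreatest (C i ∩ Icc a b) c :=
      (isCompact_Icc.inter_left (hC i hit)).exists_isGreatest ⟨a, hai, left_mem_Icc.2 hab⟩
    have hac : dist (f a) (f c) ≤ K * (c - a) := by
      simpa [Real.dist_eq, abs_sub_comm a, abs_of_nonneg (sub_nonneg.2 hcab.1)]
        using (hf i hit).dist_le_mul a hai c hci
    rcases hcab.2.eq_or_lt with rfl | hcb
    · exact hac
    have hIoc : Ioc c b ⊆ ⋃ j ∈ t.erase i, C j := fun y hy => by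
      have hyab : y ∈ Icc a b := ⟨hcab.1.trans hy.1.le, hy.2⟩
      obtain ⟨j, hjt, hyj⟩ : ∃ j ∈ t, y ∈ C j := by simpa using hcov hyab
      have hji : j ≠ i := by
        rintro rfl
        exact (hmax ⟨hyj, hyab⟩).not_gt hy.1
      exact mem_biUnion (Finset.mem_erase.2 ⟨hji, hjt⟩) hyj
    have hIcc : Icc c b ⊆ ⋃ j ∈ t.erase i, C j := by
      rw [← closure_Ioc hcb.ne]
      exact closure_minimal hIoc ((t.erase i).finite_toSet.isClosed_biUnion
        fun j hj => hC j (Finset.mem_of_mem_erase hj))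
    have hcb' := ih _ (Finset.erase_ssubset hit) (fun j hj => hC j (Finset.mem_of_mem_erase hj))
      (fun j hj => hf j (Finset.mem_of_mem_erase hj)) c hcb.le hIcc
    linarith [dist_triangle (f a) (f c) (f b)]

lemma lipschitzWith_of_finite_closed_cover {E β ι : Type*} [NormedAddCommGroup E]
    [NormedSpace ℝ E] [PseudoMetricSpace β] {f : E → β} {K : NNReal} {C : ι → Set E}
    (t : Finset ι) (hC : ∀ i ∈ t, IsClosed (C i)) (hf : ∀ i ∈ t, LipschitzOnWith K f (C i))
    (hcov : ⋃ i ∈ t, C i = univ) : LipschitzWith K f := by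
  refine LipschitzWith.of_dist_le_mul fun x y => ?_
  have hline : Continuous (AffineMap.lineMap x y : ℝ → E) := AffineMap.lineMap_continuous
  have hdist := dist_le_of_Icc_subset_biUnion (f := f ∘ (AffineMap.lineMap x y : ℝ → E)) (b := 1)
    t (fun i hi => (hC i hi).preimage hline)
    (fun i hi => (hf i hi).comp (lipschitzWith_lineMap x y).lipschitzOnWith (mapsTo_preimage _ _))
    0 zero_le_one (by simp only [← preimage_iUnion, hcov, preimage_univ, subset_univ])
  simpa using hdist

/-! ### Mollification of Lipschitz functions -/

section MollifyLipschitz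

variable {d : ℕ} {φ : ContDiffBump (0 : Euc d)} {w : Euc d → ℝ} {K : NNReal} {x : Euc d}

lemma mollify_univ_eq_integral (x : Euc d) :
    mollify φ univ w x = ∫ t, φ.normed volume t * w (x - t) := by
  rw [mollify_eq_convolution MeasurableSet.univ, indicator_univ, convolution_def]
  rfl

lemma mollify_univ_sub (hw : Continuous w) (x y : Euc d) :
    mollify φ univ w x - mollify φ univ w y =
      ∫ t, φ.normed volume t * (w (x - t) - w (y - t)) := by
  have hint : ∀ z, Integrable fun t => φ.normed volume t * w (z - t) := fun z =>
    (φ.continuous_normed.mul (hw.comp (continuous_const.sub continuous_id)))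
      |>.integrable_of_hasCompactSupport φ.hasCompactSupport_normed.mul_right
  simp only [mollify_univ_eq_integral, mul_sub, integral_sub (hint x) (hint y)]

lemma contDiff_mollify_univ (hw : Continuous w) : ContDiff ℝ ∞ (mollify φ univ w) := by
  rw [mollify_eq_convolution MeasurableSet.univ, indicator_univ]
  exact φ.hasCompactSupport_normed.contDiff_convolution_left _ φ.contDiff_normed
    hw.locallyIntegrable

lemma lipschitzWith_mollify_univ (hw : LipschitzWith K w) :
    LipschitzWith K (mollify φ univ w) := by
  refine LipschitzWith.of_dist_le_mul fun x y => ?_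
  have hbound : ∀ t, ‖φ.normed volume t * (w (x - t) - w (y - t))‖ ≤
      φ.normed volume t * (K * dist x y) := fun t => by
    rw [norm_mul, Real.norm_of_nonneg (φ.nonneg_normed t), ← dist_eq_norm, ← dist_sub_right x y t]
    exact mul_le_mul_of_nonneg_left (hw.dist_le_mul _ _) (φ.nonneg_normed t)
  calc dist (mollify φ univ w x) (mollify φ univ w y)
      ≤ ∫ t, φ.normed volume t * (K * dist x y) := by
        rw [dist_eq_norm, mollify_univ_sub hw.continuous]
        exact norm_integral_le_of_norm_le (φ.integrable_normed.mul_const _)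
          (Eventually.of_forall hbound)
    _ = K * dist x y := by rw [integral_mul_const, φ.integral_normed, one_mul]

lemma abs_mollify_univ_sub_le (hw : LipschitzWith K w) (x : Euc d) :
    |mollify φ univ w x - w x| ≤ K * φ.rOut := by
  rw [mollify_eq_convolution MeasurableSet.univ, indicator_univ, ← Real.dist_eq]
  refine ContDiffBump.dist_normed_convolution_le hw.continuous.aestronglyMeasurable fun y hy => ?_
  exact (hw.dist_le_mul y x).trans (mul_le_mul_of_nonneg_left (Metric.mem_ball.1 hy).le K.2)

lemma mollify_univ_eq_zero (h : ∀ y ∈ Metric.ball x φ.rOut, w y = 0) :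
    mollify φ univ w x = 0 := by
  rw [mollify, setIntegral_univ]
  refine integral_eq_zero_of_ae (Eventually.of_forall fun y => ?_)
  by_cases hy : y ∈ Metric.ball x φ.rOut
  · simp [h y hy]
  · simp [normed_sub_eq_zero hy]

lemma hasFDerivAt_mollify_univ_of_affine (hw : Continuous w) {r : ℝ} (hr : φ.rOut < r)
    {ℓ : Euc d →L[ℝ] ℝ} (h : ∀ a ∈ Metric.ball x r, w a - w x = ℓ (a - x)) :
    HasFDerivAt (mollify φ univ w) ℓ x := by
  have haffine : mollify φ univ w =ᶠ[𝓝 x] fun y => mollify φ univ w x + ℓ (y - x) := by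
    filter_upwards [Metric.ball_mem_nhds x (sub_pos.2 hr)] with y hy
    have hshift : ∀ t, φ.normed volume t * (w (y - t) - w (x - t)) =
        φ.normed volume t * ℓ (y - x) := fun t => by
      by_cases ht : φ.normed volume t = 0
      · simp [ht]
      have htn : ‖t‖ < φ.rOut := by
        rw [← Ne, ← Function.mem_support, φ.support_normed_eq] at ht
        simpa using ht
      have hyt : y - t ∈ Metric.ball x r := by
        rw [mem_ball_iff_norm, sub_right_comm]
        exact (norm_sub_le _ _).trans_lt (by linarith [mem_ball_iff_norm.1 hy])
      have hxt : x - t ∈ Metric.ball x r := by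
        rw [mem_ball_iff_norm, sub_sub_cancel_left, norm_neg]
        exact htn.trans hr
      rw [← sub_sub_sub_cancel_right _ _ (w x), h _ hyt, h _ hxt, ← map_sub]
      congr 2
      abel
    rw [← sub_eq_iff_eq_add', mollify_univ_sub hw]
    simp only [hshift, integral_mul_const, φ.integral_normed, one_mul]
  refine HasFDerivAt.congr_of_eventuallyEq ?_ haffine
  exact (ℓ.hasFDerivAt.comp x ((hasFDerivAt_id x).sub_const x)).const_add _

end MollifyLipschitz

/-! ### Soft thresholding -/

/-- Soft thresholding moves `t` towards zero by `ε`; it turns continuous functions with zero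
boundary values into functions with compact support. -/
noncomputable def softThreshold (ε t : ℝ) : ℝ := max (t - ε) 0 + min (t + ε) 0

section SoftThreshold

variable {ε t : ℝ}

lemma softThreshold_of_le (hε : 0 ≤ ε) (h : ε ≤ t) : softThreshold ε t = t - ε := by
  rw [softThreshold, max_eq_left (by linarith), min_eq_right (by linarith), add_zero]

lemma softThreshold_of_le_neg (hε : 0 ≤ ε) (h : t ≤ -ε) : softThreshold ε t = t + ε := by
  rw [softThreshold, max_eq_right (by linarith), min_eq_left (by linarith), zero_add]

lemma softThreshold_of_abs_le (h : |t| ≤ ε) : softThreshold ε t = 0 := by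
  obtain ⟨hlo, hhi⟩ := abs_le.1 h
  rw [softThreshold, max_eq_right (by linarith), min_eq_right (by linarith), add_zero]

lemma abs_softThreshold_sub_le (hε : 0 ≤ ε) (t : ℝ) : |softThreshold ε t - t| ≤ ε := by
  rcases le_total ε t with h | h
  · simp [softThreshold_of_le hε h, abs_of_nonneg hε]
  rcases le_total t (-ε) with h' | h'
  · simp [softThreshold_of_le_neg hε h', abs_of_nonneg hε]
  · simpa [softThreshold_of_abs_le (abs_le.2 ⟨h', h⟩)] using abs_le.2 ⟨h', h⟩

lemma softThreshold_sub_mem_Icc (hε : 0 ≤ ε) {a b : ℝ} (hab : a ≤ b) :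
    softThreshold ε b - softThreshold ε a ∈ Icc 0 (b - a) := by
  unfold softThreshold
  rcases max_cases (b - ε) 0 with hb | hb <;> rcases max_cases (a - ε) 0 with ha | ha <;>
  rcases min_cases (b + ε) 0 with hb' | hb' <;> rcases min_cases (a + ε) 0 with ha' | ha' <;>
  constructor <;> linarith

lemma lipschitzWith_softThreshold (hε : 0 ≤ ε) : LipschitzWith 1 (softThreshold ε) := by
  refine LipschitzWith.of_dist_le_mul fun a b => ?_
  rw [NNReal.coe_one, one_mul]
  wlog hab : b ≤ a generalizing a b
  · rw [dist_comm, dist_comm a]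
    exact this b a (not_le.1 hab).le
  obtain ⟨hlo, hhi⟩ := softThreshold_sub_mem_Icc hε hab
  rwa [Real.dist_eq, Real.dist_eq, abs_of_nonneg hlo, abs_of_nonneg (sub_nonneg.2 hab)]

/-- Away from its zeros, an affine function is only shifted by soft thresholding. -/
lemma exists_softThreshold_affineMap_sub {E : Type*} [NormedAddCommGroup E] [NormedSpace ℝ E]
    [FiniteDimensional ℝ E] {p : E →ᵃ[ℝ] ℝ} {x : E} (hx : p.linear ≠ 0 → p x ≠ 0) :
    ∃ c > 0, ∀ᶠ a in 𝓝 x, ∀ ε ∈ Icc 0 c,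
      softThreshold ε (p a) - softThreshold ε (p x) = p.linear (a - x) := by
  have hcont : ContinuousAt p x := p.continuous_of_finiteDimensional.continuousAt
  have hlin : ∀ a, p.linear (a - x) = p a - p x := fun a => p.linearMap_vsub a x
  simp only [hlin]
  rcases lt_trichotomy (p x) 0 with hneg | hzero | hpos
  · refine ⟨-(p x / 2), by linarith, ?_⟩
    filter_upwards [hcont.eventually_lt_const (u := p x / 2) (by linarith)] with a ha ε hε
    rw [softThreshold_of_le_neg hε.1 (by linarith [hε.2]),
      softThreshold_of_le_neg hε.1 (by linarith [hε.2])]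
    ring
  · have hconst : ∀ a, p a = p x := fun a => by
      have := hlin a
      rwa [not_not.1 fun hne => hx hne hzero, LinearMap.zero_apply, eq_comm, sub_eq_zero] at this
    exact ⟨1, one_pos, Eventually.of_forall fun a ε _ => by simp [hconst a]⟩
  · refine ⟨p x / 2, by linarith, ?_⟩
    filter_upwards [hcont.eventually_const_lt (u := p x / 2) (by linarith)] with a ha ε hε
    rw [softThreshold_of_le hε.1 (by linarith [hε.2]),
      softThreshold_of_le hε.1 (by linarith [hε.2])]
    ring

end SoftThreshold
/-! ### Approximation of finite element functions by test functions -/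

lemma norm_gradient_eq_norm_fderiv {F : Type*} [NormedAddCommGroup F] [InnerProductSpace ℝ F]
    [CompleteSpace F] (f : F → ℝ) (x : F) : ‖gradient f x‖ = ‖fderiv ℝ f x‖ := by
  rw [gradient, LinearIsometryEquiv.norm_map]

/-- The smooth function obtained from `v` by soft thresholding at `ε` followed by mollification
with `φ`. -/
noncomputable def smoothTruncation {d : ℕ} (φ : ContDiffBump (0 : Euc d)) (ε : ℝ)
    (v : Euc d → ℝ) : Euc d → ℝ :=
  mollify φ univ fun x => softThreshold ε (v x)

section SmoothTruncation

variable {d : ℕ} {φ : ContDiffBump (0 : Euc d)} {ε : ℝ} {v : Euc d → ℝ} {K : NNReal}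
  {Ω : Set (Euc d)} {x : Euc d}

lemma lipschitzWith_softThreshold_comp (hε : 0 ≤ ε) (hv : LipschitzWith K v) :
    LipschitzWith K fun x => softThreshold ε (v x) := by
  simpa [Function.comp_def] using (lipschitzWith_softThreshold hε).comp hv

lemma lipschitzWith_smoothTruncation (hε : 0 ≤ ε) (hv : LipschitzWith K v) :
    LipschitzWith K (smoothTruncation φ ε v) :=
  lipschitzWith_mollify_univ (lipschitzWith_softThreshold_comp hε hv)

lemma abs_smoothTruncation_sub_le (hε : 0 ≤ ε) (hv : LipschitzWith K v) (x : Euc d) :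
    |smoothTruncation φ ε v x - v x| ≤ K * φ.rOut + ε :=
  (abs_sub_le _ (softThreshold ε (v x)) _).trans <| add_le_add
    (abs_mollify_univ_sub_le (lipschitzWith_softThreshold_comp hε hv) x)
    (abs_softThreshold_sub_le hε _)

lemma support_smoothTruncation_subset (hv : LipschitzWith K v) :
    Function.support (smoothTruncation φ ε v) ⊆ {x | ε - K * φ.rOut ≤ |v x|} := by
  refine Function.support_subset_iff'.2 fun x hx => ?_
  refine mollify_univ_eq_zero fun y hy => softThreshold_of_abs_le ?_
  have hdist : |v y - v x| ≤ K * φ.rOut := by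
    rw [← Real.dist_eq]
    exact (hv.dist_le_mul y x).trans (mul_le_mul_of_nonneg_left (Metric.mem_ball.1 hy).le K.2)
  have hx : |v x| < ε - K * φ.rOut := not_le.1 hx
  linarith [abs_sub_abs_le_abs_sub (v y) (v x)]

lemma smoothTruncation_mem_testFunctions (hΩ : Bornology.IsBounded Ω) (hε : 0 ≤ ε)
    (hv : LipschitzWith K v) (hv0 : ∀ x ∉ Ω, v x = 0) (hφ : K * φ.rOut < ε) :
    smoothTruncation φ ε v ∈ testFunctions Ω := by
  have hclosed : IsClosed {x | ε - K * φ.rOut ≤ |v x|} :=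
    isClosed_le continuous_const hv.continuous.abs
  have hsub : {x | ε - K * φ.rOut ≤ |v x|} ⊆ Ω := fun x hx => by
    by_contra hxΩ
    rw [mem_ofPred_eq, hv0 x hxΩ, abs_zero] at hx
    linarith
  have htsupport : tsupport (smoothTruncation φ ε v) ⊆ Ω :=
    (closure_minimal (support_smoothTruncation_subset hv) hclosed).trans hsub
  exact ⟨contDiff_mollify_univ (lipschitzWith_softThreshold_comp hε hv).continuous,
    Metric.isCompact_of_isClosed_isBounded (isClosed_tsupport _) (hΩ.subset htsupport),
    htsupport⟩

lemma eventually_gradient_smoothTruncation_eq {φ : ℕ → ContDiffBump (0 : Euc d)} {ε : ℕ → ℝ}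
    (hv : LipschitzWith K v) (hφ : Tendsto (fun k => (φ k).rOut) atTop (𝓝 0))
    (hε : ∀ k, 0 ≤ ε k) (hε0 : Tendsto ε atTop (𝓝 0)) {c : ℝ} (hc : 0 < c) {ℓ : Euc d →L[ℝ] ℝ}
    (h : ∀ᶠ a in 𝓝 x, ∀ δ ∈ Icc 0 c,
      softThreshold δ (v a) - softThreshold δ (v x) = ℓ (a - x)) :
    ∀ᶠ k in atTop,
      gradient (smoothTruncation (φ k) (ε k) v) x = (InnerProductSpace.toDual ℝ _).symm ℓ := by
  obtain ⟨r, hr, hball⟩ := Metric.eventually_nhds_iff_ball.1 h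
  filter_upwards [hφ.eventually_lt_const hr, hε0.eventually_lt_const hc] with k hkr hkc
  have hfderiv : HasFDerivAt (smoothTruncation (φ k) (ε k) v) ℓ x :=
    hasFDerivAt_mollify_univ_of_affine (lipschitzWith_softThreshold_comp (hε k) hv).continuous hkr
      fun a ha => hball a ha (ε k) ⟨hε k, hkc.le⟩
  rw [gradient, hfderiv.fderiv]

end SmoothTruncation

namespace SimplicialMesh

variable {d : ℕ} {Ω : Set (Euc d)} {T : SimplicialMesh Ω} {v : Euc d → ℝ}

lemma indicator_eq_on_closure (hΩ : IsOpen Ω) (hv : v ∈ T.feSpaceZero) :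
    EqOn (Ω.indicator v) v (closure Ω) := fun x hx => by
  by_cases hxΩ : x ∈ Ω
  · exact indicator_of_mem hxΩ v
  · rw [indicator_of_notMem hxΩ, hv.2 x ⟨hx, by rwa [hΩ.interior_eq]⟩]

lemma exists_lipschitzWith_indicator (hΩ : IsOpen Ω) (hv : v ∈ T.feSpaceZero) :
    ∃ K : NNReal, LipschitzWith K (Ω.indicator v) := by
  choose! p hp using hv.1
  let L : Finset (Euc d) → NNReal := fun s => ‖(p s).linear.toContinuousLinearMap‖₊
  have hcell : ∀ s ∈ T.elems, LipschitzOnWith (∑ t ∈ T.elems, L t) (Ω.indicator v) (cell s) := by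
    intro s hs
    have heq : EqOn (Ω.indicator v) (p s) (cell s) := fun x hx =>
      (indicator_eq_on_closure hΩ hv (T.cell_subset_closure hs hx)).trans (hp s hs hx)
    have hLs : L s ≤ ∑ t ∈ T.elems, L t := Finset.single_le_sum (f := L) (fun _ _ => zero_le) hs
    refine LipschitzOnWith.of_dist_le_mul fun x hx y hy => ?_
    rw [heq hx, heq hy, dist_eq_norm, dist_eq_norm, ← vsub_eq_sub, ← (p s).linearMap_vsub]
    exact ((p s).linear.toContinuousLinearMap.le_opNorm (x - y)).trans (by gcongr; exact hLs)
  let C : Option T.elems → Set (Euc d) := fun o => o.elim Ωᶜ fun s => cell s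
  refine ⟨∑ t ∈ T.elems, L t,
    lipschitzWith_of_finite_closed_cover (C := C) Finset.univ ?_ ?_ ?_⟩
  · rintro (_ | s) -
    · exact hΩ.isClosed_compl
    · exact (isCompact_cell _).isClosed
  · rintro (_ | s) -
    · refine LipschitzOnWith.of_dist_le_mul fun x hx y hy => ?_
      rw [indicator_of_notMem hx, indicator_of_notMem hy, dist_self]
      positivity
    · exact hcell s s.2
  · refine eq_univ_of_forall fun x => ?_
    by_cases hx : x ∈ Ω
    · obtain ⟨s, hs, hxs⟩ := T.exists_mem_cell (subset_closure hx)
      exact mem_biUnion (Finset.mem_univ (some (⟨s, hs⟩ : T.elems))) hxs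
    · exact mem_biUnion (Finset.mem_univ (none : Option T.elems)) hx

lemma hasFDerivAt_of_eqOn_cell {p : Euc d →ᵃ[ℝ] ℝ} {s : Finset (Euc d)}
    (hp : EqOn v p (cell s)) {x : Euc d} (hx : x ∈ interior (cell s)) :
    HasFDerivAt v p.linear.toContinuousLinearMap x := by
  have heq : v =ᶠ[𝓝 x] fun y => p.linear.toContinuousLinearMap y + p 0 := by
    filter_upwards [mem_interior_iff_mem_nhds.1 hx] with y hy
    rw [hp hy, p.decomp]
    simp
  exact (p.linear.toContinuousLinearMap.hasFDerivAt.add_const _).congr_of_eventuallyEq heq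

lemma ae_softThreshold_indicator_sub (hΩ : interior (closure Ω) = Ω) (hv : v ∈ T.feSpace) :
    ∀ᵐ x ∂volume.restrict Ω, ∃ c > 0, ∀ᶠ a in 𝓝 x, ∀ ε ∈ Icc 0 c,
      softThreshold ε (Ω.indicator v a) - softThreshold ε (Ω.indicator v x) =
        fderiv ℝ v x (a - x) := by
  choose! p hp using hv
  have hzeros : ∀ᵐ x, ∀ s ∈ T.elems, (p s).linear ≠ 0 → p s x ≠ 0 := by
    refine (ae_ball_iff T.elems.countable_toSet).2 fun s _ => ?_
    by_cases hlin : (p s).linear = 0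
    · simp [hlin]
    · have hne : p s ≠ 0 := fun h => hlin (by rw [h, AffineMap.zero_linear])
      filter_upwards [measure_eq_zero_iff_ae_notMem.1 (addHaar_zeros_affineMap volume hne)]
        with x hx _ using hx
  have hint := T.ae_mem_interior_cell
  rw [T.restrict_closure hΩ] at hint
  filter_upwards [ae_restrict_of_ae hzeros, hint] with x hx ⟨s, hs, hxs⟩
  obtain ⟨c, hc, hthreshold⟩ := exists_softThreshold_affineMap_sub (hx s hs)
  have heq : ∀ a ∈ interior (cell s), Ω.indicator v a = p s a := fun a ha => by
    rw [indicator_of_mem (T.interior_cell_subset hΩ hs ha), hp s hs (interior_subset ha)]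
  refine ⟨c, hc, ?_⟩
  filter_upwards [hthreshold, isOpen_interior.mem_nhds hxs] with a ha has ε hε
  rw [heq a has, heq x hxs, ha ε hε, (hasFDerivAt_of_eqOn_cell (hp s hs) hxs).fderiv]
  rfl

lemma exists_testFunctions_tendsto (hΩ : interior (closure Ω) = Ω) (hv : v ∈ T.feSpaceZero) :
    ∃ (ψ : ℕ → Euc d → ℝ) (B : ℝ), (∀ k, ψ k ∈ testFunctions Ω) ∧ (∀ k x, |ψ k x| ≤ B) ∧
      (∀ k x, ‖gradient (ψ k) x‖ ≤ B) ∧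
      ∀ᵐ x ∂volume.restrict Ω, Tendsto (fun k => ψ k x) atTop (𝓝 (v x)) ∧
        Tendsto (fun k => gradient (ψ k) x) atTop (𝓝 (gradient v x)) := by
  have hΩo : IsOpen Ω := hΩ ▸ isOpen_interior
  have hΩb : Bornology.IsBounded Ω := T.isCompact_closure.isBounded.subset subset_closure
  obtain ⟨K, hK⟩ := T.exists_lipschitzWith_indicator hΩo hv
  obtain ⟨B, hB⟩ := (HasCompactSupport.of_support_subset_isCompact T.isCompact_closure
    (support_indicator_subset.trans subset_closure)).exists_bound_of_continuous hK.continuous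
  set φ : ℕ → ContDiffBump (0 : Euc d) := shrinkingBump d
  have hr : Tendsto (fun k => (φ k).rOut) atTop (𝓝 0) := tendsto_shrinkingBump_rOut
  have hr1 : ∀ k, (φ k).rOut ≤ 1 := fun k => by
    simpa [φ, shrinkingBump] using inv_le_one_of_one_le₀ (by simp : (1 : ℝ) ≤ k + 1)
  set ε : ℕ → ℝ := fun k => (K + 1) * (φ k).rOut
  have hε : ∀ k, 0 ≤ ε k := fun k => mul_nonneg (by positivity) (φ k).rOut_pos.le
  have hε0 : Tendsto ε atTop (𝓝 0) := by simpa using hr.const_mul ((K : ℝ) + 1)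
  set ψ : ℕ → Euc d → ℝ := fun k => smoothTruncation (φ k) (ε k) (Ω.indicator v)
  have herr : ∀ k x, |ψ k x - Ω.indicator v x| ≤ (2 * K + 1) * (φ k).rOut := fun k x =>
    (abs_smoothTruncation_sub_le (hε k) hK x).trans_eq (by ring)
  refine ⟨ψ, max (B + (2 * K + 1)) K, fun k => ?_, fun k x => le_max_of_le_left ?_,
    fun k x => le_max_of_le_right ?_, ?_⟩
  · exact smoothTruncation_mem_testFunctions hΩb (hε k) hK
      (fun x hx => indicator_of_notMem hx v) (by linarith [(φ k).rOut_pos])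
  · have hle : |Ω.indicator v x| ≤ B := hB x
    have := mul_le_of_le_one_right (by positivity : (0 : ℝ) ≤ 2 * K + 1) (hr1 k)
    linarith [herr k x, abs_sub_abs_le_abs_sub (ψ k x) (Ω.indicator v x)]
  · rw [norm_gradient_eq_norm_fderiv]
    exact norm_fderiv_le_of_lipschitz ℝ (lipschitzWith_smoothTruncation (hε k) hK)
  · filter_upwards [ae_restrict_mem hΩo.measurableSet, T.ae_softThreshold_indicator_sub hΩ hv.1]
      with x hxΩ ⟨c, hc, hthreshold⟩
    refine ⟨?_, tendsto_const_nhds.congr' ?_⟩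
    · rw [← indicator_of_mem hxΩ v, tendsto_iff_dist_tendsto_zero]
      exact squeeze_zero (fun k => dist_nonneg) (fun k => herr k x)
        (by simpa using hr.const_mul (2 * (K : ℝ) + 1))
    · filter_upwards [eventually_gradient_smoothTruncation_eq hK hr hε hε0 hc hthreshold]
        with k hk using hk.symm

end SimplicialMesh
/-! ### Regularity of finite element functions -/

section Gradient

variable {F : Type*} [NormedAddCommGroup F] [InnerProductSpace ℝ F] [CompleteSpace F]

lemma aestronglyMeasurable_gradient [MeasurableSpace F] [BorelSpace F]
    [SecondCountableTopology F] (f : F → ℝ) (μ : Measure F) :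
    AEStronglyMeasurable (gradient f) μ :=
  ((InnerProductSpace.toDual ℝ F).symm.continuous.measurable.comp
    (measurable_fderiv ℝ f)).aestronglyMeasurable

lemma gradient_sub {f g : F → ℝ} {x : F} (hf : DifferentiableAt ℝ f x)
    (hg : DifferentiableAt ℝ g x) : gradient (f - g) x = gradient f x - gradient g x := by
  rw [gradient, fderiv_sub hf hg, map_sub, gradient, gradient]

end Gradient

namespace SimplicialMesh

variable {d : ℕ} {Ω : Set (Euc d)} {T : SimplicialMesh Ω} {v w : Euc d → ℝ}

lemma isFiniteMeasure_restrict (T : SimplicialMesh Ω) : IsFiniteMeasure (volume.restrict Ω) :=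
  MeasureTheory.isFiniteMeasure_restrict.2
    ((measure_mono subset_closure).trans_lt T.isCompact_closure.measure_lt_top).ne

lemma sub_mem_feSpace (hv : v ∈ T.feSpace) (hw : w ∈ T.feSpace) : v - w ∈ T.feSpace := by
  intro s hs
  obtain ⟨p, hp⟩ := hv s hs
  obtain ⟨q, hq⟩ := hw s hs
  exact ⟨p - q, fun x hx => by simp [hp hx, hq hx]⟩

lemma continuousOn_of_mem_feSpace (hv : v ∈ T.feSpace) : ContinuousOn v (closure Ω) := by
  rw [T.cover, ← iUnion_subtype (· ∈ T.elems) fun s => cell s.1]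
  refine (locallyFinite_of_finite _).continuousOn_iUnion
    (fun s => (isCompact_cell _).isClosed) fun s => ?_
  obtain ⟨p, hp⟩ := hv s s.2
  exact p.continuous_of_finiteDimensional.continuousOn.congr hp

lemma aestronglyMeasurable_of_mem_feSpace (hΩ : IsOpen Ω) (hv : v ∈ T.feSpace) :
    AEStronglyMeasurable v (volume.restrict Ω) :=
  ((continuousOn_of_mem_feSpace hv).mono subset_closure).aestronglyMeasurable hΩ.measurableSet

lemma ae_differentiableAt_of_mem_feSpace (hΩ : interior (closure Ω) = Ω) (hv : v ∈ T.feSpace) :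
    ∀ᵐ x ∂volume.restrict Ω, DifferentiableAt ℝ v x := by
  have hint := T.ae_mem_interior_cell
  rw [T.restrict_closure hΩ] at hint
  filter_upwards [hint] with x ⟨s, hs, hxs⟩
  obtain ⟨p, hp⟩ := hv s hs
  exact (hasFDerivAt_of_eqOn_cell hp hxs).differentiableAt

lemma ae_gradient_sub (hΩ : interior (closure Ω) = Ω) (hv : v ∈ T.feSpace) (hw : w ∈ T.feSpace) :
    ∀ᵐ x ∂volume.restrict Ω, gradient (v - w) x = gradient v x - gradient w x := by
  filter_upwards [ae_differentiableAt_of_mem_feSpace hΩ hv,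
    ae_differentiableAt_of_mem_feSpace hΩ hw] with x hvx hwx using gradient_sub hvx hwx

lemma exists_ae_bound_of_mem_feSpace (hΩ : interior (closure Ω) = Ω) (hv : v ∈ T.feSpace) :
    ∃ B, ∀ᵐ x ∂volume.restrict Ω, |v x| ≤ B ∧ ‖gradient v x‖ ≤ B := by
  have hΩo : IsOpen Ω := hΩ ▸ isOpen_interior
  obtain ⟨B, hB⟩ :=
    T.isCompact_closure.exists_bound_of_continuousOn (continuousOn_of_mem_feSpace hv)
  choose! p hp using hv
  let L : Finset (Euc d) → ℝ := fun s => ‖(p s).linear.toContinuousLinearMap‖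
  refine ⟨max B (∑ s ∈ T.elems, L s), ?_⟩
  have hint := T.ae_mem_interior_cell
  rw [T.restrict_closure hΩ] at hint
  filter_upwards [hint, ae_restrict_mem hΩo.measurableSet] with x ⟨s, hs, hxs⟩ hxΩ
  refine ⟨le_max_of_le_left (hB x (subset_closure hxΩ)), le_max_of_le_right ?_⟩
  rw [norm_gradient_eq_norm_fderiv, (hasFDerivAt_of_eqOn_cell (hp s hs) hxs).fderiv]
  exact Finset.single_le_sum (f := L) (fun _ _ => norm_nonneg _) hs

lemma integrableOn_of_mem_feSpace (hΩ : interior (closure Ω) = Ω) (hv : v ∈ T.feSpace) :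
    IntegrableOn v Ω := by
  have := T.isFiniteMeasure_restrict
  obtain ⟨B, hB⟩ := exists_ae_bound_of_mem_feSpace hΩ hv
  exact Integrable.of_bound (aestronglyMeasurable_of_mem_feSpace (hΩ ▸ isOpen_interior) hv) B
    (hB.mono fun x hx => hx.1)

lemma integrableOn_gradient_of_mem_feSpace (hΩ : interior (closure Ω) = Ω)
    (hv : v ∈ T.feSpace) : IntegrableOn (gradient v) Ω := by
  have := T.isFiniteMeasure_restrict
  obtain ⟨B, hB⟩ := exists_ae_bound_of_mem_feSpace hΩ hv
  exact Integrable.of_bound (aestronglyMeasurable_gradient _ _) B (hB.mono fun x hx => hx.2)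

lemma integrableOn_sq_add_norm_gradient_sq (hΩ : interior (closure Ω) = Ω)
    (hv : v ∈ T.feSpace) : IntegrableOn (fun x => v x ^ 2 + ‖gradient v x‖ ^ 2) Ω := by
  have := T.isFiniteMeasure_restrict
  obtain ⟨B, hB⟩ := exists_ae_bound_of_mem_feSpace hΩ hv
  have hmeas := aestronglyMeasurable_of_mem_feSpace (hΩ ▸ isOpen_interior) hv
  refine Integrable.of_bound
    ((hmeas.pow 2).add ((aestronglyMeasurable_gradient v _).norm.pow 2)) (B ^ 2 + B ^ 2) ?_
  filter_upwards [hB] with x ⟨hvx, hgx⟩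
  rw [Real.norm_of_nonneg (by positivity), ← sq_abs (v x)]
  gcongr

end SimplicialMesh

/-! ### The bilinear form -/

lemma exists_ae_norm_le_of_memLp_top {α E : Type*} [MeasurableSpace α] [NormedAddCommGroup E]
    {μ : Measure α} {f : α → E} (hf : MemLp f ⊤ μ) : ∃ C : ℝ, ∀ᵐ x ∂μ, ‖f x‖ ≤ C := by
  refine ⟨(eLpNorm f ⊤ μ).toReal, ?_⟩
  filter_upwards [ae_le_eLpNormEssSup (f := f) (μ := μ)] with x hx
  rw [← toReal_enorm]
  exact ENNReal.toReal_mono hf.2.ne (eLpNorm_exponent_top (f := f) ▸ hx)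

namespace SecondOrderOperator

variable {d : ℕ} {L : SecondOrderOperator d} {Ω : Set (Euc d)}

/-- The coefficients of `L` belong to `L^∞(Ω)`. -/
structure HasBoundedCoeffs (L : SecondOrderOperator d) (Ω : Set (Euc d)) : Prop where
  memLp_A : MemLp L.A ⊤ (volume.restrict Ω)
  memLp_b : MemLp L.b ⊤ (volume.restrict Ω)
  memLp_c : MemLp L.c ⊤ (volume.restrict Ω)

/-- The bilinear form of `L` is coercive on `H¹₀(Ω)` with constant `α`; as in `IsElliptic`, this is
required on the dense subspace of test functions only. -/
def IsCoercive (L : SecondOrderOperator d) (Ω : Set (Euc d)) (α : ℝ) : Prop :=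
  ∀ φ ∈ testFunctions Ω,
    α * ∫ x in Ω, (φ x ^ 2 + ‖gradient φ x‖ ^ 2) ≤ L.form Ω φ (gradient φ) φ

lemma HasBoundedCoeffs.exists_bound (hL : L.HasBoundedCoeffs Ω) :
    ∃ κ, 0 ≤ κ ∧ ∀ᵐ x ∂volume.restrict Ω, ‖L.A x‖ ≤ κ ∧ ‖L.b x‖ ≤ κ ∧ ‖L.c x‖ ≤ κ := by
  obtain ⟨a, ha⟩ := exists_ae_norm_le_of_memLp_top hL.memLp_A
  obtain ⟨b, hb⟩ := exists_ae_norm_le_of_memLp_top hL.memLp_b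
  obtain ⟨c, hc⟩ := exists_ae_norm_le_of_memLp_top hL.memLp_c
  refine ⟨max 0 (max a (max b c)), le_max_left _ _, ?_⟩
  filter_upwards [ha, hb, hc] with x hax hbx hcx
  simp only [le_max_iff, hax, hbx, hcx, true_or, or_true, and_self]

/-- The integrand of the bilinear form at `x`, for the values `v`, `w` and the gradients `Dv`, `Dw`
of its two arguments. -/
noncomputable def density (L : SecondOrderOperator d) (v : ℝ) (Dv : Euc d) (w : ℝ)
    (Dw x : Euc d) : ℝ :=
  inner ℝ (L.A x Dv) Dw + inner ℝ (L.b x) Dv * w + L.c x * v * w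

lemma form_eq_integral_density (v : Euc d → ℝ) (Dv : Euc d → Euc d) (w : Euc d → ℝ) :
    L.form Ω v Dv w = ∫ x in Ω, L.density (v x) (Dv x) (w x) (gradient w x) x :=
  rfl

lemma density_sub (v v' : ℝ) (Dv Dv' : Euc d) (w : ℝ) (Dw x : Euc d) :
    L.density (v - v') (Dv - Dv') w Dw x = L.density v Dv w Dw x - L.density v' Dv' w Dw x := by
  simp only [density, map_sub, inner_sub_left, inner_sub_right]
  ring

section Bound

variable {κ : ℝ} {x : Euc d}

lemma abs_density_le (hA : ‖L.A x‖ ≤ κ) (hb : ‖L.b x‖ ≤ κ) (hc : ‖L.c x‖ ≤ κ)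
    (v : ℝ) (Dv : Euc d) (w : ℝ) (Dw : Euc d) :
    |L.density v Dv w Dw x| ≤ κ * (‖Dv‖ * ‖Dw‖ + ‖Dv‖ * |w| + |v| * |w|) := by
  have hdiffusion : |inner ℝ (L.A x Dv) Dw| ≤ κ * ‖Dv‖ * ‖Dw‖ :=
    (abs_real_inner_le_norm _ _).trans (by gcongr; exact (L.A x).le_of_opNorm_le hA Dv)
  have hconvection : |inner ℝ (L.b x) Dv * w| ≤ κ * ‖Dv‖ * |w| := by
    rw [abs_mul]
    gcongr
    exact (abs_real_inner_le_norm _ _).trans (by gcongr)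
  have hreaction : |L.c x * v * w| ≤ κ * |v| * |w| := by
    rw [abs_mul, abs_mul]
    gcongr
    exact hc
  calc |L.density v Dv w Dw x|
      ≤ |inner ℝ (L.A x Dv) Dw| + |inner ℝ (L.b x) Dv * w| + |L.c x * v * w| := abs_add_three ..
    _ ≤ κ * ‖Dv‖ * ‖Dw‖ + κ * ‖Dv‖ * |w| + κ * |v| * |w| := by gcongr
    _ = κ * (‖Dv‖ * ‖Dw‖ + ‖Dv‖ * |w| + |v| * |w|) := by ring

lemma abs_density_le_of_young (hA : ‖L.A x‖ ≤ κ) (hb : ‖L.b x‖ ≤ κ) (hc : ‖L.c x‖ ≤ κ) {α : ℝ}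
    (hα : 0 < α) (v : ℝ) (Dv : Euc d) (w : ℝ) (Dw : Euc d) :
    |L.density v Dv w Dw x| ≤
      α / 2 * (w ^ 2 + ‖Dw‖ ^ 2) + κ ^ 2 / α * (2 * ‖Dv‖ ^ 2 + v ^ 2) := by
  have young : ∀ r q : ℝ, κ * (r * q) ≤ α / 4 * q ^ 2 + κ ^ 2 / α * r ^ 2 := fun r q => by
    have hsq : α / 4 * q ^ 2 + κ ^ 2 / α * r ^ 2 - κ * (r * q) =
        (α * q - 2 * κ * r) ^ 2 / (4 * α) := by
      field_simp
      ring
    have : 0 ≤ (α * q - 2 * κ * r) ^ 2 / (4 * α) := by positivity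
    linarith
  have hDw : 0 ≤ α / 4 * ‖Dw‖ ^ 2 := by positivity
  rw [← sq_abs v, ← sq_abs w]
  linarith [abs_density_le hA hb hc v Dv w Dw, young ‖Dv‖ ‖Dw‖, young ‖Dv‖ |w|, young |v| |w|]

end Bound

namespace HasBoundedCoeffs

lemma aestronglyMeasurable_density (hL : L.HasBoundedCoeffs Ω)
    {v w : Euc d → ℝ} {Dv Dw : Euc d → Euc d}
    (hv : AEStronglyMeasurable v (volume.restrict Ω))
    (hDv : AEStronglyMeasurable Dv (volume.restrict Ω))
    (hw : AEStronglyMeasurable w (volume.restrict Ω))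
    (hDw : AEStronglyMeasurable Dw (volume.restrict Ω)) :
    AEStronglyMeasurable (fun x => L.density (v x) (Dv x) (w x) (Dw x) x)
      (volume.restrict Ω) := by
  have hADv : AEStronglyMeasurable (fun x => L.A x (Dv x)) (volume.restrict Ω) :=
    (ContinuousLinearMap.id ℝ (Euc d →L[ℝ] Euc d)).aestronglyMeasurable_comp₂ hL.memLp_A.1 hDv
  exact ((hADv.inner hDw).add ((hL.memLp_b.1.inner hDv).mul hw)).add
    ((hL.memLp_c.1.mul hv).mul hw)

lemma integrableOn_density (hL : L.HasBoundedCoeffs Ω) {v w : Euc d → ℝ} {Dv Dw : Euc d → Euc d}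
    (hv : IntegrableOn v Ω) (hDv : IntegrableOn Dv Ω)
    (hw : AEStronglyMeasurable w (volume.restrict Ω))
    (hDw : AEStronglyMeasurable Dw (volume.restrict Ω)) {B : ℝ}
    (hB : ∀ᵐ x ∂volume.restrict Ω, |w x| ≤ B ∧ ‖Dw x‖ ≤ B) :
    IntegrableOn (fun x => L.density (v x) (Dv x) (w x) (Dw x) x) Ω := by
  obtain ⟨κ, hκ0, hκ⟩ := hL.exists_bound
  have hdom : IntegrableOn (fun x => κ * (‖Dv x‖ * B + ‖Dv x‖ * B + |v x| * B)) Ω :=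
    (((hDv.norm.mul_const B).add (hDv.norm.mul_const B)).add (hv.abs.mul_const B)).const_mul κ
  refine hdom.mono' (hL.aestronglyMeasurable_density hv.1 hDv.1 hw hDw) ?_
  filter_upwards [hκ, hB] with x ⟨hA, hb, hc⟩ ⟨hwB, hDwB⟩
  exact (abs_density_le hA hb hc _ _ _ _).trans (by gcongr)

lemma tendsto_integral_density (hL : L.HasBoundedCoeffs Ω)
    {v w : ℕ → Euc d → ℝ} {Dv Dw : ℕ → Euc d → Euc d} {v' w' V DV : Euc d → ℝ}
    {Dv' Dw' : Euc d → Euc d} {B : ℝ}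
    (hv : ∀ k, AEStronglyMeasurable (v k) (volume.restrict Ω))
    (hDv : ∀ k, AEStronglyMeasurable (Dv k) (volume.restrict Ω))
    (hw : ∀ k, AEStronglyMeasurable (w k) (volume.restrict Ω))
    (hDw : ∀ k, AEStronglyMeasurable (Dw k) (volume.restrict Ω))
    (hV : IntegrableOn V Ω) (hDV : IntegrableOn DV Ω)
    (hvV : ∀ k, ∀ᵐ x ∂volume.restrict Ω, |v k x| ≤ V x ∧ ‖Dv k x‖ ≤ DV x)
    (hwB : ∀ k x, |w k x| ≤ B) (hDwB : ∀ k x, ‖Dw k x‖ ≤ B)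
    (hlim_v : ∀ᵐ x ∂volume.restrict Ω, Tendsto (fun k => v k x) atTop (𝓝 (v' x)) ∧
      Tendsto (fun k => Dv k x) atTop (𝓝 (Dv' x)))
    (hlim_w : ∀ᵐ x ∂volume.restrict Ω, Tendsto (fun k => w k x) atTop (𝓝 (w' x)) ∧
      Tendsto (fun k => Dw k x) atTop (𝓝 (Dw' x))) :
    Tendsto (fun k => ∫ x in Ω, L.density (v k x) (Dv k x) (w k x) (Dw k x) x) atTop
      (𝓝 (∫ x in Ω, L.density (v' x) (Dv' x) (w' x) (Dw' x) x)) := by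
  obtain ⟨κ, hκ0, hκ⟩ := hL.exists_bound
  refine tendsto_integral_of_dominated_convergence
    (fun x => κ * (DV x * B + DV x * B + V x * B))
    (fun k => hL.aestronglyMeasurable_density (hv k) (hDv k) (hw k) (hDw k)) ?_ (fun k => ?_) ?_
  · exact (((hDV.mul_const B).add (hDV.mul_const B)).add (hV.mul_const B)).const_mul κ
  · filter_upwards [hκ, hvV k] with x ⟨hA, hb, hc⟩ ⟨hvx, hDvx⟩
    have hVx : 0 ≤ V x := (abs_nonneg _).trans hvx
    have hDVx : 0 ≤ DV x := (norm_nonneg _).trans hDvx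
    exact (abs_density_le hA hb hc _ _ _ _).trans
      (by gcongr; exacts [hDwB k x, hwB k x, hwB k x])
  · filter_upwards [hlim_v, hlim_w] with x ⟨hvx, hDvx⟩ ⟨hwx, hDwx⟩
    exact (((((L.A x).continuous.tendsto _).comp hDvx).inner hDwx).add
      ((tendsto_const_nhds.inner hDvx).mul hwx)).add ((hvx.const_mul _).mul hwx)

end HasBoundedCoeffs

end SecondOrderOperator
/-! ### Quasi-optimality of the finite element solution -/

section QuasiOptimality

variable {d : ℕ} {Ω : Set (Euc d)} {L : SecondOrderOperator d} {T : SimplicialMesh Ω}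
  {f u : Euc d → ℝ} {Du : Euc d → Euc d} {e v w I uh E : Euc d → ℝ} {α κ D : ℝ}

lemma aestronglyMeasurable_of_mem_testFunctions {φ : Euc d → ℝ} (hφ : φ ∈ testFunctions Ω)
    (μ : Measure (Euc d)) : AEStronglyMeasurable φ μ :=
  hφ.1.continuous.aestronglyMeasurable

namespace SimplicialMesh

lemma form_eq_of_mem_feSpaceZero (hΩ : interior (closure Ω) = Ω) (hL : L.HasBoundedCoeffs Ω)
    (hf : IntegrableOn f Ω) (hu : IntegrableOn u Ω) (hDu : IntegrableOn Du Ω)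
    (hweak : ∀ φ ∈ testFunctions Ω, L.form Ω u Du φ = ∫ x in Ω, f x * φ x)
    (he : e ∈ T.feSpaceZero) : L.form Ω u Du e = ∫ x in Ω, f x * e x := by
  obtain ⟨ψ, B, hψ, hψB, hDψB, hlim⟩ := exists_testFunctions_tendsto hΩ he
  have hform : Tendsto (fun k => L.form Ω u Du (ψ k)) atTop (𝓝 (L.form Ω u Du e)) :=
    hL.tendsto_integral_density (fun _ => hu.1) (fun _ => hDu.1)
      (fun k => aestronglyMeasurable_of_mem_testFunctions (hψ k) _)
      (fun k => aestronglyMeasurable_gradient _ _) hu.abs hDu.norm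
      (fun _ => Eventually.of_forall fun x => ⟨le_rfl, le_rfl⟩) hψB hDψB
      (Eventually.of_forall fun x => ⟨tendsto_const_nhds, tendsto_const_nhds⟩) hlim
  have hload : Tendsto (fun k => ∫ x in Ω, f x * ψ k x) atTop (𝓝 (∫ x in Ω, f x * e x)) := by
    refine tendsto_integral_of_dominated_convergence (fun x => |f x| * B)
      (fun k => hf.1.mul (aestronglyMeasurable_of_mem_testFunctions (hψ k) _))
      (hf.abs.mul_const B) (fun k => Eventually.of_forall fun x => ?_) ?_
    · rw [norm_mul]
      exact mul_le_mul_of_nonneg_left (hψB k x) (norm_nonneg _)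
    · filter_upwards [hlim] with x hx using hx.1.const_mul _
  simp only [fun k => hweak (ψ k) (hψ k)] at hform
  exact tendsto_nhds_unique hform hload

lemma form_ge_of_mem_feSpaceZero (hΩ : interior (closure Ω) = Ω) (hL : L.HasBoundedCoeffs Ω)
    (hα : L.IsCoercive Ω α) (he : e ∈ T.feSpaceZero) :
    α * ∫ x in Ω, (e x ^ 2 + ‖gradient e x‖ ^ 2) ≤ L.form Ω e (gradient e) e := by
  have := T.isFiniteMeasure_restrict
  obtain ⟨ψ, B, hψ, hψB, hDψB, hlim⟩ := exists_testFunctions_tendsto hΩ he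
  have hψm := fun k => aestronglyMeasurable_of_mem_testFunctions (hψ k) (volume.restrict Ω)
  have hDψm := fun k => aestronglyMeasurable_gradient (ψ k) (volume.restrict Ω)
  have hform : Tendsto (fun k => L.form Ω (ψ k) (gradient (ψ k)) (ψ k)) atTop
      (𝓝 (L.form Ω e (gradient e) e)) :=
    hL.tendsto_integral_density hψm hDψm hψm hDψm (integrable_const B) (integrable_const B)
      (fun k => Eventually.of_forall fun x => ⟨hψB k x, hDψB k x⟩) hψB hDψB hlim hlim
  have hnorm : Tendsto (fun k => ∫ x in Ω, (ψ k x ^ 2 + ‖gradient (ψ k) x‖ ^ 2)) atTop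
      (𝓝 (∫ x in Ω, (e x ^ 2 + ‖gradient e x‖ ^ 2))) := by
    refine tendsto_integral_of_dominated_convergence (fun _ => B ^ 2 + B ^ 2)
      (fun k => ((hψm k).pow 2).add ((hDψm k).norm.pow 2)) (integrable_const _)
      (fun k => Eventually.of_forall fun x => ?_) ?_
    · rw [Real.norm_of_nonneg (by positivity), ← sq_abs (ψ k x)]
      gcongr
      exacts [hψB k x, hDψB k x]
    · filter_upwards [hlim] with x hx using (hx.1.pow 2).add (hx.2.norm.pow 2)
  exact le_of_tendsto_of_tendsto' (hnorm.const_mul α) hform fun k => hα _ (hψ k)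

lemma integrableOn_density (hΩ : interior (closure Ω) = Ω) (hL : L.HasBoundedCoeffs Ω)
    (hu : IntegrableOn u Ω) (hDu : IntegrableOn Du Ω) (hw : w ∈ T.feSpace) :
    IntegrableOn (fun x => L.density (u x) (Du x) (w x) (gradient w x) x) Ω := by
  obtain ⟨B, hB⟩ := exists_ae_bound_of_mem_feSpace hΩ hw
  exact hL.integrableOn_density hu hDu
    (aestronglyMeasurable_of_mem_feSpace (hΩ ▸ isOpen_interior) hw)
    (aestronglyMeasurable_gradient _ _) hB

lemma form_sub (hΩ : interior (closure Ω) = Ω) (hL : L.HasBoundedCoeffs Ω)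
    (hv : v ∈ T.feSpace) (hI : I ∈ T.feSpace) (hw : w ∈ T.feSpace) :
    L.form Ω (v - I) (gradient (v - I)) w =
      L.form Ω v (gradient v) w - L.form Ω I (gradient I) w := by
  simp only [SecondOrderOperator.form_eq_integral_density]
  rw [← integral_sub
    (integrableOn_density hΩ hL (integrableOn_of_mem_feSpace hΩ hv)
      (integrableOn_gradient_of_mem_feSpace hΩ hv) hw)
    (integrableOn_density hΩ hL (integrableOn_of_mem_feSpace hΩ hI)
      (integrableOn_gradient_of_mem_feSpace hΩ hI) hw)]
  refine integral_congr_ae ?_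
  filter_upwards [ae_gradient_sub hΩ hv hI] with x hx
  rw [hx, Pi.sub_apply, L.density_sub]

/-- The test function `uh - I` is absorbed with Young's inequality. -/
lemma integral_sq_add_norm_gradient_sq_le_of_galerkin (hΩ : interior (closure Ω) = Ω)
    (hL : L.HasBoundedCoeffs Ω)
    (hκ : ∀ᵐ x ∂volume.restrict Ω, ‖L.A x‖ ≤ κ ∧ ‖L.b x‖ ≤ κ ∧ ‖L.c x‖ ≤ κ)
    (hα0 : 0 < α) (hα : L.IsCoercive Ω α) (hu : IntegrableOn u Ω) (hDu : IntegrableOn Du Ω)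
    (huh : uh ∈ T.feSpace) (hI : I ∈ T.feSpace) (he : uh - I ∈ T.feSpaceZero)
    (hortho : L.form Ω uh (gradient uh) (uh - I) = L.form Ω u Du (uh - I))
    (hE : IntegrableOn E Ω)
    (herr : ∀ᵐ x ∂volume.restrict Ω, ‖Du x - gradient I x‖ ^ 2 ≤ E x ∧
      (u x - I x) ^ 2 ≤ D ^ 2 * E x) :
    ∫ x in Ω, ((uh - I) x ^ 2 + ‖gradient (uh - I) x‖ ^ 2) ≤
      2 * (κ ^ 2 / α * (2 + D ^ 2)) / α * ∫ x in Ω, E x := by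
  set e := uh - I
  have hform : L.form Ω e (gradient e) e =
      ∫ x in Ω, L.density (u x - I x) (Du x - gradient I x) (e x) (gradient e x) x := by
    simp only [L.density_sub]
    rw [form_sub hΩ hL huh hI he.1, hortho]
    exact (integral_sub (integrableOn_density hΩ hL hu hDu he.1)
      (integrableOn_density hΩ hL (integrableOn_of_mem_feSpace hΩ hI)
        (integrableOn_gradient_of_mem_feSpace hΩ hI) he.1)).symm
  have hyoung : L.form Ω e (gradient e) e ≤
      ∫ x in Ω, (α / 2 * (e x ^ 2 + ‖gradient e x‖ ^ 2) + κ ^ 2 / α * (2 + D ^ 2) * E x) := by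
    rw [hform]
    refine integral_mono_ae
      (integrableOn_density hΩ hL (u := fun x => u x - I x) (Du := fun x => Du x - gradient I x)
        (hu.sub (integrableOn_of_mem_feSpace hΩ hI))
        (hDu.sub (integrableOn_gradient_of_mem_feSpace hΩ hI)) he.1)
      (((integrableOn_sq_add_norm_gradient_sq hΩ he.1).const_mul _).add (hE.const_mul _)) ?_
    filter_upwards [hκ, herr] with x ⟨hA, hb, hc⟩ ⟨hgrad, hval⟩
    refine (le_abs_self _).trans ((L.abs_density_le_of_young hA hb hc hα0 _ _ _ _).trans ?_)
    rw [mul_assoc (κ ^ 2 / α)]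
    gcongr
    linarith
  rw [integral_add ((integrableOn_sq_add_norm_gradient_sq hΩ he.1).const_mul _)
    (hE.const_mul _), integral_const_mul, integral_const_mul] at hyoung
  rw [div_mul_eq_mul_div, le_div_iff₀ hα0]
  linarith [form_ge_of_mem_feSpaceZero hΩ hL hα he]

end SimplicialMesh

lemma norm_sub_sq_le_two_mul_add {F : Type*} [SeminormedAddCommGroup F] (a b : F) :
    ‖a - b‖ ^ 2 ≤ 2 * (‖a‖ ^ 2 + ‖b‖ ^ 2) :=
  (pow_le_pow_left₀ (norm_nonneg _) (norm_sub_le a b) 2).trans add_sq_le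

lemma eLpNorm_two_le_of_ae_sq_le {X F : Type*} [MeasurableSpace X] {μ : Measure X}
    [SeminormedAddCommGroup F] {G : X → F} {h : X → ℝ} (hh : Integrable h μ)
    (hG : ∀ᵐ x ∂μ, ‖G x‖ ^ 2 ≤ h x) : eLpNorm G 2 μ ≤ ENNReal.ofReal √(∫ x, h x ∂μ) := by
  have hle : ∫⁻ x, ‖G x‖ₑ ^ (2 : ℝ) ∂μ ≤ ENNReal.ofReal (∫ x, h x ∂μ) := by
    rw [ofReal_integral_eq_lintegral_ofReal hh (hG.mono fun x hx => (sq_nonneg _).trans hx)]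
    refine lintegral_mono_ae (hG.mono fun x hx => ?_)
    rw [← ofReal_norm, ENNReal.ofReal_rpow_of_nonneg (norm_nonneg _) zero_le_two, Real.rpow_two]
    exact ENNReal.ofReal_le_ofReal hx
  rw [eLpNorm_eq_lintegral_rpow_enorm_toReal two_ne_zero ENNReal.ofNat_ne_top,
    ENNReal.toReal_ofNat, Real.sqrt_eq_rpow, ← ENNReal.ofReal_rpow_of_nonneg
      (integral_nonneg_of_ae (hG.mono fun x hx => (sq_nonneg _).trans hx)) (by norm_num)]
  gcongr

/-- Céa's lemma: `E` bounds the pointwise error of a finite element function with the boundary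
values of the finite element solution. -/
theorem exists_quasi_optimality_constant (hΩ : interior (closure Ω) = Ω)
    (hL : L.HasBoundedCoeffs Ω) (hα0 : 0 < α) (hα : L.IsCoercive Ω α) (D : ℝ) :
    ∃ C > 0, ∀ (T : SimplicialMesh Ω) (f u : Euc d → ℝ) (Du : Euc d → Euc d),
      IntegrableOn f Ω → IntegrableOn u Ω → IntegrableOn Du Ω →
      (∀ φ ∈ testFunctions Ω, L.form Ω u Du φ = ∫ x in Ω, f x * φ x) →
      ∀ uh ∈ T.feSpace,
      (∀ v ∈ T.feSpaceZero, L.form Ω uh (gradient uh) v = ∫ x in Ω, f x * v x) →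
      ∀ I ∈ T.feSpace, uh - I ∈ T.feSpaceZero →
      ∀ E : Euc d → ℝ, IntegrableOn E Ω →
      (∀ᵐ x ∂volume.restrict Ω, ‖Du x - gradient I x‖ ^ 2 ≤ E x ∧
        (u x - I x) ^ 2 ≤ D ^ 2 * E x) →
      eLpNorm (fun x => Du x - gradient uh x) 2 (volume.restrict Ω) ≤
        ENNReal.ofReal √(C * ∫ x in Ω, E x) := by
  obtain ⟨κ, -, hκ⟩ := hL.exists_bound
  refine ⟨2 + 2 * (2 * (κ ^ 2 / α * (2 + D ^ 2)) / α), by positivity, ?_⟩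
  intro T f u Du hf hu hDu hweak uh huh hgalerkin I hI he E hE herr
  have hdiscrete := SimplicialMesh.integral_sq_add_norm_gradient_sq_le_of_galerkin hΩ hL hκ hα0
    hα hu hDu huh hI he ((hgalerkin _ he).trans
      (SimplicialMesh.form_eq_of_mem_feSpaceZero hΩ hL hf hu hDu hweak he).symm) hE herr
  have hsq := SimplicialMesh.integrableOn_sq_add_norm_gradient_sq hΩ he.1
  have hpointwise : ∀ᵐ x ∂volume.restrict Ω, ‖Du x - gradient uh x‖ ^ 2 ≤
      2 * (E x + ((uh - I) x ^ 2 + ‖gradient (uh - I) x‖ ^ 2)) := by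
    filter_upwards [herr, SimplicialMesh.ae_gradient_sub hΩ huh hI] with x hIerr hx
    have hsplit : Du x - gradient uh x = (Du x - gradient I x) - gradient (uh - I) x := by
      rw [hx]
      abel
    rw [hsplit]
    linarith [norm_sub_sq_le_two_mul_add (Du x - gradient I x) (gradient (uh - I) x),
      sq_nonneg ((uh - I) x), hIerr.1]
  refine (eLpNorm_two_le_of_ae_sq_le ((hE.add hsq).const_mul 2) hpointwise).trans ?_
  gcongr
  calc ∫ x in Ω, 2 * (E x + ((uh - I) x ^ 2 + ‖gradient (uh - I) x‖ ^ 2))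
      = 2 * (∫ x in Ω, E x) + 2 * ∫ x in Ω, ((uh - I) x ^ 2 + ‖gradient (uh - I) x‖ ^ 2) := by
        rw [integral_const_mul, integral_add hE hsq, mul_add]
    _ ≤ _ := by linarith

end QuasiOptimality

/-! ### Averages over an element and the size of the Hessian -/

section Average

variable {d : ℕ} {s : Finset (Euc d)} {R : Euc d → Matrix (Fin d) (Fin d) ℝ} {γ : ℝ}

lemma integrable_quadForm {X n : Type*} [MeasurableSpace X] {μ : Measure X} [Fintype n]
    [DecidableEq n] {R : X → Matrix n n ℝ} (hR : ∀ i j, Integrable (fun x => R x i j) μ)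
    (v : EuclideanSpace ℝ n) : Integrable (fun x => quadForm (R x) v) μ := by
  simp only [quadForm_eq_sum]
  exact integrable_finsetSum _ fun i _ => integrable_finsetSum _ fun j _ =>
    ((hR i j).mul_const _).mul_const _

lemma quadForm_cellAverage (hR : ∀ i j, IntegrableOn (fun x => R x i j) (cell s)) (v : Euc d) :
    quadForm (cellAverage R s) v = ⨍ x in cell s, quadForm (R x) v := by
  have hterm := fun i j => ((hR i j).mul_const (v i)).mul_const (v j)
  simp only [quadForm_eq_sum, cellAverage, Matrix.of_apply, setAverage_eq, smul_eq_mul]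
  rw [integral_finsetSum _ fun i _ => integrable_finsetSum _ fun j _ => hterm i j]
  simp only [integral_finsetSum _ fun j _ => hterm _ j, integral_mul_const, Finset.mul_sum]
  simp only [mul_assoc]

lemma cellAverage_isHermitian (hR : ∀ᵐ x ∂volume.restrict (cell s), (R x).IsHermitian) :
    (cellAverage R s).IsHermitian := by
  ext i j
  exact average_congr (hR.mono fun x hx => by simpa using hx.apply i j)

lemma cellAverage_posDef (hs : IsSimplex s)
    (hR : ∀ i j, IntegrableOn (fun x => R x i j) (cell s)) (hγ : 0 < γ)
    (hpos : ∀ᵐ x ∂volume.restrict (cell s), (R x - γ • 1).PosSemidef) :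
    (cellAverage R s).PosDef := by
  refine posDef_of_mul_norm_sq_le (cellAverage_isHermitian (hpos.mono fun x hx =>
    (posSemidef_of_sub_smul_one hγ.le hx).1)) hγ fun v => ?_
  have hmono : ∫ _x in cell s, γ * ‖v‖ ^ 2 ≤ ∫ x in cell s, quadForm (R x) v :=
    integral_mono_ae (integrableOn_const (volume_cell_lt_top s).ne) (integrable_quadForm hR v)
      (hpos.mono fun x hx => mul_norm_sq_le_quadForm hx v)
  rw [setIntegral_const, smul_eq_mul] at hmono
  rwa [quadForm_cellAverage hR, setAverage_eq, smul_eq_mul, le_inv_mul_iff₀ hs.volume_real_pos]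

end Average

namespace SimplicialMesh

variable {d : ℕ} {Ω : Set (Euc d)} {T : SimplicialMesh Ω}

lemma integrableOn_cell {E : Type*} [NormedAddCommGroup E] {f : Euc d → E} {s : Finset (Euc d)}
    (hΩ : interior (closure Ω) = Ω) (hf : IntegrableOn f Ω) (hs : s ∈ T.elems) :
    IntegrableOn f (cell s) := by
  rw [IntegrableOn, ← T.restrict_closure hΩ] at hf
  exact IntegrableOn.mono_set hf (T.cell_subset_closure hs)

lemma nonneg_of_isClose [NeZero d] {H : Euc d → Matrix (Fin d) (Fin d) ℝ}
    {S : Matrix (Fin d) (Fin d) ℝ} {a b : ℝ} {s : Finset (Euc d)}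
    (hΩ : interior (closure Ω) = Ω) (hs : s ∈ T.elems) (hS : S.PosDef)
    (hH : ∀ᵐ x ∂volume.restrict Ω, (H x).IsHermitian) (ha : 0 ≤ a) (hclose : IsClose S H s a b) :
    0 ≤ b := by
  have : (ae (volume.restrict (cell s))).NeBot := by
    rw [ae_neBot, Ne, Measure.restrict_eq_zero]
    intro hnull
    simpa [Measure.real, hnull] using (T.isSimplex s hs).volume_real_pos
  obtain ⟨x, hx, hxH⟩ := (hclose.and (T.ae_restrict_cell_of_ae hΩ hH hs)).exists
  exact ha.trans (le_of_spectrum_subset_Icc hS hxH hx)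

/-- The volume of the domain in the piecewise constant Riemannian metric `M`, which the
equidistribution condition divides among the elements. -/
noncomputable def metricVolume (T : SimplicialMesh Ω)
    (M : Finset (Euc d) → Matrix (Fin d) (Fin d) ℝ) : ℝ :=
  ∑ s ∈ T.elems, volume.real (cell s) * (M s).det ^ ((1 : ℝ) / 2)

lemma metricVolume_nonneg {M : Finset (Euc d) → Matrix (Fin d) (Fin d) ℝ}
    (hM : ∀ s ∈ T.elems, (M s).PosSemidef) : 0 ≤ T.metricVolume M :=
  Finset.sum_nonneg fun s hs =>
    mul_nonneg measureReal_nonneg (Real.rpow_nonneg (hM s hs).det_nonneg _)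

lemma posDef_cellAverage {R : Euc d → Matrix (Fin d) (Fin d) ℝ} {γ : ℝ} {s : Finset (Euc d)}
    (hΩ : interior (closure Ω) = Ω) (hR : ∀ i j, IntegrableOn (fun x => R x i j) Ω) (hγ : 0 < γ)
    (hpos : ∀ᵐ x ∂volume.restrict Ω, (R x - γ • 1).PosSemidef) (hs : s ∈ T.elems) :
    (cellAverage R s).PosDef :=
  cellAverage_posDef (T.isSimplex s hs) (fun i j => T.integrableOn_cell hΩ (hR i j) hs) hγ
    (T.ae_restrict_cell_of_ae hΩ hpos hs)

end SimplicialMesh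

section HessianNorm

variable {d : ℕ} [NeZero d] {H : Euc d → Matrix (Fin d) (Fin d) ℝ} {a : ℝ}

lemma ofReal_mul_metric_volume_le_lintegral {S : Matrix (Fin d) (Fin d) ℝ} {s : Finset (Euc d)}
    {b : ℝ} (hS : S.PosDef) (hH : ∀ᵐ x ∂volume.restrict (cell s), (H x).IsHermitian)
    (ha : 0 < a) (hclose : IsClose S H s a b) :
    ENNReal.ofReal ((a ^ 2) ^ ((d : ℝ) / (d + 2)) *
        (volume.real (cell s) * (metricTensor S).det ^ ((1 : ℝ) / 2))) ≤
      ∫⁻ x in cell s, ‖(H x).det ^ ((1 : ℝ) / d) • H x‖ₑ ^ ((d : ℝ) / (d + 2)) := by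
  have hdet := hS.det_pos
  have hpointwise : ∀ᵐ x ∂volume.restrict (cell s),
      ENNReal.ofReal ((a ^ 2 * (S.det ^ ((1 : ℝ) / d) * ‖S‖)) ^ ((d : ℝ) / (d + 2))) ≤
        ‖(H x).det ^ ((1 : ℝ) / d) • H x‖ₑ ^ ((d : ℝ) / (d + 2)) := by
    filter_upwards [hclose, hH] with x hx hxH
    rw [← ofReal_norm, ENNReal.ofReal_rpow_of_nonneg (norm_nonneg _) (by positivity)]
    gcongr
    exact sq_mul_det_rpow_mul_opNorm_le hS hxH ha hx
  calc ENNReal.ofReal ((a ^ 2) ^ ((d : ℝ) / (d + 2)) *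
        (volume.real (cell s) * (metricTensor S).det ^ ((1 : ℝ) / 2)))
      = ENNReal.ofReal ((a ^ 2 * (S.det ^ ((1 : ℝ) / d) * ‖S‖)) ^ ((d : ℝ) / (d + 2))) *
          volume (cell s) := by
        rw [← ENNReal.ofReal_toReal (volume_cell_lt_top s).ne,
          ← ENNReal.ofReal_mul (by positivity), det_metricTensor_rpow_half hS,
          Real.mul_rpow (sq_nonneg a) (by positivity), Measure.real, mul_assoc,
          mul_comm (volume (cell s)).toReal]
    _ = ∫⁻ _x in cell s,
          ENNReal.ofReal ((a ^ 2 * (S.det ^ ((1 : ℝ) / d) * ‖S‖)) ^ ((d : ℝ) / (d + 2))) := by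
        rw [setLIntegral_const]
    _ ≤ _ := lintegral_mono_ae hpointwise

lemma SimplicialMesh.metricVolume_rpow_le_eLpNorm {Ω : Set (Euc d)} {T : SimplicialMesh Ω}
    {S : Finset (Euc d) → Matrix (Fin d) (Fin d) ℝ} {b : Finset (Euc d) → ℝ}
    (hΩ : interior (closure Ω) = Ω) (hS : ∀ s ∈ T.elems, (S s).PosDef)
    (hH : ∀ᵐ x ∂volume.restrict Ω, (H x).IsHermitian) (ha : 0 < a)
    (hclose : ∀ s ∈ T.elems, IsClose (S s) H s a (b s)) :
    ENNReal.ofReal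
        (a ^ 2 * T.metricVolume (fun s => metricTensor (S s)) ^ (((d : ℝ) + 2) / d)) ≤
      eLpNorm (fun x => (H x).det ^ ((1 : ℝ) / d) • H x)
        (ENNReal.ofReal ((d : ℝ) / (d + 2))) (volume.restrict Ω) := by
  have hd : (0 : ℝ) < d := by exact_mod_cast NeZero.pos d
  have hp : 0 < (d : ℝ) / (d + 2) := by positivity
  have hexp : (d : ℝ) / (d + 2) * ((d + 2) / d) = 1 := by field_simp
  set q : Finset (Euc d) → ℝ := fun s =>
    volume.real (cell s) * (metricTensor (S s)).det ^ ((1 : ℝ) / 2)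
  have hq : ∀ s ∈ T.elems, 0 ≤ q s := fun s hs =>
    mul_nonneg measureReal_nonneg
      (Real.rpow_nonneg (metricTensor_posSemidef (hS s hs).posSemidef).det_nonneg _)
  rw [eLpNorm_eq_lintegral_rpow_enorm_toReal (by simpa using hp) ENNReal.ofReal_ne_top,
    ENNReal.toReal_ofReal hp.le, one_div_div, T.lintegral_eq_sum hΩ, metricVolume]
  calc ENNReal.ofReal (a ^ 2 * (∑ s ∈ T.elems, q s) ^ (((d : ℝ) + 2) / d))
      = (∑ s ∈ T.elems, ENNReal.ofReal ((a ^ 2) ^ ((d : ℝ) / (d + 2)) * q s)) ^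
          (((d : ℝ) + 2) / d) := by
        have hQ := Finset.sum_nonneg hq
        rw [← ENNReal.ofReal_sum_of_nonneg fun s hs => mul_nonneg (by positivity) (hq s hs),
          ← Finset.mul_sum, ENNReal.ofReal_rpow_of_nonneg (by positivity) (by positivity),
          Real.mul_rpow (by positivity) hQ, ← Real.rpow_mul (sq_nonneg a), hexp, Real.rpow_one]
    _ ≤ _ := by
        gcongr with s hs
        exact ofReal_mul_metric_volume_le_lintegral (hS s hs)
          (T.ae_restrict_cell_of_ae hΩ hH hs) ha (hclose s hs)

end HessianNorm

/-! ### Interpolation error -/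

section Interpolation

variable {d : ℕ} {Ω : Set (Euc d)} {T : SimplicialMesh Ω} {g u : Euc d → ℝ}
  {Du : Euc d → Euc d} {H : Euc d → Matrix (Fin d) (Fin d) ℝ} {a : ℝ}

lemma ae_quadForm_mem_Icc {S : Matrix (Fin d) (Fin d) ℝ} {s : Finset (Euc d)} {b : ℝ}
    (hS : S.PosDef) (hH : ∀ᵐ x ∂volume.restrict (cell s), (H x).PosSemidef)
    (hclose : IsClose S H s a b) :
    ∀ᵐ x ∂volume.restrict (cell s), ∀ v, quadForm (H x) v ∈ Icc 0 (quadForm (b • S) v) := by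
  filter_upwards [hclose, hH] with x hx hxH v
  rw [quadForm_smul]
  exact ⟨quadForm_nonneg hxH v, (quadForm_bounds_of_spectrum hS hxH.1 hx v).2⟩

lemma SimplicialMesh.exists_ae_norm_le_of_isClose {S : Finset (Euc d) → Matrix (Fin d) (Fin d) ℝ}
    {b : Finset (Euc d) → ℝ} (hΩ : IsOpen Ω) (hS : ∀ s ∈ T.elems, (S s).PosDef)
    (hH : ∀ᵐ x ∂volume.restrict Ω, (H x).PosSemidef) (hb : ∀ s ∈ T.elems, 0 ≤ b s)
    (hclose : ∀ s ∈ T.elems, IsClose (S s) H s a (b s)) :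
    ∃ Λ, 0 ≤ Λ ∧ ∀ᵐ x ∂volume.restrict Ω, ‖H x‖ ≤ Λ := by
  have hterm : ∀ s ∈ T.elems, 0 ≤ b s * ‖S s‖ := fun s hs => mul_nonneg (hb s hs) (norm_nonneg _)
  refine ⟨∑ s ∈ T.elems, b s * ‖S s‖, Finset.sum_nonneg hterm, ?_⟩
  have hspec : ∀ᵐ x, ∀ s ∈ T.elems, x ∈ cell s → spectrum ℝ ((S s)⁻¹ * H x) ⊆ Icc a (b s) :=
    (ae_ball_iff T.elems.countable_toSet).2 fun s hs =>
      (ae_restrict_iff' (measurableSet_cell s)).1 (hclose s hs)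
  filter_upwards [hH, ae_restrict_of_ae hspec, ae_restrict_mem hΩ.measurableSet]
    with x hxH hx hxΩ
  obtain ⟨s, hs, hxs⟩ := T.exists_mem_cell (subset_closure hxΩ)
  exact (opNorm_le_of_spectrum (hS s hs) hxH (hb s hs) (hx s hs hxs)).trans
    (Finset.single_le_sum hterm hs)

/-- The function `q` is the difference of the interpolant `p` and the first order Taylor polynomial
of `u` at `x`; its values at the vertices are second order remainders. -/
lemma interpolation_error_le_of_remainder_mem_Icc [NeZero d] {Khat s : Finset (Euc d)}
    {F : Euc d →ᵃ[ℝ] Euc d} {c x : Euc d} {ρ b : ℝ} {S : Matrix (Fin d) (Fin d) ℝ} {I : Euc d → ℝ}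
    (hF : F '' cell Khat = cell s) (hρ : 0 < ρ) (hball : Metric.closedBall c ρ ⊆ cell Khat)
    (hS : S.PosDef) (hJ : (jacobian F).det ≠ 0) (hb : 0 ≤ b) {p : Euc d →ᵃ[ℝ] ℝ}
    (hp : EqOn I p (cell s)) (hx : x ∈ interior (cell s))
    (hrem : ∀ v ∈ s, I v - u x - inner ℝ (v - x) (Du x) ∈ Icc 0 (b * quadForm S (v - x))) :
    ‖Du x - gradient I x‖ ≤ gradErrorBound Khat ρ b S (jacobian F) ∧
      |u x - I x| ≤ Metric.diam (cell s) * gradErrorBound Khat ρ b S (jacobian F) := by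
  obtain ⟨q, hq, hqlin⟩ := exists_affineMap_sub_taylor p x (u x) (Du x)
  have hmaps := mapsTo_Icc_valueErrorBound hF hS.posSemidef hb (interior_subset hx) (q := q)
    fun v hv => by
      rw [hq, ← hp (subset_cell s hv)]
      exact hrem v hv
  constructor
  · refine norm_le_of_abs_inner_le (gradErrorBound_nonneg hρ hS.posSemidef hb) fun w => ?_
    have hgrad : inner ℝ (gradient I x) w = p.linear w := by
      rw [inner_gradient_left, (SimplicialMesh.hasFDerivAt_of_eqOn_cell hp hx).fderiv]
      rfl
    rw [inner_sub_left, hgrad, abs_sub_comm, ← real_inner_comm, ← hqlin]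
    exact abs_linear_le_gradErrorBound_mul hF hρ hball hS hJ hb hmaps w
  · have hqx : q x = I x - u x := by simp [hq, hp (interior_subset hx)]
    obtain ⟨hlo, hhi⟩ := hmaps (interior_subset hx)
    rw [abs_sub_comm, ← hqx, abs_of_nonneg hlo]
    exact hhi.trans (valueErrorBound_le_diam_mul_gradErrorBound hF hρ hball hS hJ hb)

namespace SimplicialMesh

lemma exists_remainder_mem_Icc {S : Finset (Euc d) → Matrix (Fin d) (Fin d) ℝ}
    {b : Finset (Euc d) → ℝ} (hΩ : interior (closure Ω) = Ω) (hu : IsW21 Ω u Du H)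
    (hg : ∀ z ∈ frontier Ω, Tendsto u (𝓝[Ω] z) (𝓝 (g z)))
    (hH : ∀ᵐ x ∂volume.restrict Ω, (H x).PosSemidef) (hS : ∀ s ∈ T.elems, (S s).PosDef)
    (hb : ∀ s ∈ T.elems, 0 ≤ b s) (hclose : ∀ s ∈ T.elems, IsClose (S s) H s a (b s)) :
    ∃ I ∈ T.feSpace, (∀ z ∈ T.vertices, z ∈ frontier Ω → I z = g z) ∧
      ∀ᵐ x ∂volume.restrict Ω, ∀ s ∈ T.elems, x ∈ interior (cell s) →
        ∀ v ∈ s, I v - u x - inner ℝ (v - x) (Du x) ∈ Icc 0 (b s * quadForm (S s) (v - x)) := by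
  have hopen : IsOpen Ω := hΩ ▸ isOpen_interior
  obtain ⟨Λ, hΛ0, hΛ⟩ := T.exists_ae_norm_le_of_isClose hopen hS hH hb hclose
  obtain ⟨U, hUc, hUu, hUg⟩ := hu.exists_continuousOn_closure hopen hΛ0 hΛ hg
  obtain ⟨I, hI, hIU⟩ := T.exists_interpolant U
  refine ⟨I, hI, fun z hz hzf => (hIU hz).trans (hUg hzf), ?_⟩
  filter_upwards [hu.ae_mem_approxPoints hopen.measurableSet] with x hxG s hs hxs v hv
  rw [hIU ⟨s, hs, hv⟩, ← quadForm_smul]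
  refine hu.remainder_mem_Icc_of_mem_closure hopen.measurableSet hUc hUu isOpen_interior
    (convex_cell s).interior (T.interior_cell_subset hΩ hs) ⟨hxG, hxs⟩ ?_
    ((hS s hs).posSemidef.smul (hb s hs)) (ae_mono (Measure.restrict_mono interior_subset le_rfl)
      (ae_quadForm_mem_Icc (hS s hs) (T.ae_restrict_cell_of_ae hΩ hH hs) (hclose s hs)))
  rw [(T.isSimplex s hs).closure_interior_cell]
  exact subset_cell s hv

lemma exists_interpolation_error_le [NeZero d] {Khat : Finset (Euc d)} {c : Euc d} {ρ : ℝ}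
    {F : Finset (Euc d) → Euc d →ᵃ[ℝ] Euc d} {S : Finset (Euc d) → Matrix (Fin d) (Fin d) ℝ}
    {b : Finset (Euc d) → ℝ} (hvol : volume (cell Khat) = 1) (hρ : 0 < ρ)
    (hball : Metric.closedBall c ρ ⊆ cell Khat) (hΩ : interior (closure Ω) = Ω)
    (hu : IsW21 Ω u Du H) (hg : ∀ z ∈ frontier Ω, Tendsto u (𝓝[Ω] z) (𝓝 (g z)))
    (hH : ∀ᵐ x ∂volume.restrict Ω, (H x).PosSemidef) (hF : T.IsReferenceMap Khat F)
    (hS : ∀ s ∈ T.elems, (S s).PosDef) (hb : ∀ s ∈ T.elems, 0 ≤ b s)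
    (hclose : ∀ s ∈ T.elems, IsClose (S s) H s a (b s)) :
    ∃ I ∈ T.feSpace, (∀ z ∈ T.vertices, z ∈ frontier Ω → I z = g z) ∧
      ∀ᵐ x ∂volume.restrict Ω, ∃ s ∈ T.elems, x ∈ cell s ∧
        ‖Du x - gradient I x‖ ≤ gradErrorBound Khat ρ (b s) (S s) (jacobian (F s)) ∧
        |u x - I x| ≤
          Metric.diam (closure Ω) * gradErrorBound Khat ρ (b s) (S s) (jacobian (F s)) := by
  obtain ⟨I, hI, hIg, hrem⟩ := T.exists_remainder_mem_Icc hΩ hu hg hH hS hb hclose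
  refine ⟨I, hI, hIg, ?_⟩
  filter_upwards [hrem, T.restrict_closure hΩ ▸ T.ae_mem_interior_cell] with x hx hxcell
  obtain ⟨s, hs, hxs⟩ := hxcell
  obtain ⟨p, hp⟩ := hI s hs
  have hJ : (jacobian (F s)).det ≠ 0 := by
    rw [← abs_pos, ← volume_real_cell_eq hvol (hF s hs)]
    exact (T.isSimplex s hs).volume_real_pos
  obtain ⟨hgrad, hval⟩ := interpolation_error_le_of_remainder_mem_Icc (hF s hs) hρ hball (hS s hs)
    hJ (hb s hs) hp hxs (hx s hs hxs)
  refine ⟨s, hs, interior_subset hxs, hgrad, hval.trans (mul_le_mul_of_nonneg_right ?_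
    (gradErrorBound_nonneg hρ (hS s hs).posSemidef (hb s hs)))⟩
  exact Metric.diam_mono (T.cell_subset_closure hs) T.isCompact_closure.isBounded

end SimplicialMesh

end Interpolation

/-! ### Summation over the elements -/

lemma sum_sq_mul_rpow_le_of_equidistribution {ι : Type*} {t : Finset ι} {q b : ι → ℝ}
    {c β r : ℝ} (hr : 0 ≤ r) (hc : 0 ≤ c) (hq : ∀ s ∈ t, 0 ≤ q s)
    (heq : ∀ s ∈ t, q s ≤ c * (1 / (t.card : ℝ) * ∑ i ∈ t, q i))
    (hb : √(1 / (t.card : ℝ) * ∑ s ∈ t, b s ^ 2) ≤ β) :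
    ∑ s ∈ t, b s ^ 2 * q s ^ r ≤
      c ^ r * β ^ 2 * (t.card : ℝ) ^ (1 - r) * (∑ s ∈ t, q s) ^ r := by
  have hQ : 0 ≤ ∑ s ∈ t, q s := Finset.sum_nonneg hq
  rcases t.eq_empty_or_nonempty with rfl | ht
  · simp only [Finset.sum_empty, Finset.card_empty, Nat.cast_zero]
    positivity
  have hN : (0 : ℝ) < t.card := by exact_mod_cast ht.card_pos
  have hbsum : ∑ s ∈ t, b s ^ 2 ≤ t.card * β ^ 2 := by
    simpa only [one_div, inv_mul_le_iff₀ hN] using (Real.sqrt_le_iff.1 hb).2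
  calc ∑ s ∈ t, b s ^ 2 * q s ^ r
      ≤ ∑ s ∈ t, b s ^ 2 * (c * (1 / (t.card : ℝ) * ∑ i ∈ t, q i)) ^ r := by
        gcongr with s hs
        exacts [hq s hs, heq s hs]
    _ = (∑ s ∈ t, b s ^ 2) * (c * (1 / (t.card : ℝ) * ∑ i ∈ t, q i)) ^ r := by
        rw [Finset.sum_mul]
    _ ≤ t.card * β ^ 2 * (c * (1 / (t.card : ℝ) * ∑ i ∈ t, q i)) ^ r := by gcongr
    _ = c ^ r * β ^ 2 * (t.card : ℝ) ^ (1 - r) * (∑ s ∈ t, q s) ^ r := by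
        rw [Real.mul_rpow hc (by positivity), Real.mul_rpow (by positivity) hQ, one_div,
          Real.inv_rpow hN.le, Real.rpow_sub hN, Real.rpow_one]
        ring

namespace SimplicialMesh

variable {d : ℕ} {Ω : Set (Euc d)} {T : SimplicialMesh Ω} {c : Finset (Euc d) → ℝ}

/-- The function with value `c s` in the interior of every element `s`; where elements overlap,
their values are added. -/
noncomputable def piecewiseConst (T : SimplicialMesh Ω) (c : Finset (Euc d) → ℝ) : Euc d → ℝ :=
  fun x => ∑ s ∈ T.elems, (cell s).indicator (fun _ => c s) x

lemma le_piecewiseConst (hc : ∀ s ∈ T.elems, 0 ≤ c s) {s : Finset (Euc d)} (hs : s ∈ T.elems)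
    {x : Euc d} (hx : x ∈ cell s) : c s ≤ T.piecewiseConst c x := by
  have h := Finset.single_le_sum (f := fun s => (cell s).indicator (fun _ => c s) x)
    (fun t ht => indicator_nonneg (fun _ _ => hc t ht) x) hs
  simpa only [piecewiseConst, indicator_of_mem hx] using h

lemma integrable_indicator_cell (T : SimplicialMesh Ω) (s : Finset (Euc d)) (y : ℝ) :
    Integrable ((cell s).indicator fun _ => y) (volume.restrict Ω) :=
  have := T.isFiniteMeasure_restrict
  (integrable_const y).indicator (measurableSet_cell s)

lemma integrableOn_piecewiseConst : IntegrableOn (T.piecewiseConst c) Ω :=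
  integrable_finsetSum _ fun s _ => T.integrable_indicator_cell s (c s)

lemma integral_piecewiseConst_le (hc : ∀ s ∈ T.elems, 0 ≤ c s) :
    ∫ x in Ω, T.piecewiseConst c x ≤ ∑ s ∈ T.elems, volume.real (cell s) * c s := by
  simp only [piecewiseConst]
  rw [integral_finsetSum _ fun s _ => T.integrable_indicator_cell s (c s)]
  refine Finset.sum_le_sum fun s hs => ?_
  rw [integral_indicator_const _ (measurableSet_cell s), smul_eq_mul]
  exact mul_le_mul_of_nonneg_right
    (ENNReal.toReal_mono (volume_cell_lt_top s).ne (Measure.restrict_apply_le _ _)) (hc s hs)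

lemma sum_mul_gradErrorBound_sq_le [NeZero d] {Khat : Finset (Euc d)}
    {F : Finset (Euc d) → Euc d →ᵃ[ℝ] Euc d} {S : Finset (Euc d) → Matrix (Fin d) (Fin d) ℝ}
    {b : Finset (Euc d) → ℝ} {ρ β Ceq Cali : ℝ} (hvol : volume (cell Khat) = 1)
    (hF : T.IsReferenceMap Khat F) (hS : ∀ s ∈ T.elems, (S s).PosDef)
    (hM : IsQuasiMUniform T F (fun s => metricTensor (S s)) Ceq Cali)
    (hb : √(1 / (T.numElems : ℝ) * ∑ s ∈ T.elems, b s ^ 2) ≤ β) :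
    ∑ s ∈ T.elems,
        volume.real (cell s) * gradErrorBound Khat ρ (b s) (S s) (jacobian (F s)) ^ 2 ≤
      (Metric.diam (cell Khat) ^ 2 / ρ) ^ 2 * (d : ℝ) ^ (d + 1) * (Cali ^ (d + 1) *
        (Ceq ^ (((d : ℝ) + 2) / d) * β ^ 2 * (T.numElems : ℝ) ^ (-(2 : ℝ) / d) *
          T.metricVolume (fun s => metricTensor (S s)) ^ (((d : ℝ) + 2) / d))) := by
  have hd : (d : ℝ) ≠ 0 := NeZero.ne _
  have hCali : 0 ≤ Cali := zero_le_one.trans hM.one_le_Cali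
  have hexp : -(2 : ℝ) / d = 1 - ((d : ℝ) + 2) / d := by
    field_simp
    ring
  have hq : ∀ s ∈ T.elems, 0 ≤ volume.real (cell s) * (metricTensor (S s)).det ^ ((1 : ℝ) / 2) :=
    fun s hs => mul_nonneg measureReal_nonneg
      (Real.rpow_nonneg (metricTensor_posSemidef (hS s hs).posSemidef).det_nonneg _)
  rw [hexp]
  refine (Finset.sum_le_sum fun s hs => mul_gradErrorBound_sq_le (hS s hs)
    (volume_real_cell_eq hvol (hF s hs)) (T.isSimplex s hs).volume_real_pos
    (hM.alignment s hs)).trans ?_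
  calc _ = (Metric.diam (cell Khat) ^ 2 / ρ) ^ 2 * (d : ℝ) ^ (d + 1) * (Cali ^ (d + 1) *
        ∑ s ∈ T.elems, b s ^ 2 * (volume.real (cell s) *
          (metricTensor (S s)).det ^ ((1 : ℝ) / 2)) ^ (((d : ℝ) + 2) / d)) := by
        simp only [Finset.mul_sum, mul_pow]
        exact Finset.sum_congr rfl fun s _ => by ring
    _ ≤ _ := by
        gcongr
        exact sum_sq_mul_rpow_le_of_equidistribution (by positivity)
          (zero_le_one.trans hM.one_le_Ceq) hq hM.equidistribution hb

end SimplicialMesh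

/-! ### The error estimate -/

lemma sqrt_mul_error_constant {d : ℕ} {Cali Ceq a β K N Q : ℝ} (hK : 0 ≤ K)
    (hCali : 0 ≤ Cali) (hCeq : 0 ≤ Ceq) (ha : 0 < a) (hβ : 0 ≤ β) (hN : 0 ≤ N) :
    √(K * (Cali ^ (d + 1) * (Ceq ^ (((d : ℝ) + 2) / d) * β ^ 2 * N ^ (-(2 : ℝ) / d) *
        Q ^ (((d : ℝ) + 2) / d)))) =
      √K * Cali ^ (((d : ℝ) + 1) / 2) * Ceq ^ (((d : ℝ) + 2) / (2 * d)) * (β / a) *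
        N ^ (-(1 : ℝ) / d) * (a ^ 2 * Q ^ (((d : ℝ) + 2) / d)) ^ ((1 : ℝ) / 2) := by
  have hsqrt : ∀ {x : ℝ} (p : ℝ), 0 ≤ x → √(x ^ p) = x ^ (p / 2) := fun p hx => by
    rw [Real.sqrt_eq_rpow, ← Real.rpow_mul hx, mul_one_div]
  have hCali_sqrt : √(Cali ^ (d + 1)) = Cali ^ (((d : ℝ) + 1) / 2) := by
    rw [← Real.rpow_natCast, hsqrt _ hCali, Nat.cast_add_one]
  have hexpN : -(2 : ℝ) / d / 2 = -1 / d := by ring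
  have hexpCeq : ((d : ℝ) + 2) / d / 2 = (d + 2) / (2 * d) := by rw [div_div, mul_comm]
  rw [← Real.sqrt_eq_rpow, Real.sqrt_mul hK, Real.sqrt_mul (by positivity),
    Real.sqrt_mul (by positivity), Real.sqrt_mul (by positivity), Real.sqrt_mul (by positivity),
    Real.sqrt_mul (sq_nonneg a), Real.sqrt_sq hβ, Real.sqrt_sq ha.le, hCali_sqrt, hsqrt _ hCeq,
    hsqrt _ hN, hexpN, hexpCeq]
  field_simp

lemma IsSimplex.exists_closedBall_subset_cell {d : ℕ} {s : Finset (Euc d)} (hs : IsSimplex s) :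
    ∃ c : Euc d, ∃ ρ > 0, Metric.closedBall c ρ ⊆ cell s := by
  obtain ⟨c, hc⟩ := hs.interior_cell_nonempty
  exact ⟨c, Metric.nhds_basis_closedBall.mem_iff.1 (mem_interior_iff_mem_nhds.1 hc)⟩

section ErrorEstimate

variable {d : ℕ} [NeZero d] {Khat : Finset (Euc d)} {Ω : Set (Euc d)} {T : SimplicialMesh Ω}
  {F : Finset (Euc d) → Euc d →ᵃ[ℝ] Euc d} {S : Finset (Euc d) → Matrix (Fin d) (Fin d) ℝ}
  {H : Euc d → Matrix (Fin d) (Fin d) ℝ} {b : Finset (Euc d) → ℝ} {a β ρ Ceq Cali : ℝ}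

namespace SimplicialMesh

lemma exists_interpolation_error_density {g u : Euc d → ℝ} {Du : Euc d → Euc d} {c : Euc d}
    (hvol : volume (cell Khat) = 1) (hρ : 0 < ρ) (hball : Metric.closedBall c ρ ⊆ cell Khat)
    (hΩ : interior (closure Ω) = Ω) (hu : IsW21 Ω u Du H)
    (hg : ∀ z ∈ frontier Ω, Tendsto u (𝓝[Ω] z) (𝓝 (g z)))
    (hH : ∀ᵐ x ∂volume.restrict Ω, (H x).PosSemidef) (hF : T.IsReferenceMap Khat F)
    (hS : ∀ s ∈ T.elems, (S s).PosDef) (ha : 0 ≤ a)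
    (hclose : ∀ s ∈ T.elems, IsClose (S s) H s a (b s))
    (hb : √(1 / (T.numElems : ℝ) * ∑ s ∈ T.elems, b s ^ 2) ≤ β)
    (hM : IsQuasiMUniform T F (fun s => metricTensor (S s)) Ceq Cali) :
    ∃ I ∈ T.feSpace, (∀ z ∈ T.vertices, z ∈ frontier Ω → I z = g z) ∧
      ∃ E, IntegrableOn E Ω ∧ (∀ᵐ x ∂volume.restrict Ω, ‖Du x - gradient I x‖ ^ 2 ≤ E x ∧
        (u x - I x) ^ 2 ≤ Metric.diam (closure Ω) ^ 2 * E x) ∧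
      ∫ x in Ω, E x ≤ (Metric.diam (cell Khat) ^ 2 / ρ) ^ 2 * (d : ℝ) ^ (d + 1) *
        (Cali ^ (d + 1) * (Ceq ^ (((d : ℝ) + 2) / d) * β ^ 2 * (T.numElems : ℝ) ^ (-(2 : ℝ) / d) *
          T.metricVolume (fun s => metricTensor (S s)) ^ (((d : ℝ) + 2) / d))) := by
  have hb0 : ∀ s ∈ T.elems, 0 ≤ b s := fun s hs =>
    T.nonneg_of_isClose hΩ hs (hS s hs) (hH.mono fun x hx => hx.1) ha (hclose s hs)
  obtain ⟨I, hI, hIg, herr⟩ :=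
    T.exists_interpolation_error_le hvol hρ hball hΩ hu hg hH hF hS hb0 hclose
  set η : Finset (Euc d) → ℝ := fun s => gradErrorBound Khat ρ (b s) (S s) (jacobian (F s))
  have hη : ∀ s ∈ T.elems, 0 ≤ η s ^ 2 := fun s _ => sq_nonneg (η s)
  refine ⟨I, hI, hIg, T.piecewiseConst (η · ^ 2), integrableOn_piecewiseConst, ?_,
    (integral_piecewiseConst_le hη).trans (sum_mul_gradErrorBound_sq_le hvol hF hS hM hb)⟩
  filter_upwards [herr] with x ⟨s, hs, hxs, hgrad, hval⟩
  have hE : η s ^ 2 ≤ T.piecewiseConst (η · ^ 2) x := le_piecewiseConst hη hs hxs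
  constructor
  · exact (pow_le_pow_left₀ (norm_nonneg _) hgrad 2).trans hE
  · calc (u x - I x) ^ 2 = |u x - I x| ^ 2 := (sq_abs _).symm
      _ ≤ (Metric.diam (closure Ω) * η s) ^ 2 := pow_le_pow_left₀ (abs_nonneg _) hval 2
      _ ≤ _ := by
        rw [mul_pow]
        gcongr

lemma ofReal_sqrt_error_bound_le_eLpNorm {K : ℝ} (hΩ : interior (closure Ω) = Ω)
    (hS : ∀ s ∈ T.elems, (S s).PosDef) (hH : ∀ᵐ x ∂volume.restrict Ω, (H x).IsHermitian)
    (hK : 0 ≤ K) (hCali : 0 ≤ Cali) (hCeq : 0 ≤ Ceq) (ha : 0 < a) (hβ : 0 ≤ β)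
    (hclose : ∀ s ∈ T.elems, IsClose (S s) H s a (b s)) :
    ENNReal.ofReal √(K * (Cali ^ (d + 1) * (Ceq ^ (((d : ℝ) + 2) / d) * β ^ 2 *
        (T.numElems : ℝ) ^ (-(2 : ℝ) / d) *
          T.metricVolume (fun s => metricTensor (S s)) ^ (((d : ℝ) + 2) / d)))) ≤
      ENNReal.ofReal (√K * Cali ^ (((d : ℝ) + 1) / 2) * Ceq ^ (((d : ℝ) + 2) / (2 * d)) * (β / a) *
          (T.numElems : ℝ) ^ (-(1 : ℝ) / d)) *
        eLpNorm (fun x => (H x).det ^ ((1 : ℝ) / d) • H x)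
          (ENNReal.ofReal ((d : ℝ) / (d + 2))) (volume.restrict Ω) ^ ((1 : ℝ) / 2) := by
  have hQ : 0 ≤ T.metricVolume (fun s => metricTensor (S s)) :=
    metricVolume_nonneg fun s hs => metricTensor_posSemidef (hS s hs).posSemidef
  rw [sqrt_mul_error_constant hK hCali hCeq ha hβ (Nat.cast_nonneg _),
    ENNReal.ofReal_mul (by positivity),
    ← ENNReal.ofReal_rpow_of_nonneg (by positivity) (by norm_num)]
  gcongr
  exact metricVolume_rpow_le_eLpNorm hΩ hS hH ha hclose

end SimplicialMesh

end ErrorEstimate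

theorem theorem2p1_general {d : ℕ} [NeZero d] {Khat : Finset (Euc d)} (hKhat : IsSimplex Khat)
    (hvol : volume (cell Khat) = 1) {Ω : Set (Euc d)} (hΩ : interior (closure Ω) = Ω)
    {L : SecondOrderOperator d} (hL : L.HasBoundedCoeffs Ω) {α : ℝ} (hα0 : 0 < α)
    (hα : L.IsCoercive Ω α) :
    ∃ C : ℝ, 0 < C ∧
      ∀ (f g u : Euc d → ℝ) (Du : Euc d → Euc d) (H : Euc d → Matrix (Fin d) (Fin d) ℝ),
      IntegrableOn f Ω → IsW21 Ω u Du H → IsBVPSolution L Ω f g u Du →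
      (∀ᵐ x ∂volume.restrict Ω, (H x).PosSemidef) →
      ∀ (T : SimplicialMesh Ω) (F : Finset (Euc d) → Euc d →ᵃ[ℝ] Euc d) (uh : Euc d → ℝ),
      T.IsReferenceMap Khat F → IsFESolution L T f g uh →
      ∀ S : Finset (Euc d) → Matrix (Fin d) (Fin d) ℝ, (∀ s ∈ T.elems, (S s).PosDef) →
      ∀ (CRpK : Finset (Euc d) → ℝ) (CRm CRp : ℝ), 0 < CRm →
      (∀ s ∈ T.elems, IsClose (S s) H s CRm (CRpK s)) →
      √(1 / (T.numElems : ℝ) * ∑ s ∈ T.elems, CRpK s ^ 2) ≤ CRp →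
      ∀ Ceq Cali : ℝ, IsQuasiMUniform T F (fun s => metricTensor (S s)) Ceq Cali →
      eLpNorm (fun x => Du x - gradient uh x) 2 (volume.restrict Ω) ≤
        ENNReal.ofReal (C * Cali ^ (((d : ℝ) + 1) / 2) * Ceq ^ (((d : ℝ) + 2) / (2 * d))
            * (CRp / CRm) * (T.numElems : ℝ) ^ (-(1 : ℝ) / d))
          * eLpNorm (fun x => (H x).det ^ ((1 : ℝ) / d) • H x)
              (ENNReal.ofReal ((d : ℝ) / (d + 2))) (volume.restrict Ω) ^ ((1 : ℝ) / 2) := by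
  obtain ⟨c, ρ, hρ, hball⟩ := hKhat.exists_closedBall_subset_cell
  obtain ⟨Cq, hCq, hquasi⟩ :=
    exists_quasi_optimality_constant hΩ hL hα0 hα (Metric.diam (closure Ω))
  set K : ℝ := Cq * ((Metric.diam (cell Khat) ^ 2 / ρ) ^ 2 * (d : ℝ) ^ (d + 1))
  have : 0 ≤ K := by positivity
  refine ⟨√(K + 1), by positivity, ?_⟩
  intro f g u Du H hf hu hsol hH T F uh hF huh S hS CRpK CRm CRp hCRm hclose hmean Ceq Cali hM
  have hCRp : 0 ≤ CRp := (Real.sqrt_nonneg _).trans hmean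
  have hCali : 0 ≤ Cali := zero_le_one.trans hM.one_le_Cali
  have hCeq : 0 ≤ Ceq := zero_le_one.trans hM.one_le_Ceq
  have hQ : 0 ≤ T.metricVolume (fun s => metricTensor (S s)) :=
    SimplicialMesh.metricVolume_nonneg fun s hs => metricTensor_posSemidef (hS s hs).posSemidef
  obtain ⟨I, hI, hIg, E, hE, herr, hEle⟩ := T.exists_interpolation_error_density hvol hρ hball hΩ hu
    hsol.boundary hH hF hS hCRm.le hclose hmean hM
  have hzero : uh - I ∈ T.feSpaceZero := T.mem_feSpaceZero hΩ (T.sub_mem_feSpace huh.mem hI)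
    fun z hz hzf => sub_eq_zero.2 ((huh.boundary z hz hzf).trans (hIg z hz hzf).symm)
  refine (hquasi T f u Du hf hu.integrableOn hu.integrableOn_grad hsol.weak_form uh huh.mem
    huh.galerkin I hI hzero E hE herr).trans ?_
  refine (ENNReal.ofReal_le_ofReal (Real.sqrt_le_sqrt ?_)).trans
    (T.ofReal_sqrt_error_bound_le_eLpNorm hΩ hS (hH.mono fun x hx => hx.1) (by positivity) hCali
      hCeq hCRm hCRp hclose)
  calc Cq * ∫ x in Ω, E x ≤ _ := mul_le_mul_of_nonneg_left hEle hCq.le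
    _ = K * _ := (mul_assoc _ _ _).symm
    _ ≤ (K + 1) * _ := by gcongr; linarith

theorem theorem2p1 (d : ℕ) (hd : 1 ≤ d)
    -- the reference element, of unit volume
    (Khat : Finset (Euc d)) (hKhat : IsSimplex Khat) (hvol : volume (cell Khat) = 1)
    (Ω : Set (Euc d)) (hΩ : IsPolyhedralDomain Ω)
    (L : SecondOrderOperator d) (hL : L.IsElliptic Ω) :
    ∃ C : ℝ, 0 < C ∧
      -- the boundary value problem and its solution in `H²(Ω)` with uniformly positive Hessian
      ∀ (f g u : Euc d → ℝ) (Du : Euc d → Euc d) (H : Euc d → Matrix (Fin d) (Fin d) ℝ),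
      MemLp f 2 (volume.restrict Ω) →
      IsH2 Ω u Du H →
      IsBVPSolution L Ω f g u Du →
      (∃ γ > (0 : ℝ), ∀ᵐ x ∂(volume.restrict Ω), (H x - γ • 1).PosSemidef) →
      -- the mesh and the finite element solution on it
      ∀ (T : SimplicialMesh Ω) (F : Finset (Euc d) → Euc d →ᵃ[ℝ] Euc d) (uh : Euc d → ℝ),
      T.IsReferenceMap Khat F →
      IsFESolution L T f g uh →
      -- the recovered Hessian
      ∀ R : Euc d → Matrix (Fin d) (Fin d) ℝ,
      (∀ i j, IntegrableOn (fun x => R x i j) Ω) →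
      (∃ γ > (0 : ℝ), ∀ x ∈ Ω, (R x - γ • 1).PosSemidef) →
      -- the closeness constants
      ∀ (CRmK CRpK : Finset (Euc d) → ℝ) (CRm CRp : ℝ), 0 < CRm → 0 < CRp →
      (∀ s ∈ T.elems, IsClose (cellAverage R s) H s (CRmK s) (CRpK s)) →
      (∀ s ∈ T.elems, CRm ≤ CRmK s) →
      √(1 / (T.numElems : ℝ) * ∑ s ∈ T.elems, CRpK s ^ 2) ≤ CRp →
      -- the mesh conditions
      ∀ Ceq Cali : ℝ,
      IsQuasiMUniform T F (fun s => metricTensor (cellAverage R s)) Ceq Cali →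
      eLpNorm (fun x => Du x - gradient uh x) 2 (volume.restrict Ω) ≤
        ENNReal.ofReal (C * Cali ^ (((d : ℝ) + 1) / 2) * Ceq ^ (((d : ℝ) + 2) / (2 * d))
            * (CRp / CRm) * (T.numElems : ℝ) ^ (-(1 : ℝ) / d))
          * eLpNorm (fun x => (H x).det ^ ((1 : ℝ) / d) • H x)
              (ENNReal.ofReal ((d : ℝ) / (d + 2))) (volume.restrict Ω) ^ ((1 : ℝ) / 2) := by
  have : NeZero d := ⟨Nat.one_le_iff_ne_zero.1 hd⟩
  obtain ⟨α, hα0, hα⟩ := hL.coercive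
  obtain ⟨C, hC, h⟩ := theorem2p1_general hKhat hvol hΩ.interior_closure
    ⟨hL.memLp_A, hL.memLp_b, hL.memLp_c⟩ hα0 hα
  refine ⟨C, hC, ?_⟩
  intro f g u Du H hf hu hsol ⟨γ, hγ, hHγ⟩ T F uh hF huh R hR ⟨δ, hδ, hRδ⟩ CRmK CRpK CRm CRp hCRm _
    hclose hmin hmean Ceq Cali hM
  have := T.isFiniteMeasure_restrict
  have hR_pos : ∀ᵐ x ∂volume.restrict Ω, (R x - δ • 1).PosSemidef :=
    (ae_restrict_mem hΩ.isOpen.measurableSet).mono hRδ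
  exact h f g u Du H (hf.integrable one_le_two) hu.isW21 hsol
    (hHγ.mono fun x hx => posSemidef_of_sub_smul_one hγ.le hx) T F uh hF huh (cellAverage R)
    (fun s hs => T.posDef_cellAverage hΩ.interior_closure hR hδ hR_pos hs) CRpK CRm CRp hCRm
    (fun s hs => (hclose s hs).mono fun x hx => hx.trans (Icc_subset_Icc_left (hmin s hs)))
    hmean Ceq Cali hM
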